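/- Throughout, $\beta\in\mathbb R$, $\varepsilon\in\{1,-1\}$, $k\ge 1$, the bar is complex conjugation, and $\partial_x^{-1}f(x)=-\int_x^\infty f$. **NLS hierarchy.** For a function $u(x,t)$, $x\ge 0$, rapidly decreasing as $x\to\infty$, put $a_0=\frac i2$, $b_0=c_0=0$, $a_1=0$, $b_1=\bar u$, $c_1=-u$, and for $j\ge 1$ $$c_{j+1}=-i\partial_xc_j-2iu\,\partial_x^{-1}(\bar uc_j+ub_j),\quad b_{j+1}=i\partial_xb_j+2i\bar u\,\partial_x^{-1}(\bar uc_j+ub_j),\quad a_{j+1}=-\partial_x^{-1}(\bar uc_{j+1}+ub_{j+1}).$$ Let $U(\lambda)=\begin{pmatrix}\lambda/2i&-\bar u\\u&-\lambda/2i\end{pmatrix}$ and $V^{(n)}(\lambda)=\sum_{j=0}^n\lambda^{n-j}\begin{pmatrix}a_j&b_j\\c_j&-a_j\end{pmatrix}$. The $n$-th NLS equation is $u_t=ic_{n+1}$. Solutions are smooth on $[0,\infty)\times J$, where $J\subset\mathbb R$ is an open set of times, and are rapidly decreasing with all $x$-derivatives as $x\to\infty$, locally uniformly in $t$; in the odd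 case $J=-J$, and a hat denotes time reversal, $\hat u(x,t)=u(x,-t)$. *Even order, boundary conditions (E)* for $n=2k$, with $\Omega_1=\sqrt{\beta^2-4|u|^2}$: at $x=0$, $$c_{2l+1}-2iua_{2l}-i\Omega_1c_{2l}=0\ (1\le l\le k-1),\qquad u_t+2ua_{n}+\Omega_1c_{n}=0.$$ *Odd order, boundary conditions (O)* for $n=2k+1$, with $\Omega_2=\sqrt{\beta^2-|u-\varepsilon\hat u|^2}$: at $x=0$, $$(-1)^{j+1}\varepsilon\hat c_j-c_j-i(\varepsilon\hat u-u)\big((-1)^{j-1}\hat a_{j-1}+a_{j-1}\big)+i\Omega_2\big((-1)^j\varepsilon\hat c_{j-1}+c_{j-1}\big)=0\ (2\le j\le 2k+1),$$ $$\varepsilon\hat u_t-u_t+(\varepsilon\hat u-u)(a_n-\hat a_n)-\Omega_2(c_n+\varepsilon\hat c_n)=0.$$ The quantities under the roots are assumed to be positive at $x=0$. With $u,\hat u$ taken at $x=0$ let, respectively, $$K(\lambda)=\lambda I+\begin{pmatrix}-i\Omega_1&2i\bar u\\2iu&i\Omega_1\end{pmatrix},\qquad K(\lambda)=\lambda\begin{pmatrix}-\varepsilon&0\\0&1\end{pmatrix}+\begin{pmatrix}i\varepsilon\Omega_2&i(\bar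 u-\varepsilon\bar{\hat u})\\i(\hat u-\varepsilon u)&i\Omega_2\end{pmatrix}.$$ The second matrix and $\Omega_2$ depend only on $\mathfrak u=\varepsilon\hat u-u$ at $x=0$. **Monodromy matrices.** $T_L(\lambda)$ is the path-ordered exponential of $\int_0^LU(x,\lambda)\,dx$, and $\hat T_L$ the same for $\hat u$. Put $\tau_L(\lambda)=T_L(\lambda)K(\lambda)T_L(-\lambda)^{-1}$ in the even case and $\tau_L(\lambda)=T_L(\lambda)K(\lambda)\hat T_L(-\lambda)^{-1}$ in the odd case. The monodromy matrix $\tau(\lambda)$ of the half-line is, for real $\lambda$, defined in the same way from the limit $\lim_{L\to\infty}e^{i\lambda L\sigma_3/2}T_L(\lambda)$ (and its analogue for $\hat u$), where $\sigma_3=\operatorname{diag}(1,-1)$. For $\operatorname{Im}\lambda<0$ the symbol $\operatorname{tr}\tau(\lambda)$ stands for $\lim_{L\to\infty}e^{-i\lambda L}\operatorname{tr}\tau_L(\lambda)$. **Poisson brackets.** In the even case the phase space consists of pairs $(u,z)$, where $u$ is a smooth rapidly decreasing function on $[0,\infty)$ and $z\in\mathbb C$, $4|z|^2<\beta^2$,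 is the boundary variable $u|_{x=0}$ in $K$. In the odd case it consists of triples $(u,\hat u,z)$, with $u,\hat u$ two such functions and $z\in\mathbb C$, $|z|^2<\beta^2$, the boundary variable $\mathfrak u$. The bracket is the one for which the fields are canonical, $\{u(x),\bar u(y)\}=i\delta(x-y)$, $\{\hat u(x),\bar{\hat u}(y)\}=i\delta(x-y)$, the fields $u$, $\hat u$ and the boundary variable Poisson commute with each other, and $\{z,\bar z\}=\theta(z)$ for some function $\theta$. Let $r(\lambda)=P/\lambda$, with $P$ the permutation matrix of $\mathbb C^2\otimes\mathbb C^2$, $K_1=K\otimes I$, $K_2=I\otimes K$. **Theorem.** The above limits exist, and the following hold. 1. *(Boundary equations.)* Let $u$ solve the $2k$-th NLS equation. At each time, (E) holds if and only if, for all $\lambda\in\mathbb C$, $$\frac{dK(\lambda)}{dt}=V^{(2k)}(0,t,\lambda)K(\lambda)-K(\lambda)V^{(2k)}(0,t,-\lambda).$$ Let $u$ solve the $(2k+1)$-th NLS equation. At each time, (O) holds if and only if, for all $\lambda\in\mathbb C$, $$\frac{dK(\lambda)}{dt}=V^{(2k+1)}(0,t,\lambda)K(\lambda)+K(\lambda)V^{(2k+1)}(0,-t,-\lambda).$$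 2. *(Poisson algebras.)* In the even case the relations $$\{K_1(\lambda),K_2(\mu)\}=[r(\lambda-\mu),K_1(\lambda)K_2(\mu)]+K_1(\lambda)r(\lambda+\mu)K_2(\mu)-K_2(\mu)r(\lambda+\mu)K_1(\lambda)\quad(\lambda\ne\pm\mu)$$ hold if and only if $\{z,\bar z\}=-i\Omega_1$ with $\Omega_1=\sqrt{\beta^2-4|z|^2}$. In the odd case the relations $$\{K_1(\lambda),K_2(\mu)\}=[r(\lambda-\mu),K_1(\lambda)K_2(\mu)]\quad(\lambda\ne\mu)$$ hold if and only if $\{z,\bar z\}=-2i\Omega_2$ with $\Omega_2=\sqrt{\beta^2-|z|^2}$. 3. *(Conservation.)* Along every solution of the $2k$-th equation that satisfies (E), and along every solution of the $(2k+1)$-th equation that satisfies (O), $\operatorname{tr}\tau(\lambda)$ is conserved, $\frac{d}{dt}\operatorname{tr}\tau(\lambda)=0$, for all $\lambda$ that are real or satisfy $\operatorname{Im}\lambda<0$. On the whole phase space $\operatorname{tr}\tau(\lambda)/\lambda$ has, as $i\lambda\to+\infty$, an asymptotic expansion $\sum_{n\ge0}I_n(i\lambda)^{-n}$ to all orders,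 and every coefficient functional $I_n$ is conserved along these solutions. 4. *(Involution.)* Let $\{z,\bar z\}=-i\Omega_1$ in the even case and $\{z,\bar z\}=-2i\Omega_2$ in the odd case. Then, on the whole phase space, $\{\operatorname{tr}\tau(\lambda),\operatorname{tr}\tau(\mu)\}=0$ for all $\lambda,\mu$ in the lower half-plane; likewise $\{\operatorname{tr}\tau_L(\lambda),\operatorname{tr}\tau_L(\mu)\}=0$ for all $\lambda,\mu\in\mathbb C$ and $L>0$. -/

import Mathlib

open MeasureTheory Filter Set
open scoped Topology ContDiff ComplexConjugate Kronecker

noncomputable section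

namespace NLSBoundary

/-- Complex `2 × 2` matrices. -/
abbrev Mat2 := Matrix (Fin 2) (Fin 2) ℂ

/-- Complex `4 × 4` matrices, with rows and columns indexed by pairs (the tensor square). -/
abbrev Mat4 := Matrix (Fin 2 × Fin 2) (Fin 2 × Fin 2) ℂ

/-! ### Lax pair of the NLS hierarchy -/

/-- `∂ₓ⁻¹` on functions that decrease rapidly as `x → +∞`: the primitive that vanishes at `+∞`. -/
def dInv (f : ℝ → ℂ) (x : ℝ) : ℂ := -∫ y in Ioi x, f y

/-- The three coefficient functions `a_j, b_j, c_j` of the variable `x`. -/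
structure Coef where
  a : ℝ → ℂ
  b : ℝ → ℂ
  c : ℝ → ℂ

/-- The recursively defined coefficients `(a_j, b_j, c_j)` of the time part of the Lax pair,
for a spatial profile `u`. -/
def coef (u : ℝ → ℂ) : ℕ → Coef
  | 0 => ⟨fun _ => Complex.I / 2, fun _ => 0, fun _ => 0⟩
  | 1 => ⟨fun _ => 0, fun x => conj (u x), fun x => -u x⟩
  | j + 2 =>
    let p := coef u (j + 1)
    let S : ℝ → ℂ := dInv fun y => conj (u y) * p.c y + u y * p.b y
    let c' : ℝ → ℂ := fun x => -Complex.I * deriv p.c x - 2 * Complex.I * u x * S x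
    let b' : ℝ → ℂ := fun x => Complex.I * deriv p.b x + 2 * Complex.I * conj (u x) * S x
    ⟨fun x => -dInv (fun y => conj (u y) * c' y + u y * b' y) x, b', c'⟩

/-- The space part `U(x, λ)` of the Lax pair. -/
def laxU (u : ℝ → ℂ) (lam : ℂ) (x : ℝ) : Mat2 :=
  !![lam / (2 * Complex.I), -conj (u x); u x, -(lam / (2 * Complex.I))]

/-- The time part `V⁽ⁿ⁾(x, λ)` of the Lax pair. -/
def laxV (n : ℕ) (u : ℝ → ℂ) (lam : ℂ) (x : ℝ) : Mat2 :=
  ∑ j ∈ Finset.range (n + 1),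
    lam ^ (n - j) •
      !![(coef u j).a x, (coef u j).b x; (coef u j).c x, -(coef u j).a x]

/-- Smooth on the closed half-line `[0, ∞)` and rapidly decreasing, with all derivatives, as
`x → +∞`. (A function that is smooth up to `x = 0` is the restriction of a function smooth
on the line; the values at `x < 0` play no role in what follows.) -/
def HalfLineSchwartz (f : ℝ → ℂ) : Prop :=
  ContDiff ℝ ∞ f ∧
    ∀ m N : ℕ, ∃ C : ℝ, ∀ x : ℝ, 0 ≤ x → x ^ N * ‖iteratedDeriv m f x‖ ≤ C

/-- `u(x, t)`, `x ≥ 0`, `t ∈ J`, is a smooth solution of the `n`-th NLS equation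
`u_t = i c_{n+1}` on the half-line that decreases rapidly as `x → +∞`, locally uniformly in
time. -/
structure IsHalfLineSolution (n : ℕ) (J : Set ℝ) (u : ℝ → ℝ → ℂ) : Prop where
  smooth : ContDiffOn ℝ ∞ (fun p : ℝ × ℝ => u p.1 p.2) (univ ×ˢ J)
  decay : ∀ m N : ℕ, ∀ t₀ ∈ J, ∃ C : ℝ, ∀ᶠ t in 𝓝 t₀, ∀ x : ℝ, 0 ≤ x →
    x ^ N * ‖iteratedDeriv m (fun y => u y t) x‖ ≤ C
  nls : ∀ t ∈ J, ∀ x : ℝ, 0 ≤ x →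
    deriv (fun s => u x s) t = Complex.I * (coef (fun y => u y t) (n + 1)).c x

/-! ### Boundary conditions, boundary matrices and boundary equations -/

/-- `Ω₁ = √(β² - 4|z|²)`. -/
def Omega1 (β : ℝ) (z : ℂ) : ℝ := √(β ^ 2 - 4 * ‖z‖ ^ 2)

/-- The boundary conditions at `x = 0`, at time `t`, for the `2k`-th NLS equation. -/
def EvenBC (k : ℕ) (β : ℝ) (u : ℝ → ℝ → ℂ) (t : ℝ) : Prop :=
  let C := coef fun y => u y t
  (∀ l : ℕ, 1 ≤ l → l + 1 ≤ k →
    (C (2 * l + 1)).c 0 - 2 * Complex.I * u 0 t * (C (2 * l)).a 0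
      - Complex.I * Omega1 β (u 0 t) * (C (2 * l)).c 0 = 0) ∧
  deriv (fun s => u 0 s) t + 2 * u 0 t * (C (2 * k)).a 0
    + Omega1 β (u 0 t) * (C (2 * k)).c 0 = 0

/-- The boundary matrix `K(λ)` for the even order equations, `z` being the boundary value
of `u`. -/
def evenK (β : ℝ) (z lam : ℂ) : Mat2 :=
  lam • (1 : Mat2) +
    !![-Complex.I * Omega1 β z, 2 * Complex.I * conj z;
       2 * Complex.I * z, Complex.I * Omega1 β z]

/-- The boundary equation `dK(λ)/dt = V(0,t,λ) K(λ) - K(λ) V(0,t,-λ)` at time `t`, for all `λ`. -/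
def EvenBoundaryEq (k : ℕ) (β : ℝ) (u : ℝ → ℝ → ℂ) (t : ℝ) : Prop :=
  ∀ lam : ℂ, ∀ i j : Fin 2,
    HasDerivAt (fun s => evenK β (u 0 s) lam i j)
      ((laxV (2 * k) (fun y => u y t) lam 0 * evenK β (u 0 t) lam
        - evenK β (u 0 t) lam * laxV (2 * k) (fun y => u y t) (-lam) 0) i j) t

/-- `√(β² - |w|²)`; at `w = ε û - u` this is `Ω₂`. -/
def Omega2 (β : ℝ) (w : ℂ) : ℝ := √(β ^ 2 - ‖w‖ ^ 2)

/-- The boundary conditions at `x = 0`, at time `t`, for the `(2k+1)`-th NLS equation;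
the hat is the time reversal `û(x,t) = u(x,-t)`. -/
def OddBC (k : ℕ) (β ε : ℝ) (u : ℝ → ℝ → ℂ) (t : ℝ) : Prop :=
  let C := coef fun y => u y t
  let D := coef fun y => u y (-t)
  let Ω : ℂ := Omega2 β (u 0 t - ε * u 0 (-t))
  (∀ j : ℕ, 2 ≤ j → j ≤ 2 * k + 1 →
    (-1) ^ (j + 1) * ε * (D j).c 0 - (C j).c 0
      - Complex.I * (ε * u 0 (-t) - u 0 t) * ((-1) ^ (j - 1) * (D (j - 1)).a 0 + (C (j - 1)).a 0)
      + Complex.I * Ω * ((-1) ^ j * ε * (D (j - 1)).c 0 + (C (j - 1)).c 0) = 0) ∧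
  ε * deriv (fun s => u 0 (-s)) t - deriv (fun s => u 0 s) t
    + (ε * u 0 (-t) - u 0 t) * ((C (2 * k + 1)).a 0 - (D (2 * k + 1)).a 0)
    - Ω * ((C (2 * k + 1)).c 0 + ε * (D (2 * k + 1)).c 0) = 0

/-- The boundary matrix `K(λ)` for the odd order equations, `z` and `zh` being the boundary
values of `u` and of its time reversal `û`. -/
def oddK (β ε : ℝ) (z zh lam : ℂ) : Mat2 :=
  lam • !![-(ε : ℂ), 0; 0, 1] +
    !![Complex.I * ε * Omega2 β (z - ε * zh), Complex.I * (conj z - ε * conj zh);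
       Complex.I * (zh - ε * z), Complex.I * Omega2 β (z - ε * zh)]

/-- The same matrix in terms of the single boundary variable `w = ε û - u`. -/
def oddKw (β ε : ℝ) (w lam : ℂ) : Mat2 :=
  lam • !![-(ε : ℂ), 0; 0, 1] +
    !![Complex.I * ε * Omega2 β w, -Complex.I * conj w;
       Complex.I * ε * w, Complex.I * Omega2 β w]

theorem oddK_eq_oddKw (β ε : ℝ) (hε : ε = 1 ∨ ε = -1) (z zh lam : ℂ) :
    oddK β ε z zh lam = oddKw β ε (ε * zh - z) lam := by
  have h2 : (ε : ℂ) * ε = 1 := by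
    rcases hε with rfl | rfl <;> norm_num
  have hΩ : Omega2 β (z - ε * zh) = Omega2 β (ε * zh - z) := by
    unfold Omega2
    rw [norm_sub_rev]
  unfold oddK oddKw
  rw [hΩ]
  congr 1
  ext i j
  fin_cases i <;> fin_cases j <;> simp
  · ring
  · linear_combination (-Complex.I * zh) * h2

/-- The boundary equation `dK(λ)/dt = V(0,t,λ) K(λ) + K(λ) V(0,-t,-λ)` at time `t`, for all `λ`. -/
def OddBoundaryEq (k : ℕ) (β ε : ℝ) (u : ℝ → ℝ → ℂ) (t : ℝ) : Prop :=
  ∀ lam : ℂ, ∀ i j : Fin 2,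
    HasDerivAt (fun s => oddK β ε (u 0 s) (u 0 (-s)) lam i j)
      ((laxV (2 * k + 1) (fun y => u y t) lam 0 * oddK β ε (u 0 t) (u 0 (-t)) lam
        + oddK β ε (u 0 t) (u 0 (-t)) lam
          * laxV (2 * k + 1) (fun y => u y (-t)) (-lam) 0) i j) t

/-! ### Transition and monodromy matrices -/

/-- The terms of the series of the path-ordered exponential of `U(·, λ)` from `0` to `x`. -/
def dyson (u : ℝ → ℂ) (lam : ℂ) : ℕ → ℝ → Mat2
  | 0 => fun _ => 1
  | m + 1 => fun x => Matrix.of fun i j => ∫ ξ in (0 : ℝ)..x, (laxU u lam ξ * dyson u lam m ξ) i j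

/-- The transition matrix `T(L, 0, λ)`: the path-ordered exponential of `U(·, λ)` over `[0, L]`. -/
def transition (u : ℝ → ℂ) (lam : ℂ) (L : ℝ) : Mat2 :=
  Matrix.of fun i j => ∑' m : ℕ, dyson u lam m L i j

/-- The transition matrix from `0` to `L`, with the free oscillation at the end `L` removed. -/
def transitionNormalized (u : ℝ → ℂ) (lam : ℂ) (L : ℝ) : Mat2 :=
  Matrix.diagonal
    ![Complex.exp (Complex.I * lam * L / 2), Complex.exp (-(Complex.I * lam * L / 2))]
    * transition u lam L

/-- `T(∞, 0, λ)` for real `λ`: the limit of the normalized transition matrix as `L → ∞`. -/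
def transitionInf (u : ℝ → ℂ) (lam : ℂ) : Mat2 :=
  Matrix.of fun i j => limUnder atTop fun L : ℝ => transitionNormalized u lam L i j

/-- The monodromy matrix `τ(λ) = T(λ) K T̂(-λ)⁻¹` of the half-line, `T` and `T̂` being the
transition matrices of `u` and `uh`. -/
def tauInf (u uh : ℝ → ℂ) (K : Mat2) (lam : ℂ) : Mat2 :=
  transitionInf u lam * K * (transitionInf uh (-lam))⁻¹

/-- The monodromy matrix with both transition matrices taken over `[0, L]`. -/
def tau (u uh : ℝ → ℂ) (K : Mat2) (lam : ℂ) (L : ℝ) : Mat2 :=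
  transition u lam L * K * (transition uh (-lam) L)⁻¹

/-- The trace of the monodromy matrix of the half-line for `Im λ < 0`, where `tr τ` over `[0, L]`
grows like `exp (i λ L)`: the limit as `L → ∞` after removal of this factor. -/
def traceInf (u uh : ℝ → ℂ) (K : Mat2) (lam : ℂ) : ℂ :=
  limUnder atTop fun L : ℝ => Complex.exp (-(Complex.I * lam * L)) * (tau u uh K lam L).trace

/-! ### Phase space and Poisson brackets -/

/-- `m` fields on the half-line and one complex boundary variable. -/
abbrev PhasePoint (m : ℕ) := (Fin m → ℝ → ℂ) × ℂ

/-- The points of phase space: rapidly decreasing fields, boundary variable in `D`. -/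
def phaseSpace (m : ℕ) (D : Set ℂ) : Set (PhasePoint m) :=
  {s | (∀ i, HalfLineSchwartz (s.1 i)) ∧ s.2 ∈ D}

/-- Values of the derivatives `δF/δu_i(x)`, `δF/δū_i(x)`, `∂F/∂z`, `∂F/∂z̄`. -/
structure Gradient (m : ℕ) where
  du : Fin m → ℝ → ℂ
  dub : Fin m → ℝ → ℂ
  dz : ℂ
  dzb : ℂ

/-- `g` is the (square integrable) functional gradient of `F` at the point `s`. -/
def HasGradient {m : ℕ} (F : PhasePoint m → ℂ) (s : PhasePoint m) (g : Gradient m) : Prop :=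
  (∀ i, MemLp (g.du i) 2 (volume.restrict (Ioi 0))) ∧
  (∀ i, MemLp (g.dub i) 2 (volume.restrict (Ioi 0))) ∧
  ∀ (v : Fin m → ℝ → ℂ) (w : ℂ), (∀ i, HalfLineSchwartz (v i)) →
    HasDerivAt (fun r : ℝ => F (fun i x => s.1 i x + r * v i x, s.2 + r * w))
      ((∑ i, ∫ x in Ioi (0 : ℝ), (g.du i x * v i x + g.dub i x * conj (v i x)))
        + g.dz * w + g.dzb * conj w) 0

/-- The Poisson bracket for which the fields are canonical, `{u_i(x), ū_j(y)} = i δ_ij δ(x - y)`,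
the boundary variable `z` commutes with the fields, and `{z, z̄} = θ`. -/
def gradBracket {m : ℕ} (θ : ℂ) (g h : Gradient m) : ℂ :=
  Complex.I * (∑ i, ∫ x in Ioi (0 : ℝ), (g.du i x * h.dub i x - g.dub i x * h.du i x))
    + θ * (g.dz * h.dzb - g.dzb * h.dz)

/-- `F` and `G` have functional gradients at `s` and `{F, G} = c` there; `θ` is the structure
function of the boundary variable, `{z, z̄} = θ(z)`. -/
def HasBracket {m : ℕ} (θ : ℂ → ℂ) (F G : PhasePoint m → ℂ) (s : PhasePoint m) (c : ℂ) : Prop :=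
  ∃ g h : Gradient m, HasGradient F s g ∧ HasGradient G s h ∧ gradBracket (θ s.2) g h = c

/-- The classical `r`-matrix: the permutation matrix divided by `λ`. -/
def rMat (lam : ℂ) : Mat4 :=
  (1 / lam) • Matrix.of fun p q => if p.1 = q.2 ∧ p.2 = q.1 then 1 else 0

/-- The algebra `{K₁(λ), K₂(μ)} = [r(λ-μ), K₁(λ)K₂(μ)] + K₁(λ)r(λ+μ)K₂(μ) - K₂(μ)r(λ+μ)K₁(λ)`
on the phase space with boundary variable in `D`. -/
def ReflectionAlgebra (m : ℕ) (D : Set ℂ) (θ : ℂ → ℂ) (K : ℂ → ℂ → Mat2) : Prop :=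
  ∀ s ∈ phaseSpace m D, ∀ lam mu : ℂ, lam ≠ mu → lam ≠ -mu → ∀ a b c d : Fin 2,
    HasBracket θ (fun p : PhasePoint m => K p.2 lam a b) (fun p => K p.2 mu c d) s
      (let K₁ : Mat4 := K s.2 lam ⊗ₖ (1 : Mat2)
       let K₂ : Mat4 := (1 : Mat2) ⊗ₖ K s.2 mu
       (rMat (lam - mu) * (K₁ * K₂) - (K₁ * K₂) * rMat (lam - mu)
         + K₁ * rMat (lam + mu) * K₂ - K₂ * rMat (lam + mu) * K₁) (a, c) (b, d))

/-- The algebra `{K₁(λ), K₂(μ)} = [r(λ-μ), K₁(λ)K₂(μ)]` on the phase space with boundary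
variable in `D`. -/
def CommutatorAlgebra (m : ℕ) (D : Set ℂ) (θ : ℂ → ℂ) (K : ℂ → ℂ → Mat2) : Prop :=
  ∀ s ∈ phaseSpace m D, ∀ lam mu : ℂ, lam ≠ mu → ∀ a b c d : Fin 2,
    HasBracket θ (fun p : PhasePoint m => K p.2 lam a b) (fun p => K p.2 mu c d) s
      (let K₁ : Mat4 := K s.2 lam ⊗ₖ (1 : Mat2)
       let K₂ : Mat4 := (1 : Mat2) ⊗ₖ K s.2 mu
       (rMat (lam - mu) * (K₁ * K₂) - (K₁ * K₂) * rMat (lam - mu)) (a, c) (b, d))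

/-- The boundary variable satisfies `{z, z̄} = f(z)`. -/
def BoundaryBracket (m : ℕ) (D : Set ℂ) (θ f : ℂ → ℂ) : Prop :=
  ∀ s ∈ phaseSpace m D,
    HasBracket θ (fun p : PhasePoint m => p.2) (fun p => conj p.2) s (f s.2)

/-- Range of the boundary variable `z = u(0)` of the even order equations: `Ω₁ > 0`. -/
def evenDisc (β : ℝ) : Set ℂ := {z | 4 * ‖z‖ ^ 2 < β ^ 2}

/-- Range of the boundary variable `w = ε û(0) - u(0)` of the odd order equations: `Ω₂ > 0`. -/
def oddDisc (β : ℝ) : Set ℂ := {w | ‖w‖ ^ 2 < β ^ 2}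

/-- `tr τ(λ)` over `[0, L]`, even order equations, as a functional of the field and of `z`. -/
def evenTrace (β : ℝ) (lam : ℂ) (L : ℝ) (p : PhasePoint 1) : ℂ :=
  (tau (p.1 0) (p.1 0) (evenK β p.2 lam) lam L).trace

/-- `tr τ(λ)` of the half-line, even order equations, `Im λ < 0`. -/
def evenTraceInf (β : ℝ) (lam : ℂ) (p : PhasePoint 1) : ℂ :=
  traceInf (p.1 0) (p.1 0) (evenK β p.2 lam) lam

/-- `tr τ(λ)` over `[0, L]`, odd order equations, as a functional of the fields `u`, `û` and
of `w`. -/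
def oddTrace (β ε : ℝ) (lam : ℂ) (L : ℝ) (p : PhasePoint 2) : ℂ :=
  (tau (p.1 0) (p.1 1) (oddKw β ε p.2 lam) lam L).trace

/-- `tr τ(λ)` of the half-line, odd order equations, `Im λ < 0`. -/
def oddTraceInf (β ε : ℝ) (lam : ℂ) (p : PhasePoint 2) : ℂ :=
  traceInf (p.1 0) (p.1 1) (oddKw β ε p.2 lam) lam

/-- The point of phase space at time `t`, even order equations. -/
def evenState (u : ℝ → ℝ → ℂ) (t : ℝ) : PhasePoint 1 :=
  (![fun x => u x t], u 0 t)

/-- The point of phase space at time `t`, odd order equations. -/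
def oddState (ε : ℝ) (u : ℝ → ℝ → ℂ) (t : ℝ) : PhasePoint 2 :=
  (![fun x => u x t, fun x => u x (-t)], ε * u 0 (-t) - u 0 t)

/-- `F(λ)/λ` has, as `iλ = κ → +∞`, the asymptotic expansion `∑ cₙ (iλ)⁻ⁿ`, to all orders. -/
def HasExpansion (F : ℂ → ℂ) (c : ℕ → ℂ) : Prop :=
  ∀ N : ℕ,
    (fun κ : ℝ => F (-Complex.I * κ) / (-Complex.I * κ)
      - ∑ n ∈ Finset.range (N + 1), c n / (κ : ℂ) ^ n)
    =o[atTop] fun κ : ℝ => (κ ^ N)⁻¹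

end NLSBoundary

end

open NLSBoundary

noncomputable section

namespace NLSBoundary

/-! ### The transition matrix -/

/-! Monodromy matrix. Transposition turns the spatial system of the conjugate potential at −λ into
the adjoint of the system of u at λ. Hence τ = T_u(λ) K T_v(λ)ᵀ, where v is the conjugate of û (of u
itself for even order), and the inverse disappears (`tau_eq`). The off-diagonal part of U is
skew-Hermitian, so |f|² + |g|² of a solution grows at most like exp(|Im λ| x). After multiplication
by exp(−iλx/2) transition matrices are bounded by 1 for Im λ ≤ 0. Their second row has derivative u
times the first row, which is integrable, so it converges; the limit j(u) is the Jost row. For Im λ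
< 0 the first row tends to 0 and tr τ(λ) = ∑ j_a(u) K_ab j_b(v) (`traceInf_eq`). For real λ the
SU(2) symmetry recovers the first row from the second.

Boundary equations. Comparing powers of λ gives one matrix equation per order. The (1,0) entries are
the boundary conditions and the (0,1) entries follow from them by conjugation. The diagonal entries
are automatic: the formal series Q = ∑ λ⁻ʲQ_j satisfies Q² = −1/4 (`coef_square`), as does its
partner P, so D = QK − KP satisfies QD + DP = 0 and its first possibly nonzero coefficient has zero
diagonal (`diag_eq_zero_of_square`).

Conservation. An exact Duhamel formula (`transition_sub`) gives the derivative of the Jost row with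
respect to the potential. Along the flow, zero curvature makes its integrand a total derivative, so
∂ₜj = cj − jV(0) with a scalar c. The row of v obeys the same kind of equation with −c, and the
boundary equation is exactly what makes the bilinear form constant. The expansion in (iλ)⁻¹ comes
from a WKB series of the Jost solution whose truncations telescope (`jost_eq_sum`). Its coefficients
are determined by tr τ in the lower half-plane and are therefore conserved.

Poisson structure. The relations for K are scalar identities, checked entry by entry, and one entry
already determines θ. The gradient of tr τ(λ) in the fields is made of the off-diagonal entries of a
kernel X with X' = [U(λ), X]. For two such solutions the derivative of tr(X X̃) is i(λ−μ) times a
bracket density, so the field part of {tr τ(λ), tr τ(μ)} is a boundary term. It vanishes at the far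
end because the traces agree there, and at x = 0 the algebra of K cancels it against the bracket of
the boundary variable (`even_gradBracket_eq_zero`, `odd_gradBracket_eq_zero`). The interval [0, L]
and the half-line are treated at once through `Scattering`. -/

theorem laxU_continuous {u : ℝ → ℂ} (hu : Continuous u) (lam : ℂ) (i j : Fin 2) :
    Continuous fun x => laxU u lam x i j := by
  fin_cases i <;> fin_cases j <;> simp [laxU] <;> fun_prop

theorem dyson_hasDerivAt {u : ℝ → ℂ} (hu : Continuous u) (lam : ℂ) (m : ℕ) :
    (∀ i j, Continuous fun x => dyson u lam m x i j) ∧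
    ∀ x i j, HasDerivAt (fun x => dyson u lam (m + 1) x i j)
      ((laxU u lam x * dyson u lam m x) i j) x := by
  have key : ∀ m, (∀ i j, Continuous fun x => dyson u lam m x i j) →
      ∀ x i j, HasDerivAt (fun x => dyson u lam (m + 1) x i j)
        ((laxU u lam x * dyson u lam m x) i j) x := by
    intro m hm x i j
    have hc : Continuous fun x => (laxU u lam x * dyson u lam m x) i j := by
      simp only [Matrix.mul_apply]
      exact continuous_finsetSum _ fun k _ => (laxU_continuous hu lam i k).mul (hm k j)
    exact intervalIntegral.integral_hasDerivAt_right (hc.intervalIntegrable _ _)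
      hc.stronglyMeasurable.stronglyMeasurableAtFilter hc.continuousAt
  have hcont : ∀ i j, Continuous fun x => dyson u lam m x i j := by
    induction m with
    | zero => intro i j; simp [dyson, continuous_const]
    | succ m ih =>
      intro i j
      exact continuous_iff_continuousAt.2 fun x => (key m ih x i j).continuousAt
  exact ⟨hcont, key m hcont⟩

/-- Each integration contributes 2C, the 2 counting the summands in a product of 2 × 2 matrices, and
integrating |ξ|^m builds up the factorial. The majorant serves the series as well as its termwise
derivative. -/
theorem dyson_norm_le {u : ℝ → ℂ} (lam : ℂ) {R C : ℝ}
    (hC : ∀ x, |x| ≤ R → ∀ i j, ‖laxU u lam x i j‖ ≤ C) (m : ℕ) :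
    ∀ x, |x| ≤ R → ∀ i j, ‖dyson u lam m x i j‖ ≤ (2 * C * |x|) ^ m / (m.factorial : ℝ) := by
  induction m with
  | zero =>
    intro x _ i j
    by_cases h : i = j <;> simp [dyson, Matrix.one_apply, h]
  | succ m ih =>
    intro x hx i j
    have hC0 : 0 ≤ C := (norm_nonneg _).trans (hC x hx 0 0)
    have h1 : ∀ ξ ∈ Set.uIoc 0 x, ‖(laxU u lam ξ * dyson u lam m ξ) i j‖
        ≤ 2 * C * ((2 * C) ^ m / (m.factorial : ℝ)) * |ξ - 0| ^ m := by
      intro ξ hξ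
      have hξR : |ξ| ≤ R := by
        refine le_trans ?_ hx
        rcases le_total 0 x with h | h
        · rw [Set.uIoc_of_le h] at hξ
          rw [abs_of_pos hξ.1, abs_of_nonneg h]; exact hξ.2
        · rw [Set.uIoc_of_ge h] at hξ
          rw [abs_of_nonpos hξ.2, abs_of_nonpos h]; linarith [hξ.1]
      rw [Matrix.mul_apply, Fin.sum_univ_two]
      refine (norm_add_le _ _).trans ?_
      rw [norm_mul, norm_mul, sub_zero]
      have e0 := mul_le_mul (hC ξ hξR i 0) (ih ξ hξR 0 j) (norm_nonneg _) hC0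
      have e1 := mul_le_mul (hC ξ hξR i 1) (ih ξ hξR 1 j) (norm_nonneg _) hC0
      refine (add_le_add e0 e1).trans (le_of_eq ?_)
      rw [mul_pow]; ring
    have hint : IntegrableOn (fun ξ : ℝ => 2 * C * ((2 * C) ^ m / (m.factorial : ℝ)) * |ξ - 0| ^ m)
        (Set.uIoc 0 x) := by
      apply IntegrableOn.mono_set _ Set.uIoc_subset_uIcc
      exact (by fun_prop : Continuous _).integrableOn_uIcc
    have h2 : ‖dyson u lam (m + 1) x i j‖ ≤
        ∫ ξ in Set.uIoc 0 x, 2 * C * ((2 * C) ^ m / (m.factorial : ℝ)) * |ξ - 0| ^ m := by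
      refine intervalIntegral.norm_integral_le_integral_norm_uIoc.trans ?_
      refine integral_mono_of_nonneg (Eventually.of_forall fun _ => norm_nonneg _) hint ?_
      exact (ae_restrict_iff' measurableSet_uIoc).2 (Eventually.of_forall h1)
    refine h2.trans (le_of_eq ?_)
    rw [integral_const_mul, integral_pow_abs_sub_uIoc, Nat.factorial_succ, sub_zero]
    push_cast
    field_simp
    ring

theorem dyson_bound {u : ℝ → ℂ} (hu : Continuous u) (lam : ℂ) (R : ℝ) :
    ∃ C, 0 ≤ C ∧ ∀ x, |x| ≤ R → ∀ i j, ‖laxU u lam x i j‖ ≤ C := by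
  have : ∀ i j, ∃ C, ∀ x ∈ Set.Icc (-R) R, ‖laxU u lam x i j‖ ≤ C := fun i j =>
    isCompact_Icc.exists_bound_of_continuousOn (laxU_continuous hu lam i j).continuousOn
  choose C hC using this
  refine ⟨∑ i, ∑ j, |C i j|, by positivity, fun x hx i j => ?_⟩
  refine (hC i j x (abs_le.1 hx)).trans ((le_abs_self _).trans ?_)
  refine (Finset.single_le_sum (f := fun j => |C i j|) (fun _ _ => abs_nonneg _)
    (Finset.mem_univ j)).trans ?_
  exact Finset.single_le_sum (f := fun i => ∑ j, |C i j|)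
    (fun _ _ => Finset.sum_nonneg fun _ _ => abs_nonneg _) (Finset.mem_univ i)

theorem dyson_summable {u : ℝ → ℂ} (hu : Continuous u) (lam : ℂ) (x : ℝ) (i j : Fin 2) :
    Summable fun m => dyson u lam m x i j := by
  obtain ⟨C, _, hC⟩ := dyson_bound hu lam |x|
  exact Summable.of_norm_bounded (Real.summable_pow_div_factorial (2 * C * |x|))
    fun m => dyson_norm_le lam hC m x le_rfl i j

theorem dyson_zero_right (u : ℝ → ℂ) (lam : ℂ) (m : ℕ) : dyson u lam (m + 1) 0 = 0 := by
  ext i j; simp [dyson]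

theorem transition_zero (u : ℝ → ℂ) (lam : ℂ) : transition u lam 0 = 1 := by
  ext i j
  simp only [transition, Matrix.of_apply]
  rw [tsum_eq_single 0]
  · rfl
  · intro m hm
    obtain ⟨m, rfl⟩ := Nat.exists_eq_succ_of_ne_zero hm
    simp [dyson_zero_right]

/-- The series is differentiated termwise on a ball containing x: the derivative of term m + 1 is U
times term m, and an exponential series dominates uniformly on the ball. -/
theorem transition_hasDerivAt {u : ℝ → ℂ} (hu : Continuous u) (lam : ℂ) (x : ℝ) (i j : Fin 2) :
    HasDerivAt (fun x => transition u lam x i j) ((laxU u lam x * transition u lam x) i j) x := by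
  set R := |x| + 1
  obtain ⟨C, hC0, hC⟩ := dyson_bound hu lam R
  have hx : x ∈ Metric.ball (0 : ℝ) R := by simp [R]
  have hsub : ∀ y ∈ Metric.ball (0 : ℝ) R, |y| ≤ R := fun y hy => by
    rw [mem_ball_zero_iff, Real.norm_eq_abs] at hy; exact hy.le
  have main := hasDerivAt_tsum_of_isPreconnected (g := fun m y => dyson u lam (m + 1) y i j)
    (g' := fun m y => (laxU u lam y * dyson u lam m y) i j)
    ((Real.summable_pow_div_factorial (2 * C * R)).mul_left (2 * C))
    Metric.isOpen_ball (convex_ball (0 : ℝ) R).isPreconnected (t := Metric.ball (0 : ℝ) R)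
    (y₀ := x) (y := x) (fun m y _ => (dyson_hasDerivAt hu lam m).2 y i j) ?_ hx
    ((summable_nat_add_iff 1).2 (dyson_summable hu lam x i j)) hx
  · have hs : ∀ k, Summable fun m => laxU u lam x i k * dyson u lam m x k j := fun k =>
      (dyson_summable hu lam x k j).mul_left _
    have e : ∑' m, (laxU u lam x * dyson u lam m x) i j
        = (laxU u lam x * transition u lam x) i j := by
      simp only [Matrix.mul_apply, Fin.sum_univ_two]
      rw [(hs 0).tsum_add (hs 1), tsum_mul_left, tsum_mul_left]
      rfl
    rw [e] at main
    have e2 : (fun x => transition u lam x i j) =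
        fun y => (1 : Mat2) i j + ∑' m, dyson u lam (m + 1) y i j := by
      ext y
      exact (dyson_summable hu lam y i j).tsum_eq_zero_add
    rw [e2]
    exact main.const_add _
  · intro m y hy
    simp only [Matrix.mul_apply, Fin.sum_univ_two]
    refine (norm_add_le _ _).trans ?_
    rw [norm_mul, norm_mul]
    have hy' := hsub y hy
    have hd : ∀ k, ‖dyson u lam m y k j‖ ≤ (2 * C * R) ^ m / (m.factorial : ℝ) := fun k =>
      (dyson_norm_le lam hC m y hy' k j).trans (by gcongr)
    have e0 := mul_le_mul (hC y hy' i 0) (hd 0) (norm_nonneg _) hC0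
    have e1 := mul_le_mul (hC y hy' i 1) (hd 1) (norm_nonneg _) hC0
    linarith

theorem transition_continuous {u : ℝ → ℂ} (hu : Continuous u) (lam : ℂ) (i j : Fin 2) :
    Continuous fun x => transition u lam x i j :=
  continuous_iff_continuousAt.2 fun x => (transition_hasDerivAt hu lam x i j).continuousAt

/-- Product rule for matrix functions with entrywise derivatives. -/
theorem hasDerivAt_mul_apply {A B : ℝ → Mat2} {A' B' : Mat2} {x : ℝ}
    (hA : ∀ i j, HasDerivAt (fun y => A y i j) (A' i j) x)
    (hB : ∀ i j, HasDerivAt (fun y => B y i j) (B' i j) x) (i j : Fin 2) :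
    HasDerivAt (fun y => (A y * B y) i j) ((A' * B x + A x * B') i j) x := by
  simp only [Matrix.add_apply, Matrix.mul_apply, ← Finset.sum_add_distrib]
  exact HasDerivAt.fun_sum fun k _ => (hA i k).mul (hB k j)

/-- The complex conjugate potential. -/
def cbar (u : ℝ → ℂ) (x : ℝ) : ℂ := conj (u x)

theorem continuous_cbar {u : ℝ → ℂ} (hu : Continuous u) : Continuous (cbar u) :=
  Complex.continuous_conj.comp hu

/-- This symmetry eliminates inverses: the transposed transition matrix of the conjugate potential
at −λ solves the adjoint equation, hence is the inverse transition matrix. -/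
theorem laxU_cbar_transpose (u : ℝ → ℂ) (lam : ℂ) (x : ℝ) :
    (laxU (cbar u) (-lam) x).transpose = -laxU u lam x := by
  ext i j
  fin_cases i <;> fin_cases j <;> simp [laxU, cbar, neg_div]

/-- The map λ ↦ −λ̄ preserves the lower half-plane, so facts about Jost rows pass to the conjugate
potential without leaving the region of convergence. -/
theorem laxU_cbar (u : ℝ → ℂ) (lam : ℂ) (x : ℝ) (i j : Fin 2) :
    laxU (cbar u) (-conj lam) x i j = conj (laxU u lam x i j) := by
  fin_cases i <;> fin_cases j <;> simp [laxU, cbar, neg_div, div_neg, map_ofNat]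

/-- The inverse of the transition matrix. -/
def transitionInv (u : ℝ → ℂ) (lam : ℂ) (x : ℝ) : Mat2 :=
  (transition (cbar u) (-lam) x).transpose

theorem transitionInv_hasDerivAt {u : ℝ → ℂ} (hu : Continuous u) (lam : ℂ) (x : ℝ) (i j : Fin 2) :
    HasDerivAt (fun x => transitionInv u lam x i j) ((-(transitionInv u lam x * laxU u lam x)) i j) x := by
  have h := transition_hasDerivAt (continuous_cbar hu) (-lam) x j i
  refine h.congr_deriv ?_
  rw [← Matrix.transpose_apply (laxU (cbar u) (-lam) x * _), Matrix.transpose_mul,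
    laxU_cbar_transpose, Matrix.mul_neg]
  rfl

theorem transitionInv_mul {u : ℝ → ℂ} (hu : Continuous u) (lam : ℂ) (x : ℝ) :
    transitionInv u lam x * transition u lam x = 1 := by
  have hd : ∀ i j x, HasDerivAt (fun x => (transitionInv u lam x * transition u lam x) i j) 0 x := by
    intro i j x
    have := hasDerivAt_mul_apply (transitionInv_hasDerivAt hu lam x)
      (transition_hasDerivAt hu lam x) i j
    rwa [Matrix.neg_mul, Matrix.mul_assoc, neg_add_cancel] at this
  ext i j
  have := is_const_of_deriv_eq_zero (fun x => (hd i j x).differentiableAt)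
    (fun x => (hd i j x).deriv) x 0
  rw [this, transitionInv, transition_zero, transition_zero]; simp

theorem mul_transitionInv {u : ℝ → ℂ} (hu : Continuous u) (lam : ℂ) (x : ℝ) :
    transition u lam x * transitionInv u lam x = 1 :=
  mul_eq_one_comm.1 (transitionInv_mul hu lam x)

theorem transition_inv {u : ℝ → ℂ} (hu : Continuous u) (lam : ℂ) (x : ℝ) :
    (transition u lam x)⁻¹ = transitionInv u lam x :=
  Matrix.inv_eq_left_inv (transitionInv_mul hu lam x)

/-- The monodromy matrix without inverses. -/
theorem tau_eq {u uh : ℝ → ℂ} (huh : Continuous uh) (K : Mat2) (lam : ℂ) (L : ℝ) :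
    tau u uh K lam L = transition u lam L * K * (transition (cbar uh) lam L).transpose := by
  rw [tau, transition_inv huh, transitionInv, neg_neg]

theorem dyson_cbar (u : ℝ → ℂ) (lam : ℂ) (m : ℕ) : ∀ (x : ℝ) (i j : Fin 2),
    dyson (cbar u) (-conj lam) m x i j = conj (dyson u lam m x i j) := by
  induction m with
  | zero => intro x i j; by_cases h : i = j <;> simp [dyson, Matrix.one_apply, h]
  | succ m ih =>
    intro x i j
    simp only [dyson, Matrix.of_apply]
    rw [← intervalIntegral.intervalIntegral_conj]
    refine intervalIntegral.integral_congr fun y _ => ?_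
    simp [Matrix.mul_apply, ih, laxU_cbar]

theorem transition_cbar (u : ℝ → ℂ) (lam : ℂ) (x : ℝ) (i j : Fin 2) :
    transition (cbar u) (-conj lam) x i j = conj (transition u lam x i j) := by
  simp only [transition, Matrix.of_apply, dyson_cbar]
  exact (Complex.conj_tsum _).symm

/-! ### The energy bound -/

theorem hasDerivAt_normSq {h : ℝ → ℂ} {h' : ℂ} {x : ℝ} (hh : HasDerivAt h h' x) :
    HasDerivAt (fun x => Complex.normSq (h x)) (2 * ((h x).re * h'.re + (h x).im * h'.im)) x := by
  have h1 := (Complex.reCLM.hasFDerivAt.comp_hasDerivAt x hh)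
  have h2 := (Complex.imCLM.hasFDerivAt.comp_hasDerivAt x hh)
  have := (h1.mul h1).add (h2.mul h2)
  refine (this.congr_deriv ?_)
  simp; ring

/-- Growth of solutions of the spatial equation. -/
theorem normSq_growth {u : ℝ → ℂ} {lam : ℂ} {f g : ℝ → ℂ}
    (hf : ∀ x, HasDerivAt f (lam / (2 * Complex.I) * f x - conj (u x) * g x) x)
    (hg : ∀ x, HasDerivAt g (u x * f x - lam / (2 * Complex.I) * g x) x) (x : ℝ) :
    HasDerivAt (fun x => Complex.normSq (f x) + Complex.normSq (g x))
      (lam.im * (Complex.normSq (f x) - Complex.normSq (g x))) x := by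
  refine ((hasDerivAt_normSq (hf x)).add (hasDerivAt_normSq (hg x))).congr_deriv ?_
  have hl : lam / (2 * Complex.I) = -(Complex.I * lam / 2) := by
    field_simp; simp
  rw [hl]
  simp [Complex.normSq_apply]
  ring

/-- The potential has dropped out of the growth law, so the bound is uniform in u. This is what
later allows limits and derivatives along families of potentials. -/
theorem normSq_le_exp {u : ℝ → ℂ} {lam : ℂ} {f g : ℝ → ℂ}
    (hf : ∀ x, HasDerivAt f (lam / (2 * Complex.I) * f x - conj (u x) * g x) x)
    (hg : ∀ x, HasDerivAt g (u x * f x - lam / (2 * Complex.I) * g x) x) {x y : ℝ} (hxy : y ≤ x) :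
    Complex.normSq (f x) + Complex.normSq (g x) ≤
      Real.exp (|lam.im| * (x - y)) * (Complex.normSq (f y) + Complex.normSq (g y)) := by
  have hd : ∀ z, HasDerivAt (fun z => Real.exp (-(|lam.im| * z)) *
      (Complex.normSq (f z) + Complex.normSq (g z)))
      (Real.exp (-(|lam.im| * z)) * (-|lam.im|) * (Complex.normSq (f z) + Complex.normSq (g z)) +
        Real.exp (-(|lam.im| * z)) * (lam.im * (Complex.normSq (f z) - Complex.normSq (g z)))) z := by
    intro z
    have h1 : HasDerivAt (fun z => Real.exp (-(|lam.im| * z)))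
        (Real.exp (-(|lam.im| * z)) * (-|lam.im|)) z := by
      have := ((hasDerivAt_id z).const_mul |lam.im|).neg.exp
      simpa using this
    exact h1.mul (normSq_growth hf hg z)
  -- The energy grows at rate Im λ (|f|² − |g|²), which is at most |Im λ| times the energy.
  have ha : Antitone fun z => Real.exp (-(|lam.im| * z)) *
      (Complex.normSq (f z) + Complex.normSq (g z)) := by
    refine antitone_of_deriv_nonpos (fun z => (hd z).differentiableAt) fun z => ?_
    rw [(hd z).deriv]
    have e := Real.exp_pos (-(|lam.im| * z))
    have n1 := Complex.normSq_nonneg (f z)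
    have n2 := Complex.normSq_nonneg (g z)
    have a1 := le_abs_self lam.im
    have a2 := neg_abs_le lam.im
    have : -|lam.im| * (Complex.normSq (f z) + Complex.normSq (g z)) +
      lam.im * (Complex.normSq (f z) - Complex.normSq (g z)) ≤ 0 := by nlinarith
    have := mul_nonpos_of_nonneg_of_nonpos e.le this
    linarith
  have := ha hxy
  simp only at this
  have e : Real.exp (|lam.im| * (x - y)) = Real.exp (|lam.im| * x) * Real.exp (-(|lam.im| * y)) := by
    rw [← Real.exp_add]; ring_nf
  rw [e]
  have h3 := mul_le_mul_of_nonneg_left this (Real.exp_pos (|lam.im| * x)).le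
  rw [← mul_assoc, ← Real.exp_add, add_neg_cancel, Real.exp_zero, one_mul] at h3
  linarith

/-! ### Propagators, weights, and the Jost row -/

/-- The transition matrix from `y` to `x`. -/
def propagator (u : ℝ → ℂ) (lam : ℂ) (x y : ℝ) : Mat2 :=
  transition u lam x * transitionInv u lam y

theorem transitionInv_zero (u : ℝ → ℂ) (lam : ℂ) : transitionInv u lam 0 = 1 := by
  rw [transitionInv, transition_zero, Matrix.transpose_one]

theorem propagator_zero_right (u : ℝ → ℂ) (lam : ℂ) (x : ℝ) :
    propagator u lam x 0 = transition u lam x := by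
  rw [propagator, transitionInv_zero, mul_one]

theorem propagator_self {u : ℝ → ℂ} (hu : Continuous u) (lam : ℂ) (x : ℝ) :
    propagator u lam x x = 1 := mul_transitionInv hu lam x

theorem transitionInv_continuous {u : ℝ → ℂ} (hu : Continuous u) (lam : ℂ) (i j : Fin 2) :
    Continuous fun x => transitionInv u lam x i j :=
  transition_continuous (continuous_cbar hu) _ _ _

theorem propagator_continuous_right {u : ℝ → ℂ} (hu : Continuous u) (lam : ℂ) (x : ℝ)
    (i j : Fin 2) : Continuous fun y => propagator u lam x y i j := by
  simp only [propagator, Matrix.mul_apply]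
  exact continuous_finsetSum _ fun k _ => continuous_const.mul (transitionInv_continuous hu lam k j)

theorem propagator_hasDerivAt {u : ℝ → ℂ} (hu : Continuous u) (lam : ℂ) (x y : ℝ) (i j : Fin 2) :
    HasDerivAt (fun x => propagator u lam x y i j) ((laxU u lam x * propagator u lam x y) i j) x := by
  have := hasDerivAt_mul_apply (transition_hasDerivAt hu lam x) (B := fun _ => transitionInv u lam y)
    (B' := 0) (fun i j => hasDerivAt_const _ _) i j
  rwa [mul_zero, add_zero, Matrix.mul_assoc] at this

theorem propagator_normSq_le {u : ℝ → ℂ} (hu : Continuous u) (lam : ℂ) {x y : ℝ} (h : y ≤ x)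
    (j : Fin 2) :
    Complex.normSq (propagator u lam x y 0 j) + Complex.normSq (propagator u lam x y 1 j) ≤
      Real.exp (|lam.im| * (x - y)) := by
  have := normSq_le_exp (u := u) (lam := lam) (f := fun x => propagator u lam x y 0 j)
    (g := fun x => propagator u lam x y 1 j) (fun x => ?_) (fun x => ?_) h
  · simp only [propagator_self hu] at this
    have h1 : Complex.normSq ((1 : Mat2) 0 j) + Complex.normSq ((1 : Mat2) 1 j) = 1 := by
      revert j
      simp [Fin.forall_fin_two]
    rwa [h1, mul_one] at this
  · refine (propagator_hasDerivAt hu lam x y 0 j).congr_deriv ?_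
    simp [Matrix.mul_apply, laxU]; ring
  · refine (propagator_hasDerivAt hu lam x y 1 j).congr_deriv ?_
    simp [Matrix.mul_apply, laxU]; ring

theorem norm_propagator_le {u : ℝ → ℂ} (hu : Continuous u) (lam : ℂ) {x y : ℝ} (h : y ≤ x)
    (i j : Fin 2) : ‖propagator u lam x y i j‖ ≤ Real.exp (|lam.im| * (x - y) / 2) := by
  have h1 := propagator_normSq_le hu lam h j
  have h2 : Complex.normSq (propagator u lam x y i j) ≤ Real.exp (|lam.im| * (x - y)) := by
    have n0 := Complex.normSq_nonneg (propagator u lam x y 0 j)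
    have n1 := Complex.normSq_nonneg (propagator u lam x y 1 j)
    fin_cases i
    · exact (le_add_of_nonneg_right n1).trans h1
    · exact (le_add_of_nonneg_left n0).trans h1
  rw [Complex.normSq_eq_norm_sq] at h2
  refine le_of_sq_le_sq ?_ (Real.exp_pos _).le
  rw [← Real.exp_nat_mul]
  have e : ((2 : ℕ) : ℝ) * (|lam.im| * (x - y) / 2) = |lam.im| * (x - y) := by push_cast; ring
  rwa [e]

theorem norm_transition_le {u : ℝ → ℂ} (hu : Continuous u) (lam : ℂ) {x : ℝ} (h : 0 ≤ x)
    (i j : Fin 2) : ‖transition u lam x i j‖ ≤ Real.exp (|lam.im| * x / 2) := by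
  simpa [propagator_zero_right] using norm_propagator_le hu lam h i j

/-- The weight that compensates the growth of transition matrices. -/
def weight (lam : ℂ) (x : ℝ) : ℂ := Complex.exp (-(Complex.I * lam * x / 2))

theorem weight_ne_zero (lam : ℂ) (x : ℝ) : weight lam x ≠ 0 := Complex.exp_ne_zero _

theorem weight_zero (lam : ℂ) : weight lam 0 = 1 := by simp [weight]

theorem norm_weight (lam : ℂ) (x : ℝ) : ‖weight lam x‖ = Real.exp (lam.im * x / 2) := by
  rw [weight, Complex.norm_exp]
  congr 1
  simp; ring

theorem weight_hasDerivAt (lam : ℂ) (x : ℝ) :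
    HasDerivAt (weight lam) (-(Complex.I * lam / 2) * weight lam x) x := by
  have h : HasDerivAt (fun x : ℝ => -(Complex.I * lam * x / 2)) (-(Complex.I * lam / 2)) x := by
    have := (((Complex.ofRealCLM.hasDerivAt (x := x)).const_mul (Complex.I * lam)).div_const 2).neg
    rw [Complex.ofRealCLM_apply, Complex.ofReal_one, mul_one] at this
    exact this
  exact h.cexp.congr_deriv (by rw [weight]; ring)

theorem weight_continuous (lam : ℂ) : Continuous (weight lam) := by
  unfold weight; fun_prop

theorem weight_conj (lam : ℂ) (x : ℝ) : weight (-conj lam) x = conj (weight lam x) := by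
  rw [weight, weight, ← Complex.exp_conj]
  congr 1
  simp [map_ofNat]

/-- The weighted transition matrix. -/
def wT (u : ℝ → ℂ) (lam : ℂ) (x : ℝ) : Mat2 := weight lam x • transition u lam x

/-- The weighted propagator. -/
def wP (u : ℝ → ℂ) (lam : ℂ) (x y : ℝ) : Mat2 :=
  (weight lam x * (weight lam y)⁻¹) • propagator u lam x y

theorem wT_zero (u : ℝ → ℂ) (lam : ℂ) : wT u lam 0 = 1 := by
  rw [wT, weight_zero, transition_zero, one_smul]

/-- The weight is chosen to cancel the diagonal term of the second row. What is left there is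
off-diagonal and integrable, while the first row acquires the damping rate −iλ. -/
theorem wT_hasDerivAt {u : ℝ → ℂ} (hu : Continuous u) (lam : ℂ) (x : ℝ) (j : Fin 2) :
    HasDerivAt (fun x => wT u lam x 0 j)
      (-(Complex.I * lam) * wT u lam x 0 j - conj (u x) * wT u lam x 1 j) x ∧
    HasDerivAt (fun x => wT u lam x 1 j) (u x * wT u lam x 0 j) x := by
  have hl : lam / (2 * Complex.I) = -(Complex.I * lam / 2) := by field_simp; simp
  refine ⟨((weight_hasDerivAt lam x).mul (transition_hasDerivAt hu lam x 0 j)).congr_deriv ?_,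
    ((weight_hasDerivAt lam x).mul (transition_hasDerivAt hu lam x 1 j)).congr_deriv ?_⟩ <;>
  · simp [Matrix.mul_apply, laxU, wT, hl]; ring

theorem wP_hasDerivAt {u : ℝ → ℂ} (hu : Continuous u) (lam : ℂ) (x y : ℝ) (j : Fin 2) :
    HasDerivAt (fun x => wP u lam x y 1 j) (u x * wP u lam x y 0 j) x := by
  have hl : lam / (2 * Complex.I) = -(Complex.I * lam / 2) := by field_simp; simp
  refine (((weight_hasDerivAt lam x).mul_const (weight lam y)⁻¹).mul
    (propagator_hasDerivAt hu lam x y 1 j)).congr_deriv ?_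
  simp [Matrix.mul_apply, laxU, wP, hl]; ring

theorem wT_continuous {u : ℝ → ℂ} (hu : Continuous u) (lam : ℂ) (i j : Fin 2) :
    Continuous fun x => wT u lam x i j :=
  (weight_continuous lam).mul (transition_continuous hu lam i j)

theorem wP_continuous_right {u : ℝ → ℂ} (hu : Continuous u) (lam : ℂ) (x : ℝ) (i j : Fin 2) :
    Continuous fun y => wP u lam x y i j :=
  (continuous_const.mul ((weight_continuous lam).inv₀ (weight_ne_zero lam))).mul
    (propagator_continuous_right hu lam x i j)

theorem wP_continuous_left {u : ℝ → ℂ} (hu : Continuous u) (lam : ℂ) (y : ℝ) (i j : Fin 2) :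
    Continuous fun x => wP u lam x y i j :=
  ((weight_continuous lam).mul continuous_const).mul
    (continuous_iff_continuousAt.2 fun x => (propagator_hasDerivAt hu lam x y i j).continuousAt)

/-- For Im λ ≤ 0 the quotient of the weights has modulus exp(−|Im λ|(x − y)/2), the exact reciprocal
of the energy bound. -/
theorem norm_wP_le {u : ℝ → ℂ} (hu : Continuous u) {lam : ℂ} (hl : lam.im ≤ 0) {x y : ℝ}
    (h : y ≤ x) (i j : Fin 2) : ‖wP u lam x y i j‖ ≤ 1 := by
  have e : ‖weight lam x * (weight lam y)⁻¹‖ = Real.exp (-(|lam.im| * (x - y) / 2)) := by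
    rw [norm_mul, norm_inv, norm_weight, norm_weight, ← Real.exp_neg, ← Real.exp_add,
      abs_of_nonpos hl]
    congr 1; ring
  rw [wP, Matrix.smul_apply, smul_eq_mul, norm_mul, e]
  refine (mul_le_mul_of_nonneg_left (norm_propagator_le hu lam h i j) (Real.exp_pos _).le).trans ?_
  rw [← Real.exp_add]; simp

theorem wP_zero (u : ℝ → ℂ) (lam : ℂ) (x : ℝ) : wP u lam x 0 = wT u lam x := by
  rw [wP, wT, weight_zero, propagator_zero_right, inv_one, mul_one]

theorem norm_wT_le {u : ℝ → ℂ} (hu : Continuous u) {lam : ℂ} (hl : lam.im ≤ 0) {x : ℝ}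
    (h : 0 ≤ x) (i j : Fin 2) : ‖wT u lam x i j‖ ≤ 1 := by
  rw [← wP_zero]; exact norm_wP_le hu hl h i j

/-- Products of an integrable and a bounded continuous function. -/
theorem integrableOn_mul_bdd {u f : ℝ → ℂ} {A : Set ℝ} (hA : MeasurableSet A)
    (hu : IntegrableOn u A) (hf : Continuous f) {C : ℝ} (hC : ∀ x ∈ A, ‖f x‖ ≤ C) :
    IntegrableOn (fun x => u x * f x) A :=
  hu.mul_bdd hf.aestronglyMeasurable.restrict
    ((ae_restrict_iff' hA).2 (Eventually.of_forall hC))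

/-- The Jost row: the limit of the second row of the weighted transition matrix. -/
def jost (u : ℝ → ℂ) (lam : ℂ) (j : Fin 2) : ℂ :=
  limUnder atTop fun L : ℝ => wT u lam L 1 j

theorem tendsto_jost {u : ℝ → ℂ} (hu : Continuous u) (hi : IntegrableOn u (Ioi 0)) {lam : ℂ}
    (hl : lam.im ≤ 0) (j : Fin 2) :
    Tendsto (fun L : ℝ => wT u lam L 1 j) atTop (𝓝 (jost u lam j)) :=
  tendsto_limUnder_of_hasDerivAt_of_integrableOn_Ioi (a := 0)
    (fun _ _ => (wT_hasDerivAt hu lam _ j).2)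
    (integrableOn_mul_bdd measurableSet_Ioi hi (wT_continuous hu lam 0 j)
      fun _ hx => norm_wT_le hu hl (le_of_lt hx) 0 j)

/-- The Jost solution, continued from infinity to the point `y`. -/
def jostSol (u : ℝ → ℂ) (lam : ℂ) (y : ℝ) (j : Fin 2) : ℂ :=
  (weight lam y)⁻¹ * ∑ k, jost u lam k * transitionInv u lam y k j

theorem jostSol_continuous {u : ℝ → ℂ} (hu : Continuous u) (lam : ℂ) (j : Fin 2) :
    Continuous fun y => jostSol u lam y j :=
  ((weight_continuous lam).inv₀ (weight_ne_zero lam)).mul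
    (continuous_finsetSum _ fun k _ => continuous_const.mul (transitionInv_continuous hu lam k j))

theorem jostSol_zero (u : ℝ → ℂ) (lam : ℂ) (j : Fin 2) : jostSol u lam 0 j = jost u lam j := by
  fin_cases j <;> simp [jostSol, weight_zero, transitionInv_zero]

theorem tendsto_jostSol {u : ℝ → ℂ} (hu : Continuous u) (hi : IntegrableOn u (Ioi 0)) {lam : ℂ}
    (hl : lam.im ≤ 0) (y : ℝ) (j : Fin 2) :
    Tendsto (fun L : ℝ => wP u lam L y 1 j) atTop (𝓝 (jostSol u lam y j)) := by
  have h : Tendsto (fun L : ℝ => (weight lam y)⁻¹ * ∑ k, wT u lam L 1 k * transitionInv u lam y k j)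
      atTop (𝓝 (jostSol u lam y j)) :=
    (tendsto_finsetSum _ fun k _ => (tendsto_jost hu hi hl k).mul_const _).const_mul _
  refine h.congr fun L => ?_
  simp only [wP, wT, propagator, Matrix.smul_apply, Matrix.mul_apply, smul_eq_mul,
    Fin.sum_univ_two]
  ring

theorem norm_jostSol_le {u : ℝ → ℂ} (hu : Continuous u) (hi : IntegrableOn u (Ioi 0)) {lam : ℂ}
    (hl : lam.im ≤ 0) (y : ℝ) (j : Fin 2) : ‖jostSol u lam y j‖ ≤ 1 :=
  le_of_tendsto (tendsto_jostSol hu hi hl y j).norm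
    ((eventually_ge_atTop y).mono fun _ hL => norm_wP_le hu hl hL 1 j)

theorem jostSol_hasDerivAt {u : ℝ → ℂ} (hu : Continuous u) (lam : ℂ) (y : ℝ) :
    HasDerivAt (fun y => jostSol u lam y 0)
      (Complex.I * lam * jostSol u lam y 0 - u y * jostSol u lam y 1) y ∧
    HasDerivAt (fun y => jostSol u lam y 1) (conj (u y) * jostSol u lam y 0) y := by
  have hl : lam / (2 * Complex.I) = -(Complex.I * lam / 2) := by field_simp; simp
  have hw := (weight_hasDerivAt lam y).inv (weight_ne_zero lam y)
  have hs : ∀ j, HasDerivAt (fun y => ∑ k, jost u lam k * transitionInv u lam y k j)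
      (∑ k, jost u lam k * (-(transitionInv u lam y * laxU u lam y)) k j) y := fun j =>
    HasDerivAt.fun_sum fun k _ => (transitionInv_hasDerivAt hu lam y k j).const_mul _
  have h0 := weight_ne_zero lam y
  refine ⟨(hw.mul (hs 0)).congr_deriv ?_, (hw.mul (hs 1)).congr_deriv ?_⟩ <;>
  · simp only [jostSol, Fin.sum_univ_two, Matrix.neg_apply, Matrix.mul_apply, laxU, hl,
      Matrix.of_apply, Matrix.cons_val_zero, Matrix.cons_val_one, Matrix.cons_val',
      Matrix.cons_val_fin_one, Pi.inv_apply]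
    field_simp
    ring

/-- The weighted propagator starts from the identity at y and its second row changes by at most ∫
|u| over [y, L]. The tail of ∫ |u| therefore bounds the deviation uniformly in L, and the bound
survives L → ∞. -/
theorem tendsto_jostSol_atTop {u : ℝ → ℂ} (hu : Continuous u) (hi : IntegrableOn u (Ioi 0))
    {lam : ℂ} (hl : lam.im ≤ 0) (j : Fin 2) :
    Tendsto (fun y => jostSol u lam y j) atTop (𝓝 ((1 : Mat2) 1 j)) := by
  have htail : Tendsto (fun y => (∫ x in Ioi (0 : ℝ), ‖u x‖) - ∫ x in (0 : ℝ)..y, ‖u x‖) atTop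
      (𝓝 0) := by
    have := (intervalIntegral_tendsto_integral_Ioi 0 hi.norm tendsto_id).const_sub
      (∫ x in Ioi (0 : ℝ), ‖u x‖)
    simpa using this
  refine tendsto_iff_norm_sub_tendsto_zero.2 (squeeze_zero' (Eventually.of_forall fun _ =>
    norm_nonneg _) ?_ htail)
  filter_upwards [eventually_ge_atTop 0] with y hy
  refine le_of_tendsto ((tendsto_jostSol hu hi hl y j).sub_const _).norm ?_
  filter_upwards [eventually_ge_atTop y] with L hL
  have e : wP u lam L y 1 j - (1 : Mat2) 1 j = ∫ x in y..L, u x * wP u lam x y 0 j := by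
    rw [intervalIntegral.integral_eq_sub_of_hasDerivAt (fun x _ => wP_hasDerivAt hu lam x y j)
      ((hu.mul (wP_continuous_left hu lam y 0 j)).intervalIntegrable _ _)]
    congr 1
    rw [wP, mul_inv_cancel₀ (weight_ne_zero lam y), one_smul, propagator_self hu]
  have hL0 : IntervalIntegrable (fun x => ‖u x‖) volume 0 L := hu.norm.intervalIntegrable _ _
  rw [e]
  calc ‖∫ x in y..L, u x * wP u lam x y 0 j‖ ≤ ∫ x in y..L, ‖u x‖ := by
        refine intervalIntegral.norm_integral_le_of_norm_le hL (Eventually.of_forall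
          fun x hx => ?_) (hu.norm.intervalIntegrable _ _)
        rw [norm_mul]
        exact mul_le_of_le_one_right (norm_nonneg _) (norm_wP_le hu hl (le_of_lt hx.1) 0 j)
    _ = (∫ x in (0 : ℝ)..L, ‖u x‖) - ∫ x in (0 : ℝ)..y, ‖u x‖ :=
        (intervalIntegral.integral_interval_sub_left hL0 (hu.norm.intervalIntegrable _ _)).symm
    _ ≤ _ := by
        gcongr
        rw [intervalIntegral.integral_of_le (hy.trans hL)]
        exact setIntegral_mono_set hi.norm (Eventually.of_forall fun _ => norm_nonneg _)
          (Eventually.of_forall fun x hx => hx.1)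

/-- The weighted energy is nonincreasing and nonnegative, with derivative 2 Im λ times the square of
the first row. A monotone function with a limit has an integrable derivative. -/
theorem wT_zero_row_sq_integrable {u : ℝ → ℂ} (hu : Continuous u)
    {lam : ℂ} (hl : lam.im < 0) (j : Fin 2) :
    IntegrableOn (fun x => Complex.normSq (wT u lam x 0 j)) (Ioi 0) := by
  have hd : ∀ x, HasDerivAt
      (fun x => Complex.normSq (wT u lam x 0 j) + Complex.normSq (wT u lam x 1 j))
      (2 * lam.im * Complex.normSq (wT u lam x 0 j)) x := fun x => by
    refine ((hasDerivAt_normSq (wT_hasDerivAt hu lam x j).1).add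
      (hasDerivAt_normSq (wT_hasDerivAt hu lam x j).2)).congr_deriv ?_
    simp [Complex.normSq_apply]; ring
  have hneg : ∀ x, 2 * lam.im * Complex.normSq (wT u lam x 0 j) ≤ 0 := fun x =>
    mul_nonpos_of_nonpos_of_nonneg (by linarith) (Complex.normSq_nonneg _)
  have ha : Antitone
      fun x => Complex.normSq (wT u lam x 0 j) + Complex.normSq (wT u lam x 1 j) :=
    antitone_of_deriv_nonpos (fun x => (hd x).differentiableAt)
      fun x => by rw [(hd x).deriv]; exact hneg x
  have hb : BddBelow (range fun x =>
      Complex.normSq (wT u lam x 0 j) + Complex.normSq (wT u lam x 1 j)) :=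
    ⟨0, by rintro _ ⟨x, rfl⟩; exact add_nonneg (Complex.normSq_nonneg _) (Complex.normSq_nonneg _)⟩
  have hi := integrableOn_Ioi_deriv_of_nonpos (a := 0) (hd 0).continuousAt.continuousWithinAt
    (fun x _ => hd x) (fun x _ => hneg x) (tendsto_atTop_ciInf ha hb)
  have := hi.const_mul (2 * lam.im)⁻¹
  refine this.congr (Eventually.of_forall fun x => ?_)
  have : lam.im ≠ 0 := hl.ne
  simp only
  field_simp

/-- The square of the modulus and its derivative are both integrable, so the square tends to 0. The
strict inequality Im λ < 0 enters through this square integrability. -/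
theorem tendsto_wT_zero_row {u : ℝ → ℂ} (hu : Continuous u) (hi : IntegrableOn u (Ioi 0))
    {lam : ℂ} (hl : lam.im < 0) (j : Fin 2) :
    Tendsto (fun x => wT u lam x 0 j) atTop (𝓝 0) := by
  have hs := wT_zero_row_sq_integrable hu hl j
  have hd : ∀ x, HasDerivAt (fun x => Complex.normSq (wT u lam x 0 j))
      (2 * lam.im * Complex.normSq (wT u lam x 0 j) -
        2 * (u x * (wT u lam x 0 j * conj (wT u lam x 1 j))).re) x := fun x => by
    refine (hasDerivAt_normSq (wT_hasDerivAt hu lam x j).1).congr_deriv ?_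
    simp [Complex.normSq_apply]; ring
  have h2 : IntegrableOn (fun x => 2 * lam.im * Complex.normSq (wT u lam x 0 j) -
        2 * (u x * (wT u lam x 0 j * conj (wT u lam x 1 j))).re) (Ioi 0) := by
    refine (hs.const_mul _).sub (Integrable.const_mul ?_ 2)
    refine (integrableOn_mul_bdd (C := 1) measurableSet_Ioi hi ((wT_continuous hu lam 0 j).mul
      (Complex.continuous_conj.comp (wT_continuous hu lam 1 j))) fun x hx => ?_).re
    simp only [Pi.mul_apply, Function.comp]
    rw [norm_mul]
    exact mul_le_one₀ (norm_wT_le hu hl.le (le_of_lt hx) 0 j) (norm_nonneg _)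
      (by rw [RCLike.norm_conj]; exact norm_wT_le hu hl.le (le_of_lt hx) 1 j)
  have h3 := tendsto_zero_of_hasDerivAt_of_integrableOn_Ioi (fun x _ => hd x) h2 hs
  refine tendsto_zero_iff_norm_tendsto_zero.2 ?_
  have h4 := (Real.continuous_sqrt.tendsto 0).comp h3
  rw [Real.sqrt_zero] at h4
  refine h4.congr fun x => ?_
  simp [Complex.normSq_eq_norm_sq]

/-- Counterpart for the solution normalized at infinity: its energy is nondecreasing with a finite
limit. The two results together make the functional gradients square integrable on the half-line. -/
theorem jostSol_zero_sq_integrable {u : ℝ → ℂ} (hu : Continuous u) (hi : IntegrableOn u (Ioi 0))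
    {lam : ℂ} (hl : lam.im < 0) :
    IntegrableOn (fun y => Complex.normSq (jostSol u lam y 0)) (Ioi 0) := by
  have hd : ∀ x, HasDerivAt
      (fun x => Complex.normSq (jostSol u lam x 0) + Complex.normSq (jostSol u lam x 1))
      (-(2 * lam.im) * Complex.normSq (jostSol u lam x 0)) x := fun x => by
    refine ((hasDerivAt_normSq (jostSol_hasDerivAt hu lam x).1).add
      (hasDerivAt_normSq (jostSol_hasDerivAt hu lam x).2)).congr_deriv ?_
    simp [Complex.normSq_apply]; ring
  have hpos : ∀ x, 0 ≤ -(2 * lam.im) * Complex.normSq (jostSol u lam x 0) := fun x =>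
    mul_nonneg (by linarith) (Complex.normSq_nonneg _)
  have ht : Tendsto (fun x => Complex.normSq (jostSol u lam x 0)
      + Complex.normSq (jostSol u lam x 1)) atTop
      (𝓝 (Complex.normSq ((1 : Mat2) 1 0) + Complex.normSq ((1 : Mat2) 1 1))) :=
    ((Complex.continuous_normSq.tendsto _).comp (tendsto_jostSol_atTop hu hi hl.le 0)).add
      ((Complex.continuous_normSq.tendsto _).comp (tendsto_jostSol_atTop hu hi hl.le 1))
  have hI := integrableOn_Ioi_deriv_of_nonneg (a := 0) (hd 0).continuousAt.continuousWithinAt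
    (fun x _ => hd x) (fun x _ => hpos x) ht
  have := hI.const_mul (-(2 * lam.im))⁻¹
  refine this.congr (Eventually.of_forall fun x => ?_)
  have : lam.im ≠ 0 := hl.ne
  simp only
  field_simp

/-! ### Variation of the transition matrix -/

/-- The off-diagonal matrix `δU` of a variation `d` of the potential. -/
def varU (d : ℂ) : Mat2 := !![0, -conj d; d, 0]

theorem mul_varU_mul (A B : Mat2) (d : ℂ) (i j : Fin 2) :
    (A * varU d * B) i j = A i 1 * d * B 0 j - A i 0 * conj d * B 1 j := by
  simp [varU, Matrix.mul_apply, Fin.sum_univ_two]; ring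

theorem laxU_sub (p q : ℝ → ℂ) (lam : ℂ) (x : ℝ) :
    laxU p lam x - laxU q lam x = varU (p x - q x) := by
  ext i j
  fin_cases i <;> fin_cases j <;> simp [laxU, varU]
  ring

/-- Duhamel's formula, exact rather than to first order: T_q(L) T_q(y)⁻¹ T_p(y) interpolates between
T_q(L) at y = 0 and T_p(L) at y = L, and its derivative sees only the difference of the two
potentials. -/
theorem transition_sub {p q : ℝ → ℂ} (hp : Continuous p) (hq : Continuous q) (lam : ℂ) (L : ℝ)
    (i j : Fin 2) :
    transition p lam L i j - transition q lam L i j =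
      ∫ y in (0 : ℝ)..L, (propagator q lam L y i 1 * (p y - q y) * transition p lam y 0 j
        - propagator q lam L y i 0 * conj (p y - q y) * transition p lam y 1 j) := by
  have hd : ∀ y, HasDerivAt (fun y => (propagator q lam L y * transition p lam y) i j)
      (propagator q lam L y i 1 * (p y - q y) * transition p lam y 0 j
        - propagator q lam L y i 0 * conj (p y - q y) * transition p lam y 1 j) y := by
    intro y
    have h1 := hasDerivAt_mul_apply (A := fun _ => transition q lam L) (A' := 0) (x := y)
      (fun i j => hasDerivAt_const _ _) (transitionInv_hasDerivAt hq lam y)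
    have h2 := hasDerivAt_mul_apply h1 (transition_hasDerivAt hp lam y) i j
    refine h2.congr_deriv ?_
    rw [← mul_varU_mul, ← laxU_sub p q lam, propagator]
    simp only [zero_mul, zero_add, Matrix.mul_neg, Matrix.neg_mul, Matrix.mul_sub, Matrix.sub_mul,
      Matrix.mul_assoc]
    rw [sub_eq_neg_add]
  rw [intervalIntegral.integral_eq_sub_of_hasDerivAt (fun y _ => hd y)]
  · rw [propagator_self hq, propagator_zero_right, transition_zero, one_mul, mul_one]
  · refine Continuous.intervalIntegrable ?_ _ _
    have c1 := propagator_continuous_right hq lam L i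
    have c2 := fun i => transition_continuous hp lam i j
    have c3 := hp.sub hq
    exact (((c1 1).mul c3).mul (c2 0)).sub
      (((c1 0).mul (Complex.continuous_conj.comp c3)).mul (c2 1))

/-- A family of potentials that is differentiable at `s₀`, with derivative `v`, in the `L¹`
sense. -/
structure DiffFamily (u : ℝ → ℝ → ℂ) (v : ℝ → ℂ) (s₀ : ℝ) : Prop where
  cont : ∀ᶠ s in 𝓝 s₀, Continuous (u s)
  int : ∀ᶠ s in 𝓝 s₀, IntegrableOn (u s) (Ioi 0)
  vcont : Continuous v
  vint : IntegrableOn v (Ioi 0)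
  deriv : ∀ y, 0 ≤ y → HasDerivAt (fun s => u s y) (v y) s₀
  dom : ∃ B : ℝ → ℝ, IntegrableOn B (Ioi 0) ∧
    ∀ᶠ s in 𝓝 s₀, ∀ y, 0 ≤ y → ‖u s y - u s₀ y‖ ≤ B y * |s - s₀|

namespace DiffFamily

variable {u : ℝ → ℝ → ℂ} {v : ℝ → ℂ} {s₀ : ℝ}

theorem cbar (h : DiffFamily u v s₀) : DiffFamily (fun s => cbar (u s)) (cbar v) s₀ where
  cont := h.cont.mono fun _ => continuous_cbar
  int := h.int.mono fun s hs => by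
    refine (integrable_norm_iff ?_).1 ?_
    · exact Complex.continuous_conj.comp_aestronglyMeasurable hs.aestronglyMeasurable
    · simpa [NLSBoundary.cbar] using hs.norm
  vcont := continuous_cbar h.vcont
  vint := by
    refine (integrable_norm_iff ?_).1 ?_
    · exact Complex.continuous_conj.comp_aestronglyMeasurable h.vint.aestronglyMeasurable
    · simpa [NLSBoundary.cbar] using h.vint.norm
  deriv := fun y hy => (h.deriv y hy).star
  dom := by
    obtain ⟨B, hB, h2⟩ := h.dom
    refine ⟨B, hB, h2.mono fun s hs y hy => ?_⟩
    rw [NLSBoundary.cbar, NLSBoundary.cbar, ← map_sub, RCLike.norm_conj]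
    exact hs y hy

end DiffFamily

/-- Differentiation under the integral sign for the variation formulas. -/
theorem hasDerivAt_of_kernel {R : ℝ → ℂ} {u : ℝ → ℝ → ℂ} {v : ℝ → ℂ} {s₀ : ℝ} {A : Set ℝ}
    (hA : MeasurableSet A) (hA0 : A ⊆ Ici 0) (hu : DiffFamily u v s₀) {k0 k1 : ℝ → ℂ}
    {m0 m1 : ℝ → ℝ → ℂ} {C : ℝ}
    (hk0 : Continuous k0) (hk1 : Continuous k1)
    (hm0 : ∀ᶠ s in 𝓝 s₀, Continuous (m0 s)) (hm1 : ∀ᶠ s in 𝓝 s₀, Continuous (m1 s))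
    (bk0 : ∀ y ∈ A, ‖k0 y‖ ≤ C) (bk1 : ∀ y ∈ A, ‖k1 y‖ ≤ C)
    (bm0 : ∀ᶠ s in 𝓝 s₀, ∀ y ∈ A, ‖m0 s y‖ ≤ C) (bm1 : ∀ᶠ s in 𝓝 s₀, ∀ y ∈ A, ‖m1 s y‖ ≤ C)
    (tm0 : ∀ y ∈ A, Tendsto (fun s => m0 s y) (𝓝 s₀) (𝓝 (m0 s₀ y)))
    (tm1 : ∀ y ∈ A, Tendsto (fun s => m1 s y) (𝓝 s₀) (𝓝 (m1 s₀ y)))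
    (hR : ∀ᶠ s in 𝓝 s₀, R s - R s₀ =
      ∫ y in A, (k1 y * (u s y - u s₀ y) * m0 s y - k0 y * conj (u s y - u s₀ y) * m1 s y)) :
    HasDerivAt R (∫ y in A, (k1 y * v y * m0 s₀ y - k0 y * conj (v y) * m1 s₀ y)) s₀ := by
  obtain ⟨B, hB, hdom⟩ := hu.dom
  rw [hasDerivAt_iff_tendsto_slope]
  have hle : 𝓝[≠] s₀ ≤ 𝓝 s₀ := nhdsWithin_le_nhds
  have hne : ∀ᶠ s in 𝓝[≠] s₀, s ≠ s₀ := eventually_mem_nhdsWithin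
  have hC : (A.Nonempty → 0 ≤ C) := fun ⟨y, hy⟩ => (norm_nonneg _).trans (bk0 y hy)
  set q : ℝ → ℝ → ℂ := fun s y => ((s - s₀ : ℝ) : ℂ)⁻¹ * (u s y - u s₀ y) with hq
  have hqn : ∀ᶠ s in 𝓝[≠] s₀, ∀ y ∈ A, ‖q s y‖ ≤ B y := by
    filter_upwards [hle hdom, hne] with s hs hne y hy
    have h0 : 0 < |s - s₀| := abs_pos.2 (sub_ne_zero.2 hne)
    rw [hq]
    simp only [norm_mul, norm_inv, Complex.norm_real, Real.norm_eq_abs]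
    rw [inv_mul_le_iff₀ h0, mul_comm]
    exact hs y (hA0 hy)
  have hqt : ∀ y ∈ A, Tendsto (fun s => q s y) (𝓝[≠] s₀) (𝓝 (v y)) := by
    intro y hy
    have := hasDerivAt_iff_tendsto_slope.1 (hu.deriv y (hA0 hy))
    refine this.congr fun s => ?_
    rw [slope_def_module, hq]
    simp [Complex.real_smul]
  -- Since the difference formula is exact, the difference quotient of R is an integral with s only
  -- in the quotient of the potential and in one solution factor. The majorant 2C²B allows dominated
  -- convergence.
  have main : Tendsto (fun s => ∫ y in A, (k1 y * q s y * m0 s y - k0 y * conj (q s y) * m1 s y))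
      (𝓝[≠] s₀) (𝓝 (∫ y in A, (k1 y * v y * m0 s₀ y - k0 y * conj (v y) * m1 s₀ y))) := by
    refine tendsto_integral_filter_of_dominated_convergence (fun y => 2 * C * C * B y) ?_ ?_ ?_ ?_
    · filter_upwards [hle hu.cont, hle hm0, hle hm1] with s hs h0 h1
      have hqc : Continuous (q s) := continuous_const.mul (hs.sub hu.cont.self_of_nhds)
      exact (((hk1.mul hqc).mul h0).sub
        ((hk0.mul (Complex.continuous_conj.comp hqc)).mul h1)).aestronglyMeasurable
    · filter_upwards [hqn, hle bm0, hle bm1] with s hs h0 h1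
      refine (ae_restrict_iff' hA).2 (Eventually.of_forall fun y hy => ?_)
      have hC0 := hC ⟨y, hy⟩
      have b0 : ‖k1 y * q s y * m0 s y‖ ≤ C * B y * C := by
        rw [norm_mul, norm_mul]
        have hBy : 0 ≤ B y := (norm_nonneg _).trans (hs y hy)
        exact mul_le_mul (mul_le_mul (bk1 y hy) (hs y hy) (norm_nonneg _) hC0) (h0 y hy)
          (norm_nonneg _) (mul_nonneg hC0 hBy)
      have b1 : ‖k0 y * conj (q s y) * m1 s y‖ ≤ C * B y * C := by
        rw [norm_mul, norm_mul, RCLike.norm_conj]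
        have hBy : 0 ≤ B y := (norm_nonneg _).trans (hs y hy)
        exact mul_le_mul (mul_le_mul (bk0 y hy) (hs y hy) (norm_nonneg _) hC0) (h1 y hy)
          (norm_nonneg _) (mul_nonneg hC0 hBy)
      refine (norm_sub_le _ _).trans ((add_le_add b0 b1).trans (le_of_eq (by ring)))
    · have h1 : (A : Set ℝ) ≤ᵐ[volume] Ici 0 := (Eventually.of_forall fun y hy => hA0 hy)
      exact Integrable.const_mul (hB.mono_set_ae (h1.trans Ioi_ae_eq_Ici.symm.le)) _
    · refine (ae_restrict_iff' hA).2 (Eventually.of_forall fun y hy => ?_)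
      exact (((hqt y hy).const_mul _).mul ((tm0 y hy).mono_left hle)).sub
        ((((Complex.continuous_conj.tendsto _).comp (hqt y hy)).const_mul _).mul
          ((tm1 y hy).mono_left hle))
  refine main.congr' ?_
  filter_upwards [hle hR] with s hs
  rw [slope_def_module, hs, Complex.real_smul]
  rw [← integral_const_mul]
  refine integral_congr_ae (Eventually.of_forall fun y => ?_)
  simp only [hq, map_mul, map_inv₀, Complex.conj_ofReal, Complex.ofReal_inv]
  ring

section Family

variable {u : ℝ → ℝ → ℂ} {v : ℝ → ℂ} {s₀ : ℝ}

theorem DiffFamily.tendsto_transition (h : DiffFamily u v s₀) (lam : ℂ) {L : ℝ} (hL : 0 ≤ L)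
    (i j : Fin 2) : Tendsto (fun s => transition (u s) lam L i j) (𝓝 s₀)
      (𝓝 (transition (u s₀) lam L i j)) := by
  obtain ⟨B, hB, hdom⟩ := h.dom
  have hc0 := h.cont.self_of_nhds
  set E := Real.exp (|lam.im| * L / 2)
  have hE : 0 < E := Real.exp_pos _
  have hBi : IntegrableOn B (Ioc 0 L) := hB.mono_set fun x hx => hx.1
  have hBL : IntervalIntegrable B volume 0 L := (intervalIntegrable_iff_integrableOn_Ioc_of_le hL).2 hBi
  have ht : Tendsto (fun s => |s - s₀| * ∫ y in (0 : ℝ)..L, 2 * E * E * B y) (𝓝 s₀) (𝓝 0) := by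
    have : Tendsto (fun s => |s - s₀|) (𝓝 s₀) (𝓝 0) := by
      have := (continuous_abs.comp (continuous_id.sub continuous_const)).tendsto (x := s₀)
        (f := fun s : ℝ => |s - s₀|)
      simpa using this
    simpa using this.mul_const (∫ y in (0 : ℝ)..L, 2 * E * E * B y)
  refine tendsto_iff_norm_sub_tendsto_zero.2 (squeeze_zero' (Eventually.of_forall fun _ =>
    norm_nonneg _) ?_ ht)
  filter_upwards [h.cont, hdom] with s hs hd
  rw [transition_sub hs hc0, ← intervalIntegral.integral_const_mul]
  refine intervalIntegral.norm_integral_le_of_norm_le hL (Eventually.of_forall fun y hy => ?_)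
    ((hBL.const_mul _).const_mul _)
  have hexp : ∀ z, z ≤ L → Real.exp (|lam.im| * z / 2) ≤ E := fun z hz =>
    Real.exp_le_exp.2 (by have := abs_nonneg lam.im; nlinarith)
  have hP : ∀ j, ‖propagator (u s₀) lam L y i j‖ ≤ E := fun j =>
    (norm_propagator_le hc0 lam hy.2 i j).trans (hexp _ (by linarith [hy.1]))
  have hT : ∀ i, ‖transition (u s) lam y i j‖ ≤ E := fun i =>
    (norm_transition_le hs lam hy.1.le i j).trans (hexp _ hy.2)
  have hdy := hd y hy.1.le
  have hB0 := (norm_nonneg _).trans hdy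
  refine (norm_sub_le _ _).trans ?_
  rw [norm_mul, norm_mul, norm_mul, norm_mul, RCLike.norm_conj]
  have e0 := mul_le_mul (mul_le_mul (hP 1) hdy (norm_nonneg _) hE.le) (hT 0) (norm_nonneg _)
    (mul_nonneg hE.le hB0)
  have e1 := mul_le_mul (mul_le_mul (hP 0) hdy (norm_nonneg _) hE.le) (hT 1) (norm_nonneg _)
    (mul_nonneg hE.le hB0)
  linarith

theorem DiffFamily.transition_hasDerivAt (h : DiffFamily u v s₀) (lam : ℂ) {L : ℝ} (hL : 0 ≤ L)
    (i j : Fin 2) : HasDerivAt (fun s => transition (u s) lam L i j)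
      (∫ y in Ioc 0 L, (propagator (u s₀) lam L y i 1 * v y * transition (u s₀) lam y 0 j
        - propagator (u s₀) lam L y i 0 * conj (v y) * transition (u s₀) lam y 1 j)) s₀ := by
  have hc0 := h.cont.self_of_nhds
  set E := Real.exp (|lam.im| * L / 2)
  have hexp : ∀ z, z ≤ L → Real.exp (|lam.im| * z / 2) ≤ E := fun z hz =>
    Real.exp_le_exp.2 (by have := abs_nonneg lam.im; nlinarith)
  have hP : ∀ y ∈ Ioc 0 L, ∀ j, ‖propagator (u s₀) lam L y i j‖ ≤ E := fun y hy j =>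
    (norm_propagator_le hc0 lam hy.2 i j).trans (hexp _ (by linarith [hy.1]))
  have hT : ∀ i, ∀ᶠ s in 𝓝 s₀, ∀ y ∈ Ioc 0 L, ‖transition (u s) lam y i j‖ ≤ E := fun i =>
    h.cont.mono fun s hs y hy => (norm_transition_le hs lam hy.1.le i j).trans (hexp _ hy.2)
  refine hasDerivAt_of_kernel (R := fun s => transition (u s) lam L i j)
    (m0 := fun s y => transition (u s) lam y 0 j) (m1 := fun s y => transition (u s) lam y 1 j)
    measurableSet_Ioc (fun y hy => hy.1.le) h (propagator_continuous_right hc0 lam L i 0)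
    (propagator_continuous_right hc0 lam L i 1)
    (h.cont.mono fun s hs => transition_continuous hs lam 0 j)
    (h.cont.mono fun s hs => transition_continuous hs lam 1 j)
    (fun y hy => hP y hy 0) (fun y hy => hP y hy 1) (hT 0) (hT 1)
    (fun y hy => h.tendsto_transition lam hy.1.le 0 j)
    (fun y hy => h.tendsto_transition lam hy.1.le 1 j) ?_
  filter_upwards [h.cont] with s hs
  rw [transition_sub hs hc0, intervalIntegral.integral_of_le hL]

end Family

/-- Passage to the limit `L → ∞` in the variation formulas. -/
theorem tendsto_kernel {u : ℝ → ℂ} (hu : Continuous u) (hi : IntegrableOn u (Ioi 0)) {lam : ℂ}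
    (hl : lam.im ≤ 0) {d m0 m1 : ℝ → ℂ} (hd : Continuous d) (hdi : IntegrableOn d (Ioi 0))
    (h0 : Continuous m0) (h1 : Continuous m1) (b0 : ∀ y, 0 ≤ y → ‖m0 y‖ ≤ 1)
    (b1 : ∀ y, 0 ≤ y → ‖m1 y‖ ≤ 1) :
    Tendsto (fun L : ℝ => ∫ y in Ioc 0 L, (wP u lam L y 1 1 * d y * m0 y
        - wP u lam L y 1 0 * conj (d y) * m1 y)) atTop
      (𝓝 (∫ y in Ioi 0, (jostSol u lam y 1 * d y * m0 y
        - jostSol u lam y 0 * conj (d y) * m1 y))) := by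
  have e : ∀ L : ℝ, ∫ y in Ioc 0 L, (wP u lam L y 1 1 * d y * m0 y
        - wP u lam L y 1 0 * conj (d y) * m1 y) =
      ∫ y in Ioi 0, (Iic L).indicator (fun y => wP u lam L y 1 1 * d y * m0 y
        - wP u lam L y 1 0 * conj (d y) * m1 y) y := fun L => by
    rw [setIntegral_indicator measurableSet_Iic]; rfl
  simp_rw [e]
  refine tendsto_integral_filter_of_dominated_convergence (fun y => 2 * ‖d y‖) ?_ ?_ ?_ ?_
  · refine Eventually.of_forall fun L => AEStronglyMeasurable.indicator ?_ measurableSet_Iic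
    have c1 := wP_continuous_right hu lam L 1
    exact ((((c1 1).mul hd).mul h0).sub
      (((c1 0).mul (Complex.continuous_conj.comp hd)).mul h1)).aestronglyMeasurable
  · refine Eventually.of_forall fun L => (ae_restrict_iff' measurableSet_Ioi).2
      (Eventually.of_forall fun y (hy : 0 < y) => ?_)
    by_cases hyL : y ∈ Iic L
    · rw [indicator_of_mem hyL]
      refine (norm_sub_le _ _).trans ?_
      rw [norm_mul, norm_mul, norm_mul, norm_mul, RCLike.norm_conj]
      have hw := fun j => norm_wP_le hu hl hyL 1 j
      have e0 : ‖wP u lam L y 1 1‖ * ‖d y‖ * ‖m0 y‖ ≤ 1 * ‖d y‖ * 1 := by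
        gcongr
        exacts [hw 1, b0 y hy.le]
      have e1 : ‖wP u lam L y 1 0‖ * ‖d y‖ * ‖m1 y‖ ≤ 1 * ‖d y‖ * 1 := by
        gcongr
        exacts [hw 0, b1 y hy.le]
      linarith
    · rw [indicator_of_notMem hyL, norm_zero]; positivity
  · exact hdi.norm.const_mul 2
  · refine Eventually.of_forall fun y => ?_
    have := (((tendsto_jostSol hu hi hl y 1).mul_const (d y)).mul_const (m0 y)).sub
      (((tendsto_jostSol hu hi hl y 0).mul_const (conj (d y))).mul_const (m1 y))
    refine this.congr' ?_
    filter_upwards [eventually_ge_atTop y] with L hL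
    rw [indicator_of_mem (show y ∈ Iic L from hL)]

/-- Weighted kernels. -/
theorem weight_mul_kernel (p q : ℝ → ℂ) (lam : ℂ) (L y : ℝ) (d e : ℂ) (i j : Fin 2) :
    weight lam L * (propagator q lam L y i 1 * d * transition p lam y 0 j
        - propagator q lam L y i 0 * e * transition p lam y 1 j) =
      wP q lam L y i 1 * d * wT p lam y 0 j - wP q lam L y i 0 * e * wT p lam y 1 j := by
  have h0 := weight_ne_zero lam y
  simp only [wP, wT, Matrix.smul_apply, smul_eq_mul]
  field_simp

/-- The limit L → ∞ is taken in the exact difference formula, and only then is s differentiated; the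
derivative is never interchanged with the limit L → ∞. -/
theorem DiffFamily.jost_hasDerivAt {u : ℝ → ℝ → ℂ} {v : ℝ → ℂ} {s₀ : ℝ} (h : DiffFamily u v s₀)
    {lam : ℂ} (hl : lam.im ≤ 0) (j : Fin 2) : HasDerivAt (fun s => jost (u s) lam j)
      (∫ y in Ioi 0, (jostSol (u s₀) lam y 1 * v y * wT (u s₀) lam y 0 j
        - jostSol (u s₀) lam y 0 * conj (v y) * wT (u s₀) lam y 1 j)) s₀ := by
  have hc0 := h.cont.self_of_nhds
  have hi0 := h.int.self_of_nhds
  have ht : ∀ i, ∀ y ∈ Ioi (0 : ℝ), Tendsto (fun s => wT (u s) lam y i j) (𝓝 s₀)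
      (𝓝 (wT (u s₀) lam y i j)) := fun i y hy =>
    (h.tendsto_transition lam (le_of_lt hy) i j).const_mul _
  have hb : ∀ i, ∀ᶠ s in 𝓝 s₀, ∀ y ∈ Ioi (0 : ℝ), ‖wT (u s) lam y i j‖ ≤ 1 := fun i =>
    h.cont.mono fun s hs y hy => norm_wT_le hs hl (le_of_lt hy) i j
  refine hasDerivAt_of_kernel (R := fun s => jost (u s) lam j)
    (m0 := fun s y => wT (u s) lam y 0 j) (m1 := fun s y => wT (u s) lam y 1 j)
    measurableSet_Ioi Ioi_subset_Ici_self h (jostSol_continuous hc0 lam 0)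
    (jostSol_continuous hc0 lam 1)
    (h.cont.mono fun s hs => wT_continuous hs lam 0 j)
    (h.cont.mono fun s hs => wT_continuous hs lam 1 j)
    (fun y hy => norm_jostSol_le hc0 hi0 hl y 0) (fun y hy => norm_jostSol_le hc0 hi0 hl y 1)
    (hb 0) (hb 1) (ht 0) (ht 1) ?_
  filter_upwards [h.cont, h.int] with s hs hsi
  refine tendsto_nhds_unique ((tendsto_jost hs hsi hl j).sub (tendsto_jost hc0 hi0 hl j)) ?_
  refine (tendsto_kernel hc0 hi0 hl (hs.sub hc0) (hsi.sub hi0) (wT_continuous hs lam 0 j)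
    (wT_continuous hs lam 1 j) (fun y hy => norm_wT_le hs hl hy 0 j)
    (fun y hy => norm_wT_le hs hl hy 1 j)).congr' ?_
  filter_upwards [eventually_ge_atTop 0] with L hL
  rw [← intervalIntegral.integral_of_le hL]
  simp only [wT, Matrix.smul_apply, smul_eq_mul, Pi.sub_apply]
  rw [← mul_sub, transition_sub hs hc0, ← intervalIntegral.integral_const_mul]
  refine intervalIntegral.integral_congr fun y _ => ?_
  simp only [weight_mul_kernel]
  simp [wT]

/-! ### Uniformly rapidly decreasing families -/

/-- Families of smooth functions that decrease rapidly on the half-line, with all derivatives,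
uniformly along a filter. -/
def RapidDecay {ι : Type*} (l : Filter ι) (f : ι → ℝ → ℂ) : Prop :=
  (∀ᶠ t in l, ContDiff ℝ ∞ (f t)) ∧
    ∀ m N : ℕ, ∃ C : ℝ, ∀ᶠ t in l, ∀ x : ℝ, 0 ≤ x → x ^ N * ‖iteratedDeriv m (f t) x‖ ≤ C

theorem rapidDecay_pure {ι : Type*} {f : ι → ℝ → ℂ} {t : ι} :
    RapidDecay (pure t) f ↔ HalfLineSchwartz (f t) := by
  simp [RapidDecay, HalfLineSchwartz]

theorem le_inv_one_add_sq {f : ℝ} {x C₀ C₂ : ℝ} (h0 : f ≤ C₀) (h2 : x ^ 2 * f ≤ C₂) :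
    f ≤ (C₀ + C₂) * (1 + x ^ 2)⁻¹ := by
  rw [← div_eq_mul_inv, le_div_iff₀ (by positivity)]
  linarith

theorem hasDerivAt_dInv {f : ℝ → ℂ} (hf : Continuous f) (hi : IntegrableOn f (Ioi 0)) (x : ℝ) :
    HasDerivAt (dInv f) (f x) x := by
  have hix : ∀ x, IntegrableOn f (Ioi x) := fun x => by
    rcases le_total 0 x with h | h
    · exact hi.mono_set (Ioi_subset_Ioi h)
    · rw [← Ioc_union_Ioi_eq_Ioi h]
      exact IntegrableOn.union (hf.integrableOn_Icc.mono_set Ioc_subset_Icc_self) hi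
  have e : dInv f = fun x => (∫ y in (0 : ℝ)..x, f y) - ∫ y in Ioi (0 : ℝ), f y := by
    ext x
    rw [dInv, ← intervalIntegral.integral_interval_add_Ioi hi (hix x)]
    ring
  rw [e]
  exact (intervalIntegral.integral_hasDerivAt_right (hf.intervalIntegrable _ _)
    hf.stronglyMeasurable.stronglyMeasurableAtFilter hf.continuousAt).sub_const _

namespace RapidDecay

variable {ι : Type*} {l : Filter ι} {f g : ι → ℝ → ℂ}

theorem congr (h : RapidDecay l f) (e : ∀ t, f t = g t) : RapidDecay l g := by
  rwa [← (funext e : f = g)]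

theorem mono {l' : Filter ι} (h : RapidDecay l f) (hl : l' ≤ l) : RapidDecay l' f :=
  ⟨hl h.1, fun m N => (h.2 m N).imp fun _ hC => hl hC⟩

theorem zero : RapidDecay l (fun _ _ => 0) := by
  refine ⟨Eventually.of_forall fun _ => contDiff_const, fun m N => ⟨0, Eventually.of_forall ?_⟩⟩
  intro _ x _
  have : iteratedDeriv m (fun _ : ℝ => (0 : ℂ)) x = 0 := by
    cases m <;> simp
  rw [this, norm_zero, mul_zero]

theorem add (hf : RapidDecay l f) (hg : RapidDecay l g) :
    RapidDecay l fun t x => f t x + g t x := by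
  refine ⟨(hf.1.and hg.1).mono fun _ h => h.1.add h.2, fun m N => ?_⟩
  obtain ⟨C, hC⟩ := hf.2 m N
  obtain ⟨D, hD⟩ := hg.2 m N
  refine ⟨C + D, ?_⟩
  filter_upwards [hf.1, hg.1, hC, hD] with t h1 h2 h3 h4 x hx
  rw [iteratedDeriv_fun_add (h1.of_le (mod_cast le_top)).contDiffAt
    (h2.of_le (mod_cast le_top)).contDiffAt]
  have := mul_le_mul_of_nonneg_left (norm_add_le (iteratedDeriv m (f t) x)
    (iteratedDeriv m (g t) x)) (pow_nonneg hx N)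
  linarith [h3 x hx, h4 x hx]

theorem mul (hf : RapidDecay l f) (hg : RapidDecay l g) :
    RapidDecay l fun t x => f t x * g t x := by
  refine ⟨(hf.1.and hg.1).mono fun _ h => h.1.mul h.2, fun m N => ?_⟩
  choose C hC using fun i => hf.2 i N
  -- In Leibniz' formula the whole weight x^N goes to the first factor; the second only has to have
  -- bounded derivatives.
  choose D hD using fun i => hg.2 i 0
  refine ⟨∑ i ∈ Finset.range (m + 1), (m.choose i : ℝ) * (C i * D (m - i)), ?_⟩
  have hC' : ∀ᶠ t in l, ∀ i ∈ Finset.range (m + 1), ∀ x : ℝ, 0 ≤ x →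
      x ^ N * ‖iteratedDeriv i (f t) x‖ ≤ C i :=
    (Filter.eventually_all_finset _).2 fun i _ => hC i
  have hD' : ∀ᶠ t in l, ∀ i ∈ Finset.range (m + 1), ∀ x : ℝ, 0 ≤ x →
      x ^ 0 * ‖iteratedDeriv (m - i) (g t) x‖ ≤ D (m - i) :=
    (Filter.eventually_all_finset _).2 fun i _ => hD (m - i)
  filter_upwards [hf.1, hg.1, hC', hD'] with t h1 h2 h3 h4 x hx
  have := norm_iteratedFDeriv_mul_le h1 h2 x (n := m) (mod_cast le_top)
  simp only [norm_iteratedFDeriv_eq_norm_iteratedDeriv] at this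
  refine (mul_le_mul_of_nonneg_left this (pow_nonneg hx N)).trans ?_
  rw [Finset.mul_sum]
  refine Finset.sum_le_sum fun i hi => ?_
  have e3 := h3 i hi x hx
  have e4 := h4 i hi x hx
  rw [pow_zero, one_mul] at e4
  have := mul_le_mul e3 e4 (norm_nonneg _) ((by positivity : (0 : ℝ) ≤ _).trans e3)
  calc _ = (m.choose i : ℝ) * (x ^ N * ‖iteratedDeriv i (f t) x‖ *
        ‖iteratedDeriv (m - i) (g t) x‖) := by ring
    _ ≤ _ := mul_le_mul_of_nonneg_left this (Nat.cast_nonneg _)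

theorem const_mul (c : ℂ) (hf : RapidDecay l f) : RapidDecay l fun t x => c * f t x := by
  refine ⟨hf.1.mono fun _ h => contDiff_const.mul h, fun m N => ?_⟩
  obtain ⟨C, hC⟩ := hf.2 m N
  refine ⟨‖c‖ * C, ?_⟩
  filter_upwards [hf.1, hC] with t h1 h3 x hx
  have e : iteratedDeriv m (fun x => c * f t x) x = c * iteratedDeriv m (f t) x :=
    iteratedDeriv_const_mul_field c _
  rw [e, norm_mul]
  have := mul_le_mul_of_nonneg_left (h3 x hx) (norm_nonneg c)
  linarith

theorem neg (hf : RapidDecay l f) : RapidDecay l fun t x => -f t x :=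
  (hf.const_mul (-1)).congr fun t => by ext; simp

theorem sub (hf : RapidDecay l f) (hg : RapidDecay l g) :
    RapidDecay l fun t x => f t x - g t x :=
  (hf.add hg.neg).congr fun t => by ext; simp [sub_eq_add_neg]

theorem cbar (hf : RapidDecay l f) : RapidDecay l fun t => cbar (f t) := by
  refine ⟨hf.1.mono fun _ h => Complex.conjCLE.contDiff.comp h, fun m N => ?_⟩
  obtain ⟨C, hC⟩ := hf.2 m N
  refine ⟨C, hC.mono fun t h x hx => ?_⟩
  have := LinearIsometryEquiv.norm_iteratedFDeriv_comp_left (𝕜 := ℝ) Complex.conjLIE (f t) x m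
  rw [norm_iteratedFDeriv_eq_norm_iteratedDeriv, norm_iteratedFDeriv_eq_norm_iteratedDeriv] at this
  have e : NLSBoundary.cbar (f t) = Complex.conjLIE ∘ f t := rfl
  simp only [e]
  rw [this]
  exact h x hx

theorem deriv (hf : RapidDecay l f) : RapidDecay l fun t => deriv (f t) := by
  refine ⟨hf.1.mono fun _ h => (contDiff_infty_iff_deriv.1 h).2, fun m N => ?_⟩
  obtain ⟨C, hC⟩ := hf.2 (m + 1) N
  refine ⟨C, hC.mono fun t h x hx => ?_⟩
  rw [← iteratedDeriv_succ']
  exact h x hx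

theorem le_inv (hf : RapidDecay l f) (N : ℕ) : ∃ C : ℝ, ∀ᶠ t in l, ∀ x : ℝ, 0 ≤ x →
    x ^ N * ‖f t x‖ ≤ C * (1 + x ^ 2)⁻¹ := by
  obtain ⟨C, hC⟩ := hf.2 0 N
  obtain ⟨D, hD⟩ := hf.2 0 (N + 2)
  refine ⟨C + D, ?_⟩
  filter_upwards [hC, hD] with t h1 h2 x hx
  have h1 := h1 x hx
  have h2 := h2 x hx
  rw [iteratedDeriv_zero] at h1 h2
  exact le_inv_one_add_sq h1 (by rw [← mul_assoc, ← pow_add, add_comm 2]; exact h2)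

theorem integrableOn (hf : RapidDecay l f) : ∀ᶠ t in l, IntegrableOn (f t) (Ioi 0) := by
  obtain ⟨C, hC⟩ := hf.le_inv 0
  filter_upwards [hf.1, hC] with t h1 h2
  refine Integrable.mono' (integrable_inv_one_add_sq.const_mul C).integrableOn
    h1.continuous.aestronglyMeasurable
    ((ae_restrict_iff' measurableSet_Ioi).2 (Eventually.of_forall fun x hx => ?_))
  simpa using h2 x (le_of_lt hx)

/-- Derivatives of positive order are derivatives of f. Only order zero needs an estimate, where x^N
≤ y^N on the domain of integration moves the weight under the integral. -/
theorem dInv (hf : RapidDecay l f) : RapidDecay l fun t => dInv (f t) := by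
  have hd : ∀ᶠ t in l, ∀ x, HasDerivAt (NLSBoundary.dInv (f t)) (f t x) x := by
    filter_upwards [hf.1, hf.integrableOn] with t h1 h2 using hasDerivAt_dInv h1.continuous h2
  have hd' : ∀ᶠ t in l, _root_.deriv (NLSBoundary.dInv (f t)) = f t :=
    hd.mono fun t h => funext fun x => (h x).deriv
  refine ⟨?_, fun m N => ?_⟩
  · filter_upwards [hf.1, hd, hd'] with t h1 h2 h3
    exact contDiff_infty_iff_deriv.2 ⟨fun x => (h2 x).differentiableAt, by rw [h3]; exact h1⟩
  · cases m with
    | succ m =>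
      obtain ⟨C, hC⟩ := hf.2 m N
      refine ⟨C, ?_⟩
      filter_upwards [hC, hd'] with t h h' x hx
      rw [iteratedDeriv_succ', h']
      exact h x hx
    | zero =>
      obtain ⟨C, hC⟩ := hf.le_inv N
      refine ⟨∫ x : ℝ, C * (1 + x ^ 2)⁻¹, ?_⟩
      filter_upwards [hC, hf.1] with t h h1 x hx
      have hCx : ∀ y : ℝ, 0 ≤ C * (1 + y ^ 2)⁻¹ := fun y => by
        have h0 := (by positivity : (0 : ℝ) ≤ 0 ^ N * ‖f t 0‖).trans (h 0 le_rfl)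
        simp at h0
        positivity
      rw [iteratedDeriv_zero, NLSBoundary.dInv, norm_neg]
      have hI := integrable_inv_one_add_sq.const_mul C
      calc x ^ N * ‖∫ y in Ioi x, f t y‖ = ‖∫ y in Ioi x, (x : ℂ) ^ N * f t y‖ := by
            rw [integral_const_mul, norm_mul, norm_pow, Complex.norm_real, Real.norm_of_nonneg hx]
        _ ≤ ∫ y in Ioi x, C * (1 + y ^ 2)⁻¹ := by
            refine norm_integral_le_of_norm_le hI.integrableOn
              ((ae_restrict_iff' measurableSet_Ioi).2 (Eventually.of_forall fun y hy => ?_))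
            have hxy : x ≤ y := le_of_lt hy
            rw [norm_mul, norm_pow, Complex.norm_real, Real.norm_of_nonneg hx]
            exact (mul_le_mul_of_nonneg_right (pow_le_pow_left₀ hx hxy N) (norm_nonneg _)).trans
              (h y (hx.trans hxy))
        _ ≤ _ := setIntegral_le_integral hI (Eventually.of_forall hCx)

theorem tendsto_zero [l.NeBot] (hf : RapidDecay l f) :
    ∀ᶠ t in l, Tendsto (f t) atTop (𝓝 0) := by
  obtain ⟨C, hC⟩ := hf.2 0 1
  filter_upwards [hC] with t h
  refine squeeze_zero_norm' (a := fun x => C / x) ?_ (tendsto_const_nhds.div_atTop tendsto_id)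
  filter_upwards [eventually_gt_atTop 0] with x hx
  rw [le_div_iff₀ hx, mul_comm]
  simpa using h x hx.le

end RapidDecay

namespace HalfLineSchwartz

variable {f g : ℝ → ℂ}

theorem continuous (h : HalfLineSchwartz f) : Continuous f := h.1.continuous

theorem integrableOn (h : HalfLineSchwartz f) : IntegrableOn f (Ioi 0) := by
  have := (rapidDecay_pure (t := ()) (f := fun _ => f)).2 h |>.integrableOn
  simpa using this

theorem tendsto_zero (h : HalfLineSchwartz f) : Tendsto f atTop (𝓝 0) := by
  have := (rapidDecay_pure (t := ()) (f := fun _ => f)).2 h |>.tendsto_zero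
  simpa using this

theorem cbar (h : HalfLineSchwartz f) : HalfLineSchwartz (cbar f) :=
  rapidDecay_pure.1 ((rapidDecay_pure (t := ()) (f := fun _ => f)).2 h).cbar

theorem deriv (h : HalfLineSchwartz f) : HalfLineSchwartz (deriv f) :=
  rapidDecay_pure.1 ((rapidDecay_pure (t := ()) (f := fun _ => f)).2 h).deriv

theorem dInv (h : HalfLineSchwartz f) : HalfLineSchwartz (dInv f) :=
  rapidDecay_pure.1 ((rapidDecay_pure (t := ()) (f := fun _ => f)).2 h).dInv

theorem mul (h : HalfLineSchwartz f) (hg : HalfLineSchwartz g) :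
    HalfLineSchwartz fun x => f x * g x :=
  rapidDecay_pure.1 (((rapidDecay_pure (t := ()) (f := fun _ => f)).2 h).mul
    ((rapidDecay_pure (t := ()) (f := fun _ => g)).2 hg))

theorem add (h : HalfLineSchwartz f) (hg : HalfLineSchwartz g) :
    HalfLineSchwartz fun x => f x + g x :=
  rapidDecay_pure.1 (((rapidDecay_pure (t := ()) (f := fun _ => f)).2 h).add
    ((rapidDecay_pure (t := ()) (f := fun _ => g)).2 hg))

theorem const_mul (c : ℂ) (h : HalfLineSchwartz f) : HalfLineSchwartz fun x => c * f x :=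
  rapidDecay_pure.1 (((rapidDecay_pure (t := ()) (f := fun _ => f)).2 h).const_mul c)

end HalfLineSchwartz

/-! ### The coefficients of the time part -/

/-- The coefficients `a_j` (`j ≥ 1`), `b_j`, `c_j` decrease rapidly, uniformly along a filter. -/
theorem RapidDecay.coef {ι : Type*} {l : Filter ι} {u : ι → ℝ → ℂ} (hu : RapidDecay l u) (j : ℕ) :
    RapidDecay l (fun t => (coef (u t) (j + 1)).a) ∧ RapidDecay l (fun t => (coef (u t) (j + 1)).b) ∧
      RapidDecay l (fun t => (coef (u t) (j + 1)).c) := by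
  have hub := hu.cbar
  induction j with
  | zero => exact ⟨RapidDecay.zero, hub, hu.neg⟩
  | succ j ih =>
    obtain ⟨_, hb, hc⟩ := ih
    have hS := ((hub.mul hc).add (hu.mul hb)).dInv
    have hc' : RapidDecay l (fun t => (NLSBoundary.coef (u t) (j + 2)).c) :=
      ((hc.deriv.const_mul (-Complex.I)).sub ((hu.mul hS).const_mul (2 * Complex.I))).congr
        fun t => funext fun x => by simp only [NLSBoundary.coef, NLSBoundary.cbar]; ring
    have hb' : RapidDecay l (fun t => (NLSBoundary.coef (u t) (j + 2)).b) :=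
      ((hb.deriv.const_mul Complex.I).add ((hub.mul hS).const_mul (2 * Complex.I))).congr
        fun t => funext fun x => by simp only [NLSBoundary.coef, NLSBoundary.cbar]; ring
    exact ⟨((hub.mul hc').add (hu.mul hb')).dInv.neg, hb', hc'⟩

theorem coef_schwartz {u : ℝ → ℂ} (hu : HalfLineSchwartz u) (j : ℕ) :
    HalfLineSchwartz (coef u (j + 1)).a ∧
    HalfLineSchwartz (coef u (j + 1)).b ∧ HalfLineSchwartz (coef u (j + 1)).c := by
  have := ((rapidDecay_pure (t := ()) (f := fun _ => u)).2 hu).coef j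
  exact ⟨rapidDecay_pure.1 this.1, rapidDecay_pure.1 this.2.1, rapidDecay_pure.1 this.2.2⟩

theorem coef_source_schwartz {u : ℝ → ℂ} (hu : HalfLineSchwartz u) (j : ℕ) :
    HalfLineSchwartz fun y => conj (u y) * (coef u (j + 1)).c y + u y * (coef u (j + 1)).b y :=
  (hu.cbar.mul (coef_schwartz hu j).2.2).add (hu.mul (coef_schwartz hu j).2.1)

/-- The formula for a_j also covers j = 1, because ūc₁ + ub₁ = 0. -/
theorem coef_a_eq (u : ℝ → ℂ) (j : ℕ) (x : ℝ) : (coef u (j + 1)).a x =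
    -dInv (fun y => conj (u y) * (coef u (j + 1)).c y + u y * (coef u (j + 1)).b y) x := by
  cases j with
  | zero => simp [coef, dInv, mul_comm]
  | succ j => rfl

/-- The nonlocal integral of the recursion is −a_j. In this form the recursion starts at j = 0,
since 2iu · i/2 = −u. -/
theorem coef_c_succ (u : ℝ → ℂ) (j : ℕ) (x : ℝ) : (coef u (j + 1)).c x =
    -Complex.I * deriv (coef u j).c x + 2 * Complex.I * u x * (coef u j).a x := by
  cases j with
  | zero => simp [coef]; linear_combination (- u x) * Complex.I_sq
  | succ j => rw [coef_a_eq]; simp only [coef]; ring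

theorem coef_b_succ (u : ℝ → ℂ) (j : ℕ) (x : ℝ) : (coef u (j + 1)).b x =
    Complex.I * deriv (coef u j).b x - 2 * Complex.I * conj (u x) * (coef u j).a x := by
  cases j with
  | zero => simp [coef]; linear_combination (conj (u x)) * Complex.I_sq
  | succ j => rw [coef_a_eq]; simp only [coef]; ring

theorem coef_hasDerivAt {u : ℝ → ℂ} (hu : HalfLineSchwartz u) (j : ℕ) (x : ℝ) :
    HasDerivAt (coef u j).a (-(conj (u x) * (coef u j).c x + u x * (coef u j).b x)) x ∧
    HasDerivAt (coef u j).b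
      (2 * conj (u x) * (coef u j).a x - Complex.I * (coef u (j + 1)).b x) x ∧
    HasDerivAt (coef u j).c (2 * u x * (coef u j).a x + Complex.I * (coef u (j + 1)).c x) x := by
  cases j with
  | zero =>
    refine ⟨(hasDerivAt_const x (Complex.I / 2)).congr_deriv ?_,
      (hasDerivAt_const x (0 : ℂ)).congr_deriv ?_, (hasDerivAt_const x (0 : ℂ)).congr_deriv ?_⟩ <;>
    · simp [coef]; try ring
  | succ j =>
    obtain ⟨_, hb, hc⟩ := coef_schwartz hu j
    have hs := coef_source_schwartz hu j
    refine ⟨?_, ?_, ?_⟩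
    · have := (hasDerivAt_dInv hs.continuous hs.integrableOn x).neg
      exact this.congr_of_eventuallyEq (Eventually.of_forall fun y => coef_a_eq u j y)
    · refine ((hb.1.differentiable (by simp)) x).hasDerivAt.congr_deriv ?_
      rw [coef_b_succ]
      linear_combination (deriv (coef u (j + 1)).b x - 2 * conj (u x) * (coef u (j + 1)).a x)
        * (Complex.I_sq)
    · refine ((hc.1.differentiable (by simp)) x).hasDerivAt.congr_deriv ?_
      rw [coef_c_succ]
      linear_combination (deriv (coef u (j + 1)).c x - 2 * u x * (coef u (j + 1)).a x)
        * (Complex.I_sq)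

/-- The reality conditions `b_j = -c̄_j`, `ā_j = -a_j`. -/
theorem coef_conj {u : ℝ → ℂ} (hu : HalfLineSchwartz u) (j : ℕ) :
    (∀ x, (coef u j).b x = -conj ((coef u j).c x)) ∧ ∀ x, conj ((coef u j).a x) = -(coef u j).a x := by
  have key : ∀ j, (∀ x, (coef u (j + 1)).b x = -conj ((coef u (j + 1)).c x)) →
      ∀ x, conj ((coef u (j + 1)).a x) = -(coef u (j + 1)).a x := by
    intro j h x
    rw [coef_a_eq, dInv, neg_neg, ← integral_conj, ← integral_neg]
    refine integral_congr_ae (Eventually.of_forall fun y => ?_)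
    simp [h]
  induction j with
  | zero => constructor <;> simp [coef, map_ofNat, neg_div]
  | succ j ih =>
    have hb : ∀ x, (coef u (j + 1)).b x = -conj ((coef u (j + 1)).c x) := by
      intro x
      have hd : deriv (coef u j).b x = -conj (deriv (coef u j).c x) := by
        have h1 : HasDerivAt (fun x => -conj ((coef u j).c x)) (-conj (deriv (coef u j).c x)) x := by
          have := (coef_hasDerivAt hu j x).2.2.differentiableAt.hasDerivAt
          exact this.star.neg
        rw [funext ih.1]
        exact h1.deriv
      rw [coef_b_succ, coef_c_succ, hd]
      simp [ih.2, map_ofNat]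
      ring
    exact ⟨hb, key j hb⟩

/-- `Q(λ)² = -1/4` for the formal series `Q(λ) = ∑ λ⁻ʲ Q_j`. -/
theorem coef_square {u : ℝ → ℂ} (hu : HalfLineSchwartz u) (m : ℕ) (x : ℝ) :
    ∑ p ∈ Finset.HasAntidiagonal.antidiagonal (m + 1),
      ((coef u p.1).a x * (coef u p.2).a x + (coef u p.1).b x * (coef u p.2).c x) = 0 := by
  set F : ℝ → ℂ := fun x => ∑ p ∈ Finset.HasAntidiagonal.antidiagonal (m + 1),
      ((coef u p.1).a x * (coef u p.2).a x + (coef u p.1).b x * (coef u p.2).c x) with hF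
  -- The coefficients satisfy Q' = [U, Q] as a formal series, so Q² has constant scalar
  -- coefficients, and these can be evaluated at x = +∞.
  have hd : ∀ x, HasDerivAt F 0 x := by
    intro x
    have h1 : HasDerivAt F (∑ p ∈ Finset.HasAntidiagonal.antidiagonal (m + 1),
        ((-(conj (u x) * (coef u p.1).c x + u x * (coef u p.1).b x)) * (coef u p.2).a x
          + (coef u p.1).a x * (-(conj (u x) * (coef u p.2).c x + u x * (coef u p.2).b x))
          + ((2 * conj (u x) * (coef u p.1).a x - Complex.I * (coef u (p.1 + 1)).b x)
            * (coef u p.2).c x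
          + (coef u p.1).b x * (2 * u x * (coef u p.2).a x
            + Complex.I * (coef u (p.2 + 1)).c x)))) x :=
      HasDerivAt.fun_sum fun p _ =>
        ((coef_hasDerivAt hu p.1 x).1.mul (coef_hasDerivAt hu p.2 x).1).add
          ((coef_hasDerivAt hu p.1 x).2.1.mul (coef_hasDerivAt hu p.2 x).2.2)
    refine h1.congr_deriv ?_
    have hsw : ∀ f : ℕ → ℕ → ℂ, ∑ p ∈ Finset.HasAntidiagonal.antidiagonal (m + 1), f p.1 p.2 =
        ∑ p ∈ Finset.HasAntidiagonal.antidiagonal (m + 1), f p.2 p.1 := fun f =>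
      (Finset.Nat.sum_antidiagonal_swap (f := fun p : ℕ × ℕ => f p.1 p.2)).symm
    have e1 := hsw fun i j => (coef u i).a x * (coef u j).c x
    have e2 := hsw fun i j => (coef u i).b x * (coef u j).a x
    -- Both sums equal the full convolution of order m + 2: the missing end terms contain b₀ or c₀,
    -- which vanish.
    have e3 : ∑ p ∈ Finset.HasAntidiagonal.antidiagonal (m + 1), (coef u (p.1 + 1)).b x * (coef u p.2).c x =
        ∑ p ∈ Finset.HasAntidiagonal.antidiagonal (m + 1), (coef u p.1).b x * (coef u (p.2 + 1)).c x := by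
      have h1 := Finset.Nat.sum_antidiagonal_succ (n := m + 1)
        (f := fun p : ℕ × ℕ => (coef u p.1).b x * (coef u p.2).c x)
      have h2 := Finset.Nat.sum_antidiagonal_succ' (n := m + 1)
        (f := fun p : ℕ × ℕ => (coef u p.1).b x * (coef u p.2).c x)
      have hb0 : (coef u 0).b x = 0 := rfl
      have hc0 : (coef u 0).c x = 0 := rfl
      simp only [hb0, hc0, zero_mul, mul_zero, zero_add] at h1 h2
      rw [← h1, h2]
    have e : ∀ A A' B B' C C' : ℕ × ℕ → ℂ, ∀ s : Finset (ℕ × ℕ), ∑ p ∈ s, A p = ∑ p ∈ s, A' p →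
        ∑ p ∈ s, B p = ∑ p ∈ s, B' p → ∑ p ∈ s, C p = ∑ p ∈ s, C' p →
        ∑ p ∈ s, (conj (u x) * (A p - A' p) + u x * (B p - B' p) - Complex.I * (C p - C' p)) = 0 := by
      intro A A' B B' C C' s h1 h2 h3
      rw [Finset.sum_sub_distrib, Finset.sum_add_distrib, ← Finset.mul_sum, ← Finset.mul_sum,
        ← Finset.mul_sum, Finset.sum_sub_distrib, Finset.sum_sub_distrib, Finset.sum_sub_distrib,
        h1, h2, h3]
      simp
    rw [← e _ _ _ _ _ _ _ e1 e2 e3]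
    refine Finset.sum_congr rfl fun p _ => ?_
    ring
  -- The order m + 1 is positive, so each product a_i a_j has a factor of index at least 1, which
  -- decays; a₀ is the only coefficient that does not vanish at infinity.
  have ht : Tendsto F atTop (𝓝 0) := by
    have hs := fun j => coef_schwartz hu j
    rw [← Finset.sum_const_zero (s := Finset.HasAntidiagonal.antidiagonal (m + 1))]
    refine tendsto_finsetSum _ fun p hp => ?_
    have hb : ∀ j, Tendsto (coef u j).b atTop (𝓝 0) := fun j => by
      cases j with
      | zero => exact tendsto_const_nhds
      | succ j => exact (hs j).2.1.tendsto_zero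
    have hc : ∀ j, Tendsto (coef u j).c atTop (𝓝 0) := fun j => by
      cases j with
      | zero => exact tendsto_const_nhds
      | succ j => exact (hs j).2.2.tendsto_zero
    have hbc := (hb p.1).mul (hc p.2)
    have haa : Tendsto (fun x => (coef u p.1).a x * (coef u p.2).a x) atTop (𝓝 0) := by
      obtain ⟨i, j⟩ := p
      have ha0 : Tendsto (coef u 0).a atTop (𝓝 (Complex.I / 2)) := tendsto_const_nhds
      match i, j with
      | 0, 0 => simp at hp
      | 0, j + 1 => simpa using ha0.mul (hs j).1.tendsto_zero
      | i + 1, 0 => simpa using (hs i).1.tendsto_zero.mul ha0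
      | i + 1, j + 1 => simpa using (hs i).1.tendsto_zero.mul (hs j).1.tendsto_zero
    simpa using haa.add hbc
  have hc : ∀ y, F y = F x := fun y =>
    is_const_of_deriv_eq_zero (fun x => (hd x).differentiableAt) (fun x => (hd x).deriv) y x
  exact (tendsto_nhds_unique (tendsto_const_nhds.congr fun y => (hc y).symm) ht)

/-! ### Boundary equations -/

/-- The matrix coefficients of the time part. -/
def coefMat (u : ℝ → ℂ) (x : ℝ) (j : ℕ) : Mat2 :=
  !![(coef u j).a x, (coef u j).b x; (coef u j).c x, -(coef u j).a x]

/-- The off-diagonal entries are sums of a_i b_j − b_i a_j and the like, which cancel under the swap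
of i and j; the diagonal ones are `coef_square`. -/
theorem sum_coefMat_mul {u : ℝ → ℂ} (hu : HalfLineSchwartz u) (x : ℝ) (m : ℕ) :
    ∑ p ∈ Finset.HasAntidiagonal.antidiagonal m, coefMat u x p.1 * coefMat u x p.2 =
      if m = 0 then (-1 / 4 : ℂ) • 1 else 0 := by
  cases m with
  | zero =>
    ext i j
    fin_cases i <;> fin_cases j <;> simp [coefMat, coef] <;>
    · linear_combination (1 / 4) * Complex.I_sq
  | succ m =>
    have hsw : ∀ f : ℕ → ℕ → ℂ, ∑ p ∈ Finset.HasAntidiagonal.antidiagonal (m + 1), f p.1 p.2 =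
        ∑ p ∈ Finset.HasAntidiagonal.antidiagonal (m + 1), f p.2 p.1 := fun f =>
      (Finset.Nat.sum_antidiagonal_swap (f := fun p : ℕ × ℕ => f p.1 p.2)).symm
    have h := coef_square hu m x
    have hbc := hsw fun i j => (coef u i).b x * (coef u j).c x
    have hab := hsw fun i j => (coef u i).a x * (coef u j).b x
    have hac := hsw fun i j => (coef u i).a x * (coef u j).c x
    rw [Finset.sum_add_distrib] at h
    rw [if_neg (Nat.succ_ne_zero m)]
    ext i j
    rw [Matrix.sum_apply]
    fin_cases i <;> fin_cases j <;>
      simp [coefMat, Matrix.mul_apply, Finset.sum_add_distrib]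
    · exact h
    · rw [hab]; simp [mul_comm]
    · rw [hac]; simp [mul_comm]
    · rw [hbc] at h
      rw [← h, add_comm]
      simp [mul_comm]

open PowerSeries in
/-- If `Q` and `P` have the same scalar square, leading term `diag(i/2, -i/2)`, and the coefficients
of `D = QK - KP` below `m` vanish, then the `m`-th coefficient of `D` has zero diagonal. -/
theorem diag_eq_zero_of_square {Q P K : PowerSeries Mat2} {s : PowerSeries Mat2}
    (hQ : Q * Q = s) (hP : P * P = s) (hs : s * K = K * s)
    (hQ0 : coeff 0 Q = !![Complex.I / 2, 0; 0, -(Complex.I / 2)])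
    (hP0 : coeff 0 P = !![Complex.I / 2, 0; 0, -(Complex.I / 2)])
    {m : ℕ} (hD : ∀ j < m, coeff j (Q * K - K * P) = 0) :
    (coeff m (Q * K - K * P)) 0 0 = 0 ∧ (coeff m (Q * K - K * P)) 1 1 = 0 := by
  set D := Q * K - K * P
  -- The mixed terms QKP cancel, leaving Q²K − KP², and the common square commutes with K.
  have h : Q * D + D * P = 0 := by
    have : Q * D + D * P = Q * Q * K - K * (P * P) := by
      simp only [D, mul_sub, sub_mul, mul_assoc]
      abel
    rw [this, hQ, hP, hs, sub_self]
  -- All terms of the convolution containing a lower coefficient of D drop out. There remains Q₀D_m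
  -- + D_mP₀ = 0, which on the diagonal reads ±i D_m = 0.
  have hm := congrArg (coeff m) h
  rw [map_add, coeff_mul, coeff_mul, map_zero,
    Finset.sum_eq_single (0, m), Finset.sum_eq_single (m, 0), hQ0, hP0] at hm
  · have h00 := congrFun (congrFun hm 0) 0
    have h11 := congrFun (congrFun hm 1) 1
    simp [Matrix.mul_apply, Matrix.vecMul, dotProduct, Fin.sum_univ_two] at h00 h11
    constructor
    · have : Complex.I * (coeff m D) 0 0 = 0 := by linear_combination h00
      simpa using this
    · have : Complex.I * (coeff m D) 1 1 = 0 := by linear_combination -h11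
      simpa using this
  · rintro ⟨i, j⟩ hij hne
    rw [Finset.HasAntidiagonal.mem_antidiagonal] at hij
    simp only at hij
    have : i < m := by
      refine lt_of_le_of_ne (by omega) fun h => hne ?_
      subst h
      simp at hij
      rw [hij]
    simp [hD i this]
  · intro h; simp at h
  · rintro ⟨i, j⟩ hij hne
    rw [Finset.HasAntidiagonal.mem_antidiagonal] at hij
    simp only at hij
    have : j < m := by
      refine lt_of_le_of_ne (by omega) fun h => hne ?_
      subst h
      simp at hij
      rw [hij]
    simp [hD j this]
  · intro h; simp at h

/-- The coefficients of `Q(λ)(N + M/λ) - (N + M/λ)P(λ)`. -/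
def boundaryCoeff (Q P : ℕ → Mat2) (N M : Mat2) : ℕ → Mat2
  | 0 => Q 0 * N - N * P 0
  | m + 1 => Q (m + 1) * N - N * P (m + 1) + (Q m * M - M * P m)

-- The variable X stands for λ⁻¹, so that N + XM represents K(λ)/λ.
open PowerSeries in
theorem coeff_boundary (Q P : ℕ → Mat2) (N M : Mat2) (m : ℕ) :
    coeff m (PowerSeries.mk Q * (C N + X * C M) - (C N + X * C M) * PowerSeries.mk P) =
      boundaryCoeff Q P N M m := by
  have e : PowerSeries.mk Q * (C N + X * C M) - (C N + X * C M) * PowerSeries.mk P =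
      (PowerSeries.mk Q * C N - C N * PowerSeries.mk P) +
        X * (PowerSeries.mk Q * C M - C M * PowerSeries.mk P) := by
    rw [mul_add, add_mul, mul_sub, ← mul_assoc, ← mul_assoc, ← mul_assoc,
      (PowerSeries.commute_X (PowerSeries.mk Q)).eq]
    abel
  rw [e, map_add, map_sub, coeff_mul_C, coeff_C_mul, coeff_mk, coeff_mk]
  cases m with
  | zero => simp [boundaryCoeff]
  | succ m =>
    rw [coeff_succ_X_mul, map_sub, coeff_mul_C, coeff_C_mul, coeff_mk, coeff_mk, boundaryCoeff]

/-- Two sequences of matrices as they occur in the boundary equations. -/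
structure BoundaryPair (Q P : ℕ → Mat2) : Prop where
  left_zero : Q 0 = !![Complex.I / 2, 0; 0, -(Complex.I / 2)]
  right_zero : P 0 = !![Complex.I / 2, 0; 0, -(Complex.I / 2)]
  left_sq : ∀ m, ∑ p ∈ Finset.HasAntidiagonal.antidiagonal m, Q p.1 * Q p.2 =
    if m = 0 then (-1 / 4 : ℂ) • 1 else 0
  right_sq : ∀ m, ∑ p ∈ Finset.HasAntidiagonal.antidiagonal m, P p.1 * P p.2 =
    if m = 0 then (-1 / 4 : ℂ) • 1 else 0

open PowerSeries in
theorem BoundaryPair.diag_eq_zero {Q P : ℕ → Mat2} (h : BoundaryPair Q P) (N M : Mat2) {m : ℕ}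
    (hD : ∀ j < m, boundaryCoeff Q P N M j = 0) :
    boundaryCoeff Q P N M m 0 0 = 0 ∧ boundaryCoeff Q P N M m 1 1 = 0 := by
  have hsq : ∀ R : ℕ → Mat2, (∀ m, ∑ p ∈ Finset.HasAntidiagonal.antidiagonal m, R p.1 * R p.2 =
      if m = 0 then (-1 / 4 : ℂ) • 1 else 0) →
      PowerSeries.mk R * PowerSeries.mk R = (C ((-1 / 4 : ℂ) • 1) : PowerSeries Mat2) := by
    intro R hR
    ext1 n
    rw [coeff_mul, coeff_C, ← hR n]
    simp
  have hs : (C ((-1 / 4 : ℂ) • 1) : PowerSeries Mat2) * (C N + X * C M) =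
      (C N + X * C M) * C ((-1 / 4 : ℂ) • 1) := by
    rw [mul_add, add_mul, ← mul_assoc, (PowerSeries.commute_X (C ((-1 / 4 : ℂ) • (1 : Mat2)))).eq,
      mul_assoc, mul_assoc, ← map_mul, ← map_mul, ← map_mul, ← map_mul]
    simp
  have := diag_eq_zero_of_square (hsq Q h.left_sq) (hsq P h.right_sq) hs
    (by simpa using h.left_zero) (by simpa using h.right_zero) (m := m)
    (fun j hj => by rw [coeff_boundary]; exact hD j hj)
  rwa [coeff_boundary] at this

/-- The off-diagonal entries control all the coefficients. -/
theorem BoundaryPair.eq_zero_iff {Q P : ℕ → Mat2} (h : BoundaryPair Q P) (N M : Mat2) (n : ℕ)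
    (hsym : ∀ m, boundaryCoeff Q P N M m 1 0 = 0 → boundaryCoeff Q P N M m 0 1 = 0) :
    (∀ m ≤ n, boundaryCoeff Q P N M m = 0) ↔ ∀ m ≤ n, boundaryCoeff Q P N M m 1 0 = 0 := by
  refine ⟨fun h m hm => by rw [h m hm]; rfl, fun h0 => ?_⟩
  intro m
  induction m using Nat.strong_induction_on with
  | _ m ih =>
    intro hm
    obtain ⟨h1, h2⟩ := h.diag_eq_zero N M fun j hj => ih j hj (hj.le.trans hm)
    ext i j
    fin_cases i <;> fin_cases j
    exacts [h1, hsym m (h0 m hm), h0 m hm, h2]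

/-- Coefficients of a polynomial function that vanishes identically. -/
theorem eq_zero_of_polynomial_eq_zero {n : ℕ} {d : ℕ → ℂ}
    (h : ∀ lam : ℂ, ∑ j ∈ Finset.range (n + 1), lam ^ (n + 1 - j) * d j = 0) :
    ∀ j ≤ n, d j = 0 := by
  intro j hj
  have hp : ∑ j ∈ Finset.range (n + 1), Polynomial.monomial (n + 1 - j) (d j) = 0 := by
    refine Polynomial.funext fun x => ?_
    rw [Polynomial.eval_finsetSum, Polynomial.eval_zero, ← h x]
    exact Finset.sum_congr rfl fun j _ => by rw [Polynomial.eval_monomial, mul_comm]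
  have := congrArg (fun p => Polynomial.coeff p (n + 1 - j)) hp
  simp only [Polynomial.finsetSum_coeff, Polynomial.coeff_monomial, Polynomial.coeff_zero] at this
  rw [Finset.sum_eq_single j] at this
  · simpa using this
  · intro i hi hij
    rw [Finset.mem_range] at hi
    rw [if_neg]
    omega
  · intro hj'
    simp at hj'
    omega

/-- Expansion of the right-hand side of the boundary equation in powers of `λ`. -/
theorem boundary_expansion (Q P : ℕ → Mat2) (N M : Mat2) (n : ℕ) (lam : ℂ) :
    (∑ j ∈ Finset.range (n + 1), lam ^ (n - j) • Q j) * (lam • N + M)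
      - (lam • N + M) * ∑ j ∈ Finset.range (n + 1), lam ^ (n - j) • P j =
    ∑ j ∈ Finset.range (n + 1), lam ^ (n + 1 - j) • boundaryCoeff Q P N M j
      + (Q n * M - M * P n) := by
  have e : ∀ R : ℕ → Mat2, ∑ j ∈ Finset.range (n + 1), lam ^ (n - j) • R j =
      ∑ j ∈ Finset.range n, lam ^ (n - j) • R j + R n := fun R => by
    rw [Finset.sum_range_succ, Nat.sub_self, pow_zero, one_smul]
  have e2 : ∀ R : ℕ → Mat2, lam • ∑ j ∈ Finset.range (n + 1), lam ^ (n - j) • R j =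
      ∑ j ∈ Finset.range n, lam ^ (n - j) • R (j + 1) + lam ^ (n + 1) • R 0 := fun R => by
    rw [Finset.smul_sum, Finset.sum_range_succ']
    congr 1
    · refine Finset.sum_congr rfl fun j hj => ?_
      rw [Finset.mem_range] at hj
      rw [smul_smul, ← pow_succ']
      congr 2; omega
    · rw [smul_smul, ← pow_succ', Nat.sub_zero]
  have e3 : ∑ j ∈ Finset.range (n + 1), lam ^ (n + 1 - j) • boundaryCoeff Q P N M j =
      ∑ j ∈ Finset.range n, lam ^ (n - j) • boundaryCoeff Q P N M (j + 1)
        + lam ^ (n + 1) • boundaryCoeff Q P N M 0 := by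
    rw [Finset.sum_range_succ', Nat.sub_zero]
    congr 1
    exact Finset.sum_congr rfl fun j _ => by rw [Nat.add_sub_add_right]
  rw [mul_add, add_mul, Matrix.mul_smul, Matrix.smul_mul, ← Matrix.smul_mul, ← Matrix.mul_smul, e2 Q,
    e2 P, e Q, e P, e3]
  simp only [boundaryCoeff, add_mul, mul_add, Finset.sum_mul, Finset.mul_sum, Matrix.smul_mul,
    Matrix.mul_smul, smul_add, smul_sub, Finset.sum_add_distrib, Finset.sum_sub_distrib]
  abel

/-- The boundary equation for all `λ` in terms of the coefficients. -/
theorem boundaryEq_iff (Q P : ℕ → Mat2) (N : Mat2) (M : ℝ → Mat2) (n : ℕ) (t : ℝ) :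
    (∀ lam : ℂ, ∀ i j : Fin 2, HasDerivAt (fun s => (lam • N + M s) i j)
      (((∑ j ∈ Finset.range (n + 1), lam ^ (n - j) • Q j) * (lam • N + M t)
      - (lam • N + M t) * ∑ j ∈ Finset.range (n + 1), lam ^ (n - j) • P j) i j) t) ↔
    (∀ m ≤ n, boundaryCoeff Q P N (M t) m = 0) ∧
      ∀ i j : Fin 2, HasDerivAt (fun s => M s i j) ((Q n * M t - M t * P n) i j) t := by
  have hK : ∀ (lam : ℂ) (i j : Fin 2) (d : ℂ), HasDerivAt (fun s => (lam • N + M s) i j) d t ↔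
      HasDerivAt (fun s => M s i j) d t := fun lam i j d => by
    simp only [Matrix.add_apply]
    exact hasDerivAt_const_add_iff _
  simp only [hK, boundary_expansion]
  constructor
  · intro h
    -- At λ = 0 every power λ^(n+1−j) with j ≤ n vanishes and the evolution of M alone is left.
    -- Subtracting it for general λ gives a polynomial that vanishes identically.
    have h0 : ∀ i j, HasDerivAt (fun s => M s i j) ((Q n * M t - M t * P n) i j) t := by
      intro i j
      refine (h 0 i j).congr_deriv ?_
      rw [Finset.sum_eq_zero, zero_add]
      intro m hm
      rw [Finset.mem_range] at hm
      rw [zero_pow (by omega), zero_smul]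
    refine ⟨fun m hm => ?_, h0⟩
    ext i j
    refine eq_zero_of_polynomial_eq_zero (n := n)
      (d := fun m => boundaryCoeff Q P N (M t) m i j) (fun lam => ?_) m hm
    have := (h lam i j).unique (h0 i j)
    rw [Matrix.add_apply, add_eq_right, Matrix.sum_apply] at this
    simpa using this
  · rintro ⟨h1, h2⟩ lam i j
    refine (h2 i j).congr_deriv ?_
    rw [Finset.sum_eq_zero, zero_add]
    intro m hm
    rw [Finset.mem_range] at hm
    rw [h1 m (by omega), smul_zero]

/-- The signs come from replacing λ by −λ. They multiply the convolution of order m by (−1)^m, which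
is harmless because only order 0 is nonzero. -/
theorem boundaryPair_coef {u uh : ℝ → ℂ} (hu : HalfLineSchwartz u) (huh : HalfLineSchwartz uh) :
    BoundaryPair (coefMat u 0) (fun j => (-1 : ℂ) ^ j • coefMat uh 0 j) where
  left_zero := by simp [coefMat, coef]
  right_zero := by simp [coefMat, coef]
  left_sq := sum_coefMat_mul hu 0
  right_sq := fun m => by
    have : ∀ p ∈ Finset.HasAntidiagonal.antidiagonal m,
        ((-1 : ℂ) ^ p.1 • coefMat uh 0 p.1) * ((-1 : ℂ) ^ p.2 • coefMat uh 0 p.2) =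
        (-1 : ℂ) ^ m • (coefMat uh 0 p.1 * coefMat uh 0 p.2) := fun p hp => by
      rw [Finset.HasAntidiagonal.mem_antidiagonal] at hp
      rw [Matrix.smul_mul, Matrix.mul_smul, smul_smul, ← pow_add, hp]
    rw [Finset.sum_congr rfl this, ← Finset.smul_sum, sum_coefMat_mul huh]
    split_ifs with h
    · rw [h, pow_zero, one_smul]
    · rw [smul_zero]

theorem laxV_eq (n : ℕ) (u : ℝ → ℂ) (lam : ℂ) (x : ℝ) :
    laxV n u lam x = ∑ j ∈ Finset.range (n + 1), lam ^ (n - j) • coefMat u x j := rfl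

theorem laxV_neg (n : ℕ) (u : ℝ → ℂ) (lam : ℂ) (x : ℝ) :
    laxV n u (-lam) x =
      (-1 : ℂ) ^ n • ∑ j ∈ Finset.range (n + 1), lam ^ (n - j) • ((-1 : ℂ) ^ j • coefMat u x j) := by
  rw [laxV_eq, Finset.smul_sum]
  refine Finset.sum_congr rfl fun j hj => ?_
  rw [Finset.mem_range] at hj
  rw [smul_smul, smul_smul]
  congr 1
  obtain ⟨r, rfl⟩ := Nat.exists_eq_add_of_le (Nat.lt_succ_iff.1 hj)
  rw [Nat.add_sub_cancel_left, neg_pow, pow_add]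
  have : ((-1 : ℂ) ^ j) * (-1) ^ j = 1 := by rw [← mul_pow]; simp
  linear_combination (-(-1) ^ r * lam ^ r) * this

/-! ### The square roots -/

theorem omega1_sq {β : ℝ} {z : ℂ} (hz : z ∈ evenDisc β) :
    (Omega1 β z : ℂ) ^ 2 = (β : ℂ) ^ 2 - 4 * (z * conj z) ∧ (Omega1 β z : ℂ) ≠ 0 := by
  have h : 0 < β ^ 2 - 4 * ‖z‖ ^ 2 := sub_pos.2 hz
  constructor
  · rw [Omega1, ← Complex.ofReal_pow, Real.sq_sqrt h.le, Complex.mul_conj, Complex.normSq_eq_norm_sq]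
    push_cast; ring
  · exact Complex.ofReal_ne_zero.2 (Real.sqrt_pos.2 h).ne'

theorem omega2_sq {β : ℝ} {z : ℂ} (hz : z ∈ oddDisc β) :
    (Omega2 β z : ℂ) ^ 2 = (β : ℂ) ^ 2 - z * conj z ∧ (Omega2 β z : ℂ) ≠ 0 := by
  have h : 0 < β ^ 2 - ‖z‖ ^ 2 := sub_pos.2 hz
  constructor
  · rw [Omega2, ← Complex.ofReal_pow, Real.sq_sqrt h.le, Complex.mul_conj, Complex.normSq_eq_norm_sq]
    push_cast; ring
  · exact Complex.ofReal_ne_zero.2 (Real.sqrt_pos.2 h).ne'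

theorem sqrt_normSq_hasDerivAt {B a : ℝ} {z : ℝ → ℂ} {z' : ℂ} {t : ℝ} (hz : HasDerivAt z z' t)
    (h : 0 < B - a * ‖z t‖ ^ 2) :
    HasDerivAt (fun s => ((√(B - a * ‖z s‖ ^ 2) : ℝ) : ℂ))
      (-(a / (2 * (√(B - a * ‖z t‖ ^ 2) : ℝ))) * (conj (z t) * z' + z t * conj z')) t := by
  have h1 := (((hasDerivAt_normSq hz).const_mul a).const_sub B).sqrt
    (by rw [Complex.normSq_eq_norm_sq]; exact h.ne')
  simp only [Complex.normSq_eq_norm_sq] at h1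
  refine h1.ofReal_comp.congr_deriv ?_
  have h0 := (Real.sqrt_pos.2 h).ne'
  have e : conj (z t) * z' + z t * conj z' =
      ((2 * ((z t).re * z'.re + (z t).im * z'.im) : ℝ) : ℂ) := by
    apply Complex.ext <;> simp <;> ring
  rw [e]
  push_cast
  ring

theorem omega1_hasDerivAt {β : ℝ} {z : ℝ → ℂ} {z' : ℂ} {t : ℝ} (hz : HasDerivAt z z' t)
    (h : z t ∈ evenDisc β) :
    HasDerivAt (fun s => (Omega1 β (z s) : ℂ))
      (-(2 / Omega1 β (z t)) * (conj (z t) * z' + z t * conj z')) t := by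
  have h1 : 0 < β ^ 2 - 4 * ‖z t‖ ^ 2 := sub_pos.2 h
  refine (sqrt_normSq_hasDerivAt hz h1).congr_deriv ?_
  have h0 := (omega1_sq h).2
  rw [← Omega1]
  push_cast
  field_simp
  ring

theorem omega2_hasDerivAt {β : ℝ} {z : ℝ → ℂ} {z' : ℂ} {t : ℝ} (hz : HasDerivAt z z' t)
    (h : z t ∈ oddDisc β) :
    HasDerivAt (fun s => (Omega2 β (z s) : ℂ))
      (-(1 / (2 * Omega2 β (z t))) * (conj (z t) * z' + z t * conj z')) t := by
  have h1 : 0 < β ^ 2 - 1 * ‖z t‖ ^ 2 := by rw [one_mul]; exact sub_pos.2 h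
  have := sqrt_normSq_hasDerivAt hz h1
  simp only [one_mul] at this
  refine this.congr_deriv ?_
  rw [Omega2]
  push_cast
  ring

/-! ### Solutions -/

namespace IsHalfLineSolution

variable {n : ℕ} {J : Set ℝ} {u : ℝ → ℝ → ℂ}

theorem contDiffAt (h : IsHalfLineSolution n J u) (hJ : IsOpen J) {t : ℝ} (ht : t ∈ J) (x : ℝ) :
    ContDiffAt ℝ ∞ (fun p : ℝ × ℝ => u p.1 p.2) (x, t) :=
  h.smooth.contDiffAt ((isOpen_univ.prod hJ).mem_nhds ⟨mem_univ _, ht⟩)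

theorem contDiff_space (h : IsHalfLineSolution n J u) (hJ : IsOpen J) {t : ℝ} (ht : t ∈ J) :
    ContDiff ℝ ∞ fun x => u x t :=
  contDiff_iff_contDiffAt.2 fun x =>
    (h.contDiffAt hJ ht x).comp x (contDiffAt_id.prodMk contDiffAt_const)

theorem hasDerivAt_time (h : IsHalfLineSolution n J u) (hJ : IsOpen J) {t : ℝ} (ht : t ∈ J) {x : ℝ}
    (hx : 0 ≤ x) : HasDerivAt (fun s => u x s)
      (Complex.I * (coef (fun y => u y t) (n + 1)).c x) t := by
  have h1 : ContDiffAt ℝ ∞ (fun s => u x s) t :=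
    (h.contDiffAt hJ ht x).comp t (contDiffAt_const.prodMk contDiffAt_id)
  rw [← h.nls t ht x hx]
  exact (h1.differentiableAt (by simp)).hasDerivAt

theorem rapidDecay (h : IsHalfLineSolution n J u) (hJ : IsOpen J) {t : ℝ} (ht : t ∈ J) :
    RapidDecay (𝓝 t) fun s x => u x s :=
  ⟨Filter.eventually_of_mem (hJ.mem_nhds ht) fun _ hs => h.contDiff_space hJ hs, fun m N => h.decay m N t ht⟩

theorem schwartz (h : IsHalfLineSolution n J u) (hJ : IsOpen J) {t : ℝ} (ht : t ∈ J) :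
    HalfLineSchwartz fun x => u x t :=
  rapidDecay_pure.1 ((h.rapidDecay hJ ht).mono (pure_le_nhds t))

end IsHalfLineSolution

theorem hasDerivAt_iff_eq {f : ℝ → ℂ} {d e : ℂ} {t : ℝ} (h : HasDerivAt f d t) :
    HasDerivAt f e t ↔ d = e :=
  ⟨fun h' => h.unique h', fun h' => h' ▸ h⟩

/-- The positive powers of λ produce the conditions without time derivative and the constant term
produces the last one. By `BoundaryPair.eq_zero_iff` only the (1,0) entries of the positive powers
have to be examined. -/
theorem evenBoundaryEq_iff {k : ℕ} {β : ℝ} {J : Set ℝ} {u : ℝ → ℝ → ℂ}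
    (hJ : IsOpen J) (hu : IsHalfLineSolution (2 * k) J u) {t : ℝ} (ht : t ∈ J)
    (hD : u 0 t ∈ evenDisc β) : EvenBC k β u t ↔ EvenBoundaryEq k β u t := by
  set f : ℝ → ℂ := fun y => u y t with hf
  have hs : HalfLineSchwartz f := hu.schwartz hJ ht
  have hz := hu.hasDerivAt_time hJ ht le_rfl
  set z' := Complex.I * (coef f (2 * k + 1)).c 0
  have hz' : deriv (fun s => u 0 s) t = z' := hz.deriv
  have hΩ := omega1_hasDerivAt hz hD
  obtain ⟨-, hΩ0⟩ := omega1_sq hD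
  set M : ℝ → Mat2 := fun s => !![-Complex.I * Omega1 β (u 0 s), 2 * Complex.I * conj (u 0 s);
       2 * Complex.I * u 0 s, Complex.I * Omega1 β (u 0 s)] with hM
  set Q := coefMat f 0 with hQ
  set P : ℕ → Mat2 := fun j => (-1 : ℂ) ^ j • coefMat f 0 j with hP
  have hb : ∀ j, (coef f j).b 0 = -conj ((coef f j).c 0) := fun j => (coef_conj hs j).1 0
  have ha : ∀ j, conj ((coef f j).a 0) = -(coef f j).a 0 := fun j => (coef_conj hs j).2 0
  have hpair : BoundaryPair Q P := boundaryPair_coef hs hs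
  have h1 : EvenBoundaryEq k β u t ↔ (∀ m ≤ 2 * k, boundaryCoeff Q P 1 (M t) m = 0) ∧
      ∀ i j : Fin 2, HasDerivAt (fun s => M s i j) ((Q (2 * k) * M t - M t * P (2 * k)) i j) t := by
    rw [← boundaryEq_iff]
    simp only [EvenBoundaryEq, laxV_neg, pow_mul, neg_one_sq, one_pow, one_smul]
    rfl
  -- The factor 1 + (−1)^m makes half of the equations empty, which is why (E) only involves m = 2l.
  have h10 : ∀ m, boundaryCoeff Q P 1 (M t) (m + 1) 1 0 = (1 + (-1) ^ m) *
      ((coef f (m + 1)).c 0 - 2 * Complex.I * u 0 t * (coef f m).a 0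
        - Complex.I * Omega1 β (u 0 t) * (coef f m).c 0) := fun m => by
    simp [boundaryCoeff, hQ, hP, coefMat, hM, pow_succ]
    ring
  have h01 : ∀ m, boundaryCoeff Q P 1 (M t) (m + 1) 0 1 =
      -conj (boundaryCoeff Q P 1 (M t) (m + 1) 1 0) := fun m => by
    rw [h10]
    simp [boundaryCoeff, hQ, hP, coefMat, hM, pow_succ, map_ofNat, hb, ha]
    ring
  have h00 : boundaryCoeff Q P 1 (M t) 0 = 0 := by simp [boundaryCoeff, hQ, hP]
  have hsym : ∀ m, boundaryCoeff Q P 1 (M t) m 1 0 = 0 → boundaryCoeff Q P 1 (M t) m 0 1 = 0 := by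
    intro m hm
    cases m with
    | zero => rw [h00]; rfl
    | succ m => rw [h01, hm, map_zero, neg_zero]
  rw [h1, hpair.eq_zero_iff 1 (M t) (2 * k) hsym]
  refine and_congr ?_ ?_
  · constructor
    · intro h m hm
      cases m with
      | zero => rw [h00]; rfl
      | succ m =>
        rw [h10]
        rcases Nat.even_or_odd' m with ⟨l, rfl | rfl⟩
        · rcases Nat.eq_zero_or_pos l with rfl | hl
          · have : Complex.I * (Complex.I / 2) = -1 / 2 := by
              linear_combination (1 / 2) * Complex.I_sq
            simp [coef]
            change -u 0 t - 2 * Complex.I * u 0 t * (Complex.I / 2) = 0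
            linear_combination (-2 * u 0 t) * this
          · rw [h l hl (by omega), mul_zero]
        · simp [pow_succ, pow_mul]
    · intro h l hl hlk
      have := h (2 * l + 1) (by omega)
      rw [h10] at this
      simpa [pow_mul] using this
  · have hMz : ∀ i j, HasDerivAt (fun s => M s i j)
        ((!![-Complex.I * (-(2 / Omega1 β (u 0 t)) * (conj (u 0 t) * z' + u 0 t * conj z')),
          2 * Complex.I * conj z'; 2 * Complex.I * z',
          Complex.I * (-(2 / Omega1 β (u 0 t)) * (conj (u 0 t) * z' + u 0 t * conj z'))] : Mat2) i j)
        t := by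
      intro i j
      fin_cases i <;> fin_cases j
      · exact hΩ.const_mul _
      · exact hz.star.const_mul _
      · exact hz.const_mul _
      · exact hΩ.const_mul _
    have hz'' := ha (2 * k)
    have hb' := hb (2 * k)
    simp only [hasDerivAt_iff_eq (hMz _ _), Fin.forall_fin_two]
    have hc : (z' + 2 * u 0 t * (coef f (2 * k)).a 0 + Omega1 β (u 0 t) * (coef f (2 * k)).c 0 = 0) ↔
        z' = -(2 * u 0 t * (coef f (2 * k)).a 0 + Omega1 β (u 0 t) * (coef f (2 * k)).c 0) := by
      rw [add_assoc, add_eq_zero_iff_eq_neg]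
    rw [hz', hc]
    have hPn : P (2 * k) = Q (2 * k) := by simp [hP, hQ, pow_mul]
    rw [hPn]
    constructor
    · intro h
      have hcz : conj z' = -(2 * conj (u 0 t) * -(coef f (2 * k)).a 0
          - Omega1 β (u 0 t) * (coef f (2 * k)).b 0) := by
        rw [h, hb']; simp [map_ofNat, hz'']
      rw [hcz, h]
      simp only [hQ, coefMat, hM, Matrix.sub_apply, Matrix.mul_apply, Fin.sum_univ_two,
        Matrix.of_apply, Matrix.cons_val_zero, Matrix.cons_val_one, Matrix.cons_val',
        Matrix.cons_val_fin_one]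
      -- The diagonal entries express the evolution of Ω₁. With P_{2k} = Q_{2k} the right-hand side
      -- is a commutator, in whose diagonal a_{2k} does not occur, and differentiating the root
      -- gives the same value.
      refine ⟨⟨?_, ?_⟩, ?_, ?_⟩ <;> field_simp <;> ring
    · rintro ⟨-, h, -⟩
      simp only [hQ, coefMat, hM, Matrix.sub_apply, Matrix.mul_apply, Fin.sum_univ_two,
        Matrix.of_apply, Matrix.cons_val_zero, Matrix.cons_val_one, Matrix.cons_val',
        Matrix.cons_val_fin_one] at h
      have h2 : Complex.I * z' = Complex.I *
          (-(2 * u 0 t * (coef f (2 * k)).a 0 + Omega1 β (u 0 t) * (coef f (2 * k)).c 0)) := by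
        linear_combination h / 2
      exact mul_left_cancel₀ Complex.I_ne_zero h2

/-- The scheme is that of even order with two independent sets of coefficients, those of u and of û.
No parity cancellation occurs, so every order j contributes, and the evolution of Ω₂ now needs
information from one order beyond the boundary conditions. -/
theorem oddBoundaryEq_iff {k : ℕ} {β ε : ℝ} (hε : ε = 1 ∨ ε = -1) {J : Set ℝ} {u : ℝ → ℝ → ℂ}
    (hJ : IsOpen J) (hJs : ∀ t ∈ J, -t ∈ J) (hu : IsHalfLineSolution (2 * k + 1) J u) {t : ℝ}
    (ht : t ∈ J) (hD : ε * u 0 (-t) - u 0 t ∈ oddDisc β) :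
    OddBC k β ε u t ↔ OddBoundaryEq k β ε u t := by
  set f : ℝ → ℂ := fun y => u y t with hf
  set g : ℝ → ℂ := fun y => u y (-t) with hg
  have hεε : (ε : ℂ) * ε = 1 := by rcases hε with rfl | rfl <;> norm_num
  have hs : HalfLineSchwartz f := hu.schwartz hJ ht
  have hsg : HalfLineSchwartz g := hu.schwartz hJ (hJs t ht)
  have hz := hu.hasDerivAt_time hJ ht le_rfl
  have hzh : HasDerivAt (fun s => u 0 (-s)) (-(Complex.I * (coef g (2 * k + 1 + 1)).c 0)) t := by
    have := (hu.hasDerivAt_time hJ (hJs t ht) le_rfl).scomp t (hasDerivAt_neg t)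
    simpa [Function.comp_def] using this
  rw [OddBC, hz.deriv, hzh.deriv]
  set w : ℝ → ℂ := fun s => ε * u 0 (-s) - u 0 s with hw
  have hw' := (hzh.const_mul (ε : ℂ)).sub hz
  set w' := (ε : ℂ) * -(Complex.I * (coef g (2 * k + 1 + 1)).c 0)
    - Complex.I * (coef f (2 * k + 1 + 1)).c 0 with hw'_def
  change HasDerivAt w w' t at hw'
  have hΩ := omega2_hasDerivAt hw' hD
  obtain ⟨-, hΩ0⟩ := omega2_sq hD
  have hΩe : Omega2 β (u 0 t - ε * u 0 (-t)) = Omega2 β (w t) := by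
    unfold Omega2; rw [norm_sub_rev]
  change Omega2 β (w t) ≠ (0 : ℂ) at hΩ0
  rw [hΩe]
  have hwt : ε * u 0 (-t) - u 0 t = w t := rfl
  set N : Mat2 := !![-(ε : ℂ), 0; 0, 1] with hN
  set M : ℝ → Mat2 := fun s => !![Complex.I * ε * Omega2 β (w s), -Complex.I * conj (w s);
       Complex.I * ε * w s, Complex.I * Omega2 β (w s)] with hM
  set Q := coefMat f 0 with hQ
  set P : ℕ → Mat2 := fun j => (-1 : ℂ) ^ j • coefMat g 0 j with hP
  have hb : ∀ j, (coef f j).b 0 = -conj ((coef f j).c 0) := fun j => (coef_conj hs j).1 0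
  have ha : ∀ j, conj ((coef f j).a 0) = -(coef f j).a 0 := fun j => (coef_conj hs j).2 0
  have hbg : ∀ j, (coef g j).b 0 = -conj ((coef g j).c 0) := fun j => (coef_conj hsg j).1 0
  have hag : ∀ j, conj ((coef g j).a 0) = -(coef g j).a 0 := fun j => (coef_conj hsg j).2 0
  have hpair : BoundaryPair Q P := boundaryPair_coef hs hsg
  have h1 : OddBoundaryEq k β ε u t ↔ (∀ m ≤ 2 * k + 1, boundaryCoeff Q P N (M t) m = 0) ∧
      ∀ i j : Fin 2, HasDerivAt (fun s => M s i j)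
        ((Q (2 * k + 1) * M t - M t * P (2 * k + 1)) i j) t := by
    rw [← boundaryEq_iff]
    simp only [OddBoundaryEq, laxV_neg, oddK_eq_oddKw β ε hε]
    have : (-1 : ℂ) ^ (2 * k + 1) = -1 := by simp [pow_succ, pow_mul]
    simp only [this, neg_smul, one_smul, Matrix.mul_neg, ← sub_eq_add_neg]
    rfl
  have h10 : ∀ m, ε * boundaryCoeff Q P N (M t) (m + 1) 1 0 =
      (-1) ^ (m + 2) * ε * (coef g (m + 1)).c 0 - (coef f (m + 1)).c 0
      - Complex.I * w t * ((-1) ^ m * (coef g m).a 0 + (coef f m).a 0)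
      + Complex.I * Omega2 β (w t) * ((-1) ^ (m + 1) * ε * (coef g m).c 0 + (coef f m).c 0) :=
    fun m => by
      simp [boundaryCoeff, hQ, hP, hN, coefMat, hM, pow_succ]
      linear_combination (-(coef f (m + 1)).c 0 + Complex.I * Omega2 β (w t) * (coef f m).c 0
        - Complex.I * w t * ((-1) ^ m * (coef g m).a 0 + (coef f m).a 0)) * hεε
  have h01 : ∀ m, boundaryCoeff Q P N (M t) (m + 1) 0 1 =
      conj (ε * boundaryCoeff Q P N (M t) (m + 1) 1 0) := fun m => by
    rw [h10]
    simp [boundaryCoeff, hQ, hP, hN, coefMat, hM, pow_succ, hb, ha, hbg, hag]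
    ring
  have h00 : boundaryCoeff Q P N (M t) 0 = 0 := by
    ext i j
    fin_cases i <;> fin_cases j <;>
      simp [boundaryCoeff, hQ, hP, hN, coefMat, coef]
    ring
  have hε0 : (ε : ℂ) ≠ 0 := fun h => by simp [h] at hεε
  have hsym : ∀ m, boundaryCoeff Q P N (M t) m 1 0 = 0 → boundaryCoeff Q P N (M t) m 0 1 = 0 := by
    intro m hm
    cases m with
    | zero => rw [h00]; rfl
    | succ m => rw [h01, hm, mul_zero, map_zero]
  rw [h1]
  have hfirst : (∀ m ≤ 2 * k + 1, boundaryCoeff Q P N (M t) m = 0) ↔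
      ∀ j : ℕ, 2 ≤ j → j ≤ 2 * k + 1 →
    (-1) ^ (j + 1) * ε * (coef g j).c 0 - (coef f j).c 0
      - Complex.I * w t * ((-1) ^ (j - 1) * (coef g (j - 1)).a 0 + (coef f (j - 1)).a 0)
      + Complex.I * Omega2 β (w t) * ((-1) ^ j * ε * (coef g (j - 1)).c 0 + (coef f (j - 1)).c 0)
      = 0 := by
    rw [hpair.eq_zero_iff N (M t) (2 * k + 1) hsym]
    constructor
    · intro h j hj hjk
      obtain ⟨m, rfl⟩ := Nat.exists_eq_add_of_le' (show 1 ≤ j by omega)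
      have := h10 m
      rw [h (m + 1) hjk, mul_zero] at this
      exact this.symm
    · intro h m hm
      rcases m with _ | _ | m
      · rw [h00]; rfl
      -- The order j = 1 is automatic: c₁ and ĉ₁ cancel against the terms with a₀ = â₀ = i/2.
      · have := h10 0
        refine (mul_eq_zero.1 (this.trans ?_)).resolve_left hε0
        simp [coef, hw, hf, hg]
        linear_combination (-(ε * u 0 (-t) - u 0 t)) * Complex.I_sq
      · have := h10 (m + 1)
        refine (mul_eq_zero.1 (this.trans ?_)).resolve_left hε0
        exact h (m + 2) (by omega) hm
  refine (and_congr_left' hfirst.symm).trans (and_congr_right fun hD0 => ?_)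
  have hMz : ∀ i j, HasDerivAt (fun s => M s i j)
      ((!![Complex.I * ε * (-(1 / (2 * Omega2 β (w t))) * (conj (w t) * w' + w t * conj w')),
        -Complex.I * conj w'; Complex.I * ε * w',
        Complex.I * (-(1 / (2 * Omega2 β (w t))) * (conj (w t) * w' + w t * conj w'))] : Mat2) i j)
      t := by
    intro i j
    fin_cases i <;> fin_cases j
    · exact hΩ.const_mul _
    · exact hw'.star.const_mul _
    · exact hw'.const_mul _
    · exact hΩ.const_mul _
  simp only [hasDerivAt_iff_eq (hMz _ _), Fin.forall_fin_two]
  -- All coefficients up to order 2k + 1 vanish, so the diagonal of the next one vanishes too. It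
  -- contains the unwanted difference a_{2k+2} − â_{2k+2} in both entries; eliminating it between
  -- them yields the diagonal part of the evolution of K.
  obtain ⟨d0, d1⟩ := hpair.diag_eq_zero N (M t) (m := 2 * k + 2) fun j hj => hD0 j (by omega)
  have hodd : (-1 : ℂ) ^ (2 * k + 1) = -1 := by simp [pow_succ, pow_mul]
  have heven : (-1 : ℂ) ^ (2 * k + 1 + 1) = 1 := by simp [pow_succ, pow_mul]
  simp only [boundaryCoeff, hQ, hP, hN, coefMat, hM, Matrix.sub_apply, Matrix.add_apply,
    Matrix.smul_apply, smul_eq_mul, Matrix.mul_apply, Fin.sum_univ_two,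
    Matrix.of_apply, Matrix.cons_val_zero, Matrix.cons_val_one, Matrix.cons_val',
    Matrix.cons_val_fin_one, hodd, heven] at d0 d1 ⊢
  set a := (coef f (2 * k + 1)).a 0
  set a' := (coef g (2 * k + 1)).a 0
  set c := (coef f (2 * k + 1)).c 0
  set c' := (coef g (2 * k + 1)).c 0
  set b := (coef f (2 * k + 1)).b 0 with hb_def
  set b' := (coef g (2 * k + 1)).b 0 with hb'_def
  have key : w' + w t * (a - a') - Omega2 β (w t) * (c + ε * c') = 0 ↔
      w' = Omega2 β (w t) * (c + ε * c') - w t * (a - a') := by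
    constructor <;> intro h <;> linear_combination h
  refine key.trans ⟨fun h => ?_, ?_⟩
  · have hcz : conj w' = -Omega2 β (w t) * (b + ε * b') + conj (w t) * (a - a') := by
      rw [h, hb_def, hb'_def, hb, hbg]
      simp only [map_sub, map_mul, map_add, Complex.conj_ofReal, a, a', ha, hag, c, c']
      ring
    have hS : -(1 / (2 * (Omega2 β (w t) : ℂ))) * (conj (w t) * w' + w t * conj w') =
        -(conj (w t) * (c + ε * c') - w t * (b + ε * b')) / 2 := by
      rw [hcz, h]
      field_simp
      ring
    rw [hS, hcz, h]
    clear_value w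
    refine ⟨⟨?_, ?_⟩, ?_, ?_⟩
    · linear_combination (-1 / 2) * d0 + ε / 2 * d1
        - (Complex.I * conj (w t) * c' / 2) * hεε
    · ring
    · linear_combination (Complex.I * Omega2 β (w t) * c') * hεε
    · linear_combination ε / 2 * d0 - (1 / 2) * d1 + (((coef f (2 * k + 1 + 1)).a 0
        - (coef g (2 * k + 1 + 1)).a 0) - Complex.I * w t * b
        - Complex.I * Omega2 β (w t) * (a + a')) / 2 * hεε
  · rintro ⟨-, h, -⟩
    have : Complex.I * ε * (w' - (Omega2 β (w t) * (c + ε * c') - w t * (a - a'))) = 0 := by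
      linear_combination h - (Complex.I * Omega2 β (w t) * c') * hεε
    exact sub_eq_zero.1 ((mul_eq_zero.1 this).resolve_left
      (mul_ne_zero Complex.I_ne_zero hε0))

/-! ### Functionals of the boundary variable -/

theorem halfLineSchwartz_zero : HalfLineSchwartz fun _ => 0 :=
  rapidDecay_pure.1 (RapidDecay.zero (l := pure ()))

theorem halfLineSchwartz_of_compactSupport {φ : ℝ → ℂ} (h : ContDiff ℝ ∞ φ)
    (hc : HasCompactSupport φ) : HalfLineSchwartz φ := by
  refine ⟨h, fun m N => ?_⟩
  have h1 : HasCompactSupport (iteratedDeriv m φ) := by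
    induction m with
    | zero => rwa [iteratedDeriv_zero]
    | succ m ih => rw [iteratedDeriv_succ]; exact ih.deriv
  have h2 : Continuous (iteratedDeriv m φ) := h.continuous_iteratedDeriv m (mod_cast le_top)
  have h3 : HasCompactSupport fun x : ℝ => (x : ℂ) ^ N * iteratedDeriv m φ x := h1.mul_left
  have h4 : Continuous fun x : ℝ => (x : ℂ) ^ N * iteratedDeriv m φ x := by fun_prop
  obtain ⟨C, hC⟩ := h4.bounded_above_of_compact_support h3
  refine ⟨C, fun x hx => ?_⟩
  have := hC x
  rwa [norm_mul, norm_pow, Complex.norm_real, Real.norm_of_nonneg hx] at this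

theorem hasGradient_boundary {m : ℕ} {f : ℂ → ℂ} {s : PhasePoint m} {fz fzb : ℂ}
    (h : ∀ w : ℂ, HasDerivAt (fun r : ℝ => f (s.2 + r * w)) (fz * w + fzb * conj w) 0) :
    HasGradient (fun p : PhasePoint m => f p.2) s ⟨fun _ _ => 0, fun _ _ => 0, fz, fzb⟩ := by
  refine ⟨fun i => MemLp.zero, fun i => MemLp.zero, fun v w _ => ?_⟩
  simpa using h w

/-- Testing with φ and with iφ, φ real, gives ∫ φ(g + h) = 0 and ∫ φ(g − h) = 0. This separates g
from h and reduces the claim to the fundamental lemma of the calculus of variations. -/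
theorem ae_zero_of_test {g h : ℝ → ℂ} (hg : MemLp g 2 (volume.restrict (Ioi 0)))
    (hh : MemLp h 2 (volume.restrict (Ioi 0)))
    (H : ∀ v : ℝ → ℂ, HalfLineSchwartz v → ∫ x in Ioi (0 : ℝ), (g x * v x + h x * conj (v x)) = 0) :
    g =ᵐ[volume.restrict (Ioi 0)] 0 ∧ h =ᵐ[volume.restrict (Ioi 0)] 0 := by
  have key : ∀ φ : ℝ → ℝ, ContDiff ℝ ∞ φ → HasCompactSupport φ →
      ∫ x in Ioi (0 : ℝ), φ x • g x = 0 ∧ ∫ x in Ioi (0 : ℝ), φ x • h x = 0 := by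
    intro φ hφ hc
    have hc' : HasCompactSupport fun x => (φ x : ℂ) := hc.comp_left (g := Complex.ofReal) rfl
    have hφ' : ContDiff ℝ ∞ fun x => (φ x : ℂ) := Complex.ofRealCLM.contDiff.comp hφ
    have h1 : HalfLineSchwartz fun x => (φ x : ℂ) := halfLineSchwartz_of_compactSupport hφ' hc'
    have hL : MemLp φ 2 (volume.restrict (Ioi 0)) :=
      (hφ.continuous.memLp_of_hasCompactSupport hc).restrict _
    have ig : IntegrableOn (fun x => φ x • g x) (Ioi 0) := memLp_one_iff_integrable.1 (hg.smul hL)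
    have ih : IntegrableOn (fun x => φ x • h x) (Ioi 0) := memLp_one_iff_integrable.1 (hh.smul hL)
    have e1 := H _ h1
    have e2 := H _ (h1.const_mul Complex.I)
    have f1 : ∀ x, g x * (φ x : ℂ) + h x * conj (φ x : ℂ) = φ x • g x + φ x • h x := fun x => by
      rw [Complex.conj_ofReal, Complex.real_smul, Complex.real_smul]; ring
    have f2 : ∀ x, g x * (Complex.I * (φ x : ℂ)) + h x * conj (Complex.I * (φ x : ℂ)) =
        Complex.I * (φ x • g x - φ x • h x) := fun x => by
      rw [map_mul, Complex.conj_I, Complex.conj_ofReal, Complex.real_smul, Complex.real_smul]; ring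
    simp only [f1] at e1
    simp only [f2] at e2
    rw [integral_add ig ih] at e1
    rw [integral_const_mul, integral_sub ig ih] at e2
    have e3 := (mul_eq_zero.1 e2).resolve_left Complex.I_ne_zero
    constructor
    · linear_combination (e1 + e3) / 2
    · linear_combination (e1 - e3) / 2
  have hloc : ∀ {k : ℝ → ℂ}, MemLp k 2 (volume.restrict (Ioi 0)) →
      LocallyIntegrableOn k (Ioi 0) (volume.restrict (Ioi 0)) := fun hk =>
    (hk.locallyIntegrable (by norm_num)).locallyIntegrableOn _
  have hmem : ∀ᵐ x ∂(volume.restrict (Ioi (0 : ℝ))), x ∈ Ioi (0 : ℝ) :=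
    ae_restrict_mem measurableSet_Ioi
  constructor
  · filter_upwards [isOpen_Ioi.ae_eq_zero_of_integral_contDiff_smul_eq_zero (hloc hg)
      fun φ h1 h2 _ => (key φ h1 h2).1, hmem] with x hx hx0 using hx hx0
  · filter_upwards [isOpen_Ioi.ae_eq_zero_of_integral_contDiff_smul_eq_zero (hloc hh)
      fun φ h1 h2 _ => (key φ h1 h2).2, hmem] with x hx hx0 using hx hx0

/-- Brackets are asserted through the existence of gradients. Uniqueness makes them single-valued on
functions of z, without which the algebra could not determine θ. -/
theorem hasGradient_boundary_unique {m : ℕ} {f : ℂ → ℂ} {s : PhasePoint m} {fz fzb : ℂ}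
    (h : ∀ w : ℂ, HasDerivAt (fun r : ℝ => f (s.2 + r * w)) (fz * w + fzb * conj w) 0)
    {g : Gradient m} (hg : HasGradient (fun p : PhasePoint m => f p.2) s g) :
    (∀ i, g.du i =ᵐ[volume.restrict (Ioi 0)] 0) ∧ (∀ i, g.dub i =ᵐ[volume.restrict (Ioi 0)] 0) ∧
      g.dz = fz ∧ g.dzb = fzb := by
  obtain ⟨h1, h2, h3⟩ := hg
  have hz : ∀ i, g.du i =ᵐ[volume.restrict (Ioi 0)] 0 ∧ g.dub i =ᵐ[volume.restrict (Ioi 0)] 0 := by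
    intro i
    refine ae_zero_of_test (h1 i) (h2 i) fun v hv => ?_
    have e := h3 (fun j => if j = i then v else fun _ => 0) 0 (fun j => by
      split_ifs
      exacts [hv, halfLineSchwartz_zero])
    have e0 : HasDerivAt (fun _ : ℝ => f (s.2 + 0)) 0 0 := hasDerivAt_const _ _
    simp only [mul_zero] at e
    have := e.unique e0
    rw [map_zero, mul_zero, add_zero, add_zero, Finset.sum_eq_single i] at this
    · simpa using this
    · intro j _ hj
      simp [hj]
    · simp
  refine ⟨fun i => (hz i).1, fun i => (hz i).2, ?_⟩
  have hw : ∀ w : ℂ, g.dz * w + g.dzb * conj w = fz * w + fzb * conj w := fun w => by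
    have e := h3 (fun _ _ => 0) w (fun _ => halfLineSchwartz_zero)
    have := e.unique (h w)
    simpa using this
  have w1 := hw 1
  have w2 := hw Complex.I
  simp only [map_one, mul_one, Complex.conj_I] at w1 w2
  have w3 : g.dz - g.dzb = fz - fzb := mul_left_cancel₀ Complex.I_ne_zero (by linear_combination w2)
  constructor
  · linear_combination (w1 + w3) / 2
  · linear_combination (w1 - w3) / 2

theorem hasBracket_boundary_iff {m : ℕ} {f g : ℂ → ℂ} {s : PhasePoint m} {fz fzb gz gzb : ℂ}
    (hf : ∀ w : ℂ, HasDerivAt (fun r : ℝ => f (s.2 + r * w)) (fz * w + fzb * conj w) 0)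
    (hg : ∀ w : ℂ, HasDerivAt (fun r : ℝ => g (s.2 + r * w)) (gz * w + gzb * conj w) 0)
    (θ : ℂ → ℂ) (c : ℂ) :
    HasBracket θ (fun p : PhasePoint m => f p.2) (fun p => g p.2) s c ↔
      θ s.2 * (fz * gzb - fzb * gz) = c := by
  constructor
  · rintro ⟨G, H, hG, hH, rfl⟩
    obtain ⟨a1, a2, a3, a4⟩ := hasGradient_boundary_unique hf hG
    obtain ⟨b1, b2, b3, b4⟩ := hasGradient_boundary_unique hg hH
    have hi : ∀ i, ∫ x in Ioi (0 : ℝ), (G.du i x * H.dub i x - G.dub i x * H.du i x) = 0 := by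
      intro i
      rw [integral_eq_zero_of_ae]
      filter_upwards [a1 i, a2 i] with x h1 h2
      simp [h1, h2]
    simp only [gradBracket, hi, Finset.sum_const_zero, mul_zero, zero_add, a3, a4, b3, b4]
  · rintro rfl
    exact ⟨_, _, hasGradient_boundary hf, hasGradient_boundary hg, by simp [gradBracket]⟩

theorem exists_phasePoint (m : ℕ) {D : Set ℂ} {z : ℂ} (hz : z ∈ D) :
    ∃ s ∈ phaseSpace m D, s.2 = z :=
  ⟨(fun _ _ => 0, z), ⟨fun _ => halfLineSchwartz_zero, hz⟩, rfl⟩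

theorem hasDerivAt_line (z w : ℂ) : HasDerivAt (fun r : ℝ => z + r * w) w 0 := by
  have := ((Complex.ofRealCLM.hasDerivAt (x := (0 : ℝ))).mul_const w).const_add z
  simpa using this

theorem boundaryBracket_iff {m : ℕ} {D : Set ℂ} {θ F : ℂ → ℂ} :
    BoundaryBracket m D θ F ↔ ∀ z ∈ D, θ z = F z := by
  have key : ∀ s : PhasePoint m, HasBracket θ (fun p : PhasePoint m => p.2) (fun p => conj p.2) s
      (F s.2) ↔ θ s.2 = F s.2 := fun s => by
    rw [hasBracket_boundary_iff (f := fun z => z) (g := fun z => conj z) (fz := 1) (fzb := 0)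
      (gz := 0) (gzb := 1)]
    · simp
    · intro w; simpa using hasDerivAt_line s.2 w
    · intro w; simpa using (hasDerivAt_line s.2 w).star
  constructor
  · intro h z hz
    obtain ⟨s, hs, rfl⟩ := exists_phasePoint m hz
    exact (key s).1 (h s hs)
  · intro h s hs
    exact (key s).2 (h _ hs.2)

/-! ### Derivatives of the boundary matrices -/

/-- `∂K/∂z`, even order. -/
def evenKz (β : ℝ) (z : ℂ) : Mat2 :=
  !![-Complex.I * (-(2 / Omega1 β z) * conj z), 0;
     2 * Complex.I, Complex.I * (-(2 / Omega1 β z) * conj z)]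

/-- `∂K/∂z̄`, even order. -/
def evenKzb (β : ℝ) (z : ℂ) : Mat2 :=
  !![-Complex.I * (-(2 / Omega1 β z) * z), 2 * Complex.I;
     0, Complex.I * (-(2 / Omega1 β z) * z)]

/-- `∂K/∂w`, odd order. -/
def oddKz (β ε : ℝ) (w : ℂ) : Mat2 :=
  !![Complex.I * ε * (-(1 / (2 * Omega2 β w)) * conj w), 0;
     Complex.I * ε, Complex.I * (-(1 / (2 * Omega2 β w)) * conj w)]

/-- `∂K/∂w̄`, odd order. -/
def oddKzb (β ε : ℝ) (w : ℂ) : Mat2 :=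
  !![Complex.I * ε * (-(1 / (2 * Omega2 β w)) * w), -Complex.I;
     0, Complex.I * (-(1 / (2 * Omega2 β w)) * w)]

theorem evenK_hasDerivAt {β : ℝ} {z : ℂ} (hz : z ∈ evenDisc β) (lam : ℂ) (i j : Fin 2) (w : ℂ) :
    HasDerivAt (fun r : ℝ => evenK β (z + r * w) lam i j)
      (evenKz β z i j * w + evenKzb β z i j * conj w) 0 := by
  have hl := hasDerivAt_line z w
  have hΩ := omega1_hasDerivAt hl (by simpa using hz)
  simp only [Complex.ofReal_zero, zero_mul, add_zero] at hΩ
  simp only [evenK, Matrix.add_apply]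
  refine HasDerivAt.const_add _ ?_
  fin_cases i <;> fin_cases j
  · exact (hΩ.const_mul (-Complex.I)).congr_deriv (by simp [evenKz, evenKzb]; ring)
  · exact (hl.star.const_mul (2 * Complex.I)).congr_deriv (by simp [evenKz, evenKzb])
  · exact (hl.const_mul (2 * Complex.I)).congr_deriv (by simp [evenKz, evenKzb])
  · exact (hΩ.const_mul Complex.I).congr_deriv (by simp [evenKz, evenKzb]; ring)

theorem oddKw_hasDerivAt {β ε : ℝ} {z : ℂ} (hz : z ∈ oddDisc β) (lam : ℂ) (i j : Fin 2) (w : ℂ) :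
    HasDerivAt (fun r : ℝ => oddKw β ε (z + r * w) lam i j)
      (oddKz β ε z i j * w + oddKzb β ε z i j * conj w) 0 := by
  have hl := hasDerivAt_line z w
  have hΩ := omega2_hasDerivAt hl (by simpa using hz)
  simp only [Complex.ofReal_zero, zero_mul, add_zero] at hΩ
  simp only [oddKw, Matrix.add_apply]
  refine HasDerivAt.const_add _ ?_
  fin_cases i <;> fin_cases j
  · exact (hΩ.const_mul (Complex.I * ε)).congr_deriv (by simp [oddKz, oddKzb]; ring)
  · exact (hl.star.const_mul (-Complex.I)).congr_deriv (by simp [oddKz, oddKzb])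
  · exact (hl.const_mul (Complex.I * ε)).congr_deriv (by simp [oddKz, oddKzb])
  · exact (hΩ.const_mul Complex.I).congr_deriv (by simp [oddKz, oddKzb]; ring)

/-! ### The Poisson algebras -/

/-- Entries of the permutation matrix. -/
def permMat : Mat4 := Matrix.of fun p q => if p.1 = q.2 ∧ p.2 = q.1 then 1 else 0

theorem permMat_mul (X : Mat4) (a c b d : Fin 2) : (permMat * X) (a, c) (b, d) = X (c, a) (b, d) := by
  rw [Matrix.mul_apply, Finset.sum_eq_single (c, a)]
  · simp [permMat]
  · rintro ⟨p, q⟩ _ h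
    have : ¬(a = q ∧ c = p) := fun ⟨h1, h2⟩ => h (by rw [h1, h2])
    simp [permMat, this]
  · simp

theorem mul_permMat (X : Mat4) (a c b d : Fin 2) : (X * permMat) (a, c) (b, d) = X (a, c) (d, b) := by
  rw [Matrix.mul_apply, Finset.sum_eq_single (d, b)]
  · simp [permMat]
  · rintro ⟨p, q⟩ _ h
    have : ¬(p = d ∧ q = b) := fun ⟨h1, h2⟩ => h (by rw [h1, h2])
    simp [permMat, this]
  · simp

theorem rMat_eq (lam : ℂ) : rMat lam = (1 / lam) • permMat := rfl

theorem commutator_entry (lam : ℂ) (A B : Mat2) (a b c d : Fin 2) :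
    (rMat lam * ((A ⊗ₖ (1 : Mat2)) * ((1 : Mat2) ⊗ₖ B))
      - ((A ⊗ₖ (1 : Mat2)) * ((1 : Mat2) ⊗ₖ B)) * rMat lam) (a, c) (b, d) =
      1 / lam * (A c b * B a d - A a d * B c b) := by
  rw [← Matrix.mul_kronecker_mul, mul_one, one_mul, rMat_eq, Matrix.smul_mul, Matrix.mul_smul,
    ← smul_sub, Matrix.smul_apply, Matrix.sub_apply, permMat_mul, mul_permMat]
  simp

theorem reflection_entry (lam : ℂ) (A B : Mat2) (a b c d : Fin 2) :
    ((A ⊗ₖ (1 : Mat2)) * rMat lam * ((1 : Mat2) ⊗ₖ B)) (a, c) (b, d) =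
      1 / lam * ((A * B) a d * (1 : Mat2) c b) ∧
    (((1 : Mat2) ⊗ₖ B) * rMat lam * (A ⊗ₖ (1 : Mat2))) (a, c) (b, d) =
      1 / lam * ((B * A) c b * (1 : Mat2) a d) := by
  have h1 : (A ⊗ₖ (1 : Mat2)) * permMat = permMat * ((1 : Mat2) ⊗ₖ A) := by
    ext ⟨a, c⟩ ⟨b, d⟩
    rw [mul_permMat, permMat_mul, Matrix.kroneckerMap_apply, Matrix.kroneckerMap_apply, mul_comm]
  have h2 : ((1 : Mat2) ⊗ₖ B) * permMat = permMat * (B ⊗ₖ (1 : Mat2)) := by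
    ext ⟨a, c⟩ ⟨b, d⟩
    rw [mul_permMat, permMat_mul, Matrix.kroneckerMap_apply, Matrix.kroneckerMap_apply, mul_comm]
  constructor
  · rw [rMat_eq, Matrix.mul_smul, h1, Matrix.smul_mul, Matrix.mul_assoc, ← Matrix.mul_kronecker_mul,
      one_mul, Matrix.smul_apply, permMat_mul, Matrix.kroneckerMap_apply, smul_eq_mul, mul_comm
      ((1 : Mat2) c b)]
  · rw [rMat_eq, Matrix.mul_smul, h2, Matrix.smul_mul, Matrix.mul_assoc, ← Matrix.mul_kronecker_mul,
      one_mul, Matrix.smul_apply, permMat_mul, Matrix.kroneckerMap_apply, smul_eq_mul]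

/-- Sixteen rational identities in λ, μ, z, z̄ and Ω₁. The relation between Ω₁² and |z|² enters only
through the derivatives −2z̄/Ω₁ and −2z/Ω₁ contained in `evenKz` and `evenKzb`. -/
theorem even_algebra {β : ℝ} {z : ℂ} (hz : z ∈ evenDisc β) {lam mu : ℂ} (h1 : lam ≠ mu)
    (h2 : lam ≠ -mu) (a b c d : Fin 2) :
    -Complex.I * Omega1 β z *
      (evenKz β z a b * evenKzb β z c d - evenKzb β z a b * evenKz β z c d) =
    1 / (lam - mu) * (evenK β z lam c b * evenK β z mu a d - evenK β z lam a d * evenK β z mu c b)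
      + 1 / (lam + mu) * ((evenK β z lam * evenK β z mu) a d * (1 : Mat2) c b)
      - 1 / (lam + mu) * ((evenK β z mu * evenK β z lam) c b * (1 : Mat2) a d) := by
  have h1' : lam - mu ≠ 0 := sub_ne_zero.2 h1
  have h2' : lam + mu ≠ 0 := fun h => h2 (eq_neg_of_add_eq_zero_left h)
  obtain ⟨-, hΩ⟩ := omega1_sq hz
  have hI := Complex.I_sq
  simp only [evenK, evenKz, evenKzb]
  generalize (Omega1 β z : ℂ) = Ω at *
  fin_cases a <;> fin_cases b <;> fin_cases c <;> fin_cases d <;>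
    simp [Matrix.mul_apply, Fin.sum_univ_two] <;>
    field_simp <;> grind

theorem odd_algebra {β ε : ℝ} (hε : ε = 1 ∨ ε = -1) {z : ℂ} (hz : z ∈ oddDisc β) {lam mu : ℂ}
    (h1 : lam ≠ mu) (a b c d : Fin 2) :
    -2 * Complex.I * Omega2 β z *
      (oddKz β ε z a b * oddKzb β ε z c d - oddKzb β ε z a b * oddKz β ε z c d) =
    1 / (lam - mu) *
      (oddKw β ε z lam c b * oddKw β ε z mu a d - oddKw β ε z lam a d * oddKw β ε z mu c b) := by
  have h1' : lam - mu ≠ 0 := sub_ne_zero.2 h1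
  obtain ⟨-, hΩ⟩ := omega2_sq hz
  have hI := Complex.I_sq
  have hε2 : (ε : ℂ) * ε = 1 := by rcases hε with rfl | rfl <;> norm_num
  simp only [oddKw, oddKz, oddKzb]
  generalize (Omega2 β z : ℂ) = Ω at *
  generalize (ε : ℂ) = e at *
  fin_cases a <;> fin_cases b <;> fin_cases c <;> fin_cases d <;>
    simp <;>
    field_simp <;> grind

theorem reflectionAlgebra_iff {β : ℝ} {θ : ℂ → ℂ} :
    ReflectionAlgebra 1 (evenDisc β) θ (evenK β) ↔
      ∀ z ∈ evenDisc β, θ z = -Complex.I * Omega1 β z := by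
  have key : ∀ s : PhasePoint 1, s.2 ∈ evenDisc β → ∀ lam mu : ℂ, ∀ a b c d : Fin 2, ∀ X : ℂ,
      HasBracket θ (fun p : PhasePoint 1 => evenK β p.2 lam a b) (fun p => evenK β p.2 mu c d) s X ↔
        θ s.2 * (evenKz β s.2 a b * evenKzb β s.2 c d - evenKzb β s.2 a b * evenKz β s.2 c d) = X :=
    fun s hs lam mu a b c d X => hasBracket_boundary_iff (f := fun z => evenK β z lam a b)
      (g := fun z => evenK β z mu c d) (evenK_hasDerivAt hs lam a b) (evenK_hasDerivAt hs mu c d) θ X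
  have entry : ∀ z ∈ evenDisc β, ∀ lam mu : ℂ, lam ≠ mu → lam ≠ -mu → ∀ a b c d : Fin 2,
      (rMat (lam - mu) * ((evenK β z lam ⊗ₖ (1 : Mat2)) * ((1 : Mat2) ⊗ₖ evenK β z mu))
        - ((evenK β z lam ⊗ₖ (1 : Mat2)) * ((1 : Mat2) ⊗ₖ evenK β z mu)) * rMat (lam - mu)
         + (evenK β z lam ⊗ₖ (1 : Mat2)) * rMat (lam + mu) * ((1 : Mat2) ⊗ₖ evenK β z mu)
         - ((1 : Mat2) ⊗ₖ evenK β z mu) * rMat (lam + mu) * (evenK β z lam ⊗ₖ (1 : Mat2)))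
          (a, c) (b, d) =
      -Complex.I * Omega1 β z *
        (evenKz β z a b * evenKzb β z c d - evenKzb β z a b * evenKz β z c d) := by
    intro z hz lam mu h1 h2 a b c d
    rw [even_algebra hz h1 h2, Matrix.sub_apply, Matrix.add_apply, commutator_entry,
      (reflection_entry _ _ _ a b c d).1, (reflection_entry _ _ _ a b c d).2]
  constructor
  · intro h z hz
    obtain ⟨s, hs, rfl⟩ := exists_phasePoint 1 hz
    -- The entries 2iz and 2iz̄ of K have the bracket −4θ, so this single relation, at λ = 1 and μ =
    -- 0, already fixes θ.
    have := (key s hz 1 0 1 0 0 1 _).1 (h s hs 1 0 (by norm_num) (by norm_num) 1 0 0 1)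
    rw [entry s.2 hz 1 0 (by norm_num) (by norm_num)] at this
    refine mul_right_cancel₀ ?_ this
    simp [evenKz, evenKzb]
  · intro h s hs lam mu h1 h2 a b c d
    refine (key s hs.2 lam mu a b c d _).2 ?_
    rw [h s.2 hs.2]
    exact (entry s.2 hs.2 lam mu h1 h2 a b c d).symm

theorem commutatorAlgebra_iff {β ε : ℝ} (hε : ε = 1 ∨ ε = -1) {θ : ℂ → ℂ} :
    CommutatorAlgebra 2 (oddDisc β) θ (oddKw β ε) ↔
      ∀ z ∈ oddDisc β, θ z = -2 * Complex.I * Omega2 β z := by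
  have key : ∀ s : PhasePoint 2, s.2 ∈ oddDisc β → ∀ lam mu : ℂ, ∀ a b c d : Fin 2, ∀ X : ℂ,
      HasBracket θ (fun p : PhasePoint 2 => oddKw β ε p.2 lam a b) (fun p => oddKw β ε p.2 mu c d)
        s X ↔
        θ s.2 * (oddKz β ε s.2 a b * oddKzb β ε s.2 c d - oddKzb β ε s.2 a b * oddKz β ε s.2 c d)
          = X :=
    fun s hs lam mu a b c d X => hasBracket_boundary_iff (f := fun z => oddKw β ε z lam a b)
      (g := fun z => oddKw β ε z mu c d) (oddKw_hasDerivAt hs lam a b) (oddKw_hasDerivAt hs mu c d)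
      θ X
  have entry : ∀ z ∈ oddDisc β, ∀ lam mu : ℂ, lam ≠ mu → ∀ a b c d : Fin 2,
      (rMat (lam - mu) * ((oddKw β ε z lam ⊗ₖ (1 : Mat2)) * ((1 : Mat2) ⊗ₖ oddKw β ε z mu))
        - ((oddKw β ε z lam ⊗ₖ (1 : Mat2)) * ((1 : Mat2) ⊗ₖ oddKw β ε z mu)) * rMat (lam - mu))
          (a, c) (b, d) =
      -2 * Complex.I * Omega2 β z *
        (oddKz β ε z a b * oddKzb β ε z c d - oddKzb β ε z a b * oddKz β ε z c d) := by
    intro z hz lam mu h1 a b c d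
    rw [odd_algebra hε hz h1, commutator_entry]
  have hε0 : (ε : ℂ) ≠ 0 := by rcases hε with rfl | rfl <;> norm_num
  constructor
  · intro h z hz
    obtain ⟨s, hs, rfl⟩ := exists_phasePoint 2 hz
    -- The off-diagonal entries iεw and −iw̄ have the bracket εθ, and ε ≠ 0.
    have := (key s hz 1 0 1 0 0 1 _).1 (h s hs 1 0 (by norm_num) 1 0 0 1)
    rw [entry s.2 hz 1 0 (by norm_num)] at this
    refine mul_right_cancel₀ ?_ this
    simp [oddKz, oddKzb, hε0]
  · intro h s hs lam mu h1 a b c d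
    refine (key s hs.2 lam mu a b c d _).2 ?_
    rw [h s.2 hs.2]
    exact (entry s.2 hs.2 lam mu h1 a b c d).symm

/-! ### The monodromy matrix of the half-line -/

theorem transition_det {u : ℝ → ℂ} (hu : Continuous u) (lam : ℂ) (x : ℝ) :
    (transition u lam x).det = 1 := by
  have hd : ∀ x, HasDerivAt (fun x => (transition u lam x).det) 0 x := fun x => by
    have h := transition_hasDerivAt hu lam x
    simp only [Matrix.det_fin_two]
    refine (((h 0 0).mul (h 1 1)).sub ((h 0 1).mul (h 1 0))).congr_deriv ?_
    simp [Matrix.mul_apply, laxU, Fin.sum_univ_two]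
    ring
  rw [is_const_of_deriv_eq_zero (fun x => (hd x).differentiableAt) (fun x => (hd x).deriv) x 0,
    transition_zero, Matrix.det_one]

/-- For real λ the inverse is the conjugate transpose, and by determinant 1 it is also the adjugate:
T lies in SU(2). The convergence of the second row thus carries over to the first. -/
theorem transition_real {u : ℝ → ℂ} (hu : Continuous u) {lam : ℂ} (hl : lam.im = 0) (x : ℝ) :
    transition u lam x 0 0 = conj (transition u lam x 1 1) ∧
      transition u lam x 0 1 = -conj (transition u lam x 1 0) := by
  have hc : conj lam = lam := Complex.conj_eq_iff_im.2 hl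
  have h := transition_inv hu lam x
  rw [Matrix.inv_def, transition_det hu, Ring.inverse_one, one_smul, Matrix.adjugate_fin_two] at h
  have h00 := congrFun (congrFun h 0) 0
  have h01 := congrFun (congrFun h 0) 1
  simp only [transitionInv, Matrix.transpose_apply] at h00 h01
  have hT := fun i j => transition_cbar u lam x i j
  rw [hc] at hT
  rw [hT] at h00 h01
  simp at h00 h01
  constructor
  · rw [h00, Complex.conj_conj]
  · rw [← h01, neg_neg]

theorem jost_cbar {u : ℝ → ℂ} (hu : Continuous u) (hi : IntegrableOn u (Ioi 0)) {lam : ℂ}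
    (hl : lam.im ≤ 0) (j : Fin 2) : jost (cbar u) lam j = conj (jost u (-conj lam) j) := by
  have hl' : (-conj lam).im ≤ 0 := by simpa using hl
  have h := (Complex.continuous_conj.tendsto _).comp (tendsto_jost hu hi hl' j)
  refine Tendsto.limUnder_eq (h.congr fun L => ?_)
  have e1 := transition_cbar u (-conj lam) L 1 j
  have e2 := weight_conj (-conj lam) L
  simp only [map_neg, Complex.conj_conj, neg_neg] at e1 e2
  simp only [Function.comp, wT, Matrix.smul_apply, smul_eq_mul, map_mul, e1, e2]

/-- The limit of the normalized transition matrix for real `λ`. -/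
def jostMat (u : ℝ → ℂ) (lam : ℂ) : Mat2 :=
  !![conj (jost u lam 1), -conj (jost u lam 0); jost u lam 0, jost u lam 1]

theorem tendsto_transitionNormalized {u : ℝ → ℂ} (hu : Continuous u) (hi : IntegrableOn u (Ioi 0))
    (lam : ℝ) (i j : Fin 2) :
    Tendsto (fun L : ℝ => transitionNormalized u lam L i j) atTop (𝓝 (jostMat u lam i j)) := by
  have hl : (lam : ℂ).im = 0 := Complex.ofReal_im lam
  have h := fun j => tendsto_jost hu hi hl.le j
  have hw : ∀ L : ℝ, Complex.exp (Complex.I * lam * L / 2) = conj (weight lam L) := fun L => by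
    rw [weight, ← Complex.exp_conj]
    congr 1
    simp [map_ofNat]
    ring
  have hc : ∀ j, Tendsto (fun L : ℝ => conj (wT u lam L 1 j)) atTop (𝓝 (conj (jost u lam j))) :=
    fun j => (Complex.continuous_conj.tendsto _).comp (h j)
  fin_cases i <;> fin_cases j
  · refine (hc 1).congr fun L => ?_
    simp [transitionNormalized, wT, hw, (transition_real hu hl L).1]
  · refine (hc 0).neg.congr fun L => ?_
    simp [transitionNormalized, wT, hw, (transition_real hu hl L).2]
  · refine (h 0).congr fun L => ?_
    simp [transitionNormalized, wT, weight]
  · refine (h 1).congr fun L => ?_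
    simp [transitionNormalized, wT, weight]

theorem transitionInf_eq {u : ℝ → ℂ} (hu : Continuous u) (hi : IntegrableOn u (Ioi 0)) (lam : ℝ) :
    transitionInf u lam = jostMat u lam := by
  ext i j
  exact (tendsto_transitionNormalized hu hi lam i j).limUnder_eq

theorem jostMat_det {u : ℝ → ℂ} (hu : Continuous u) (hi : IntegrableOn u (Ioi 0)) (lam : ℝ) :
    (jostMat u lam).det = 1 := by
  have h := fun i j => tendsto_transitionNormalized hu hi lam i j
  have h2 := ((h 0 0).mul (h 1 1)).sub ((h 0 1).mul (h 1 0))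
  rw [Matrix.det_fin_two]
  refine tendsto_nhds_unique h2 (tendsto_const_nhds.congr fun L => ?_)
  rw [← Matrix.det_fin_two, transitionNormalized, Matrix.det_mul, transition_det hu,
    Matrix.det_diagonal]
  simp [← Complex.exp_add]

theorem cbar_integrableOn {u : ℝ → ℂ} (hi : IntegrableOn u (Ioi 0)) :
    IntegrableOn (cbar u) (Ioi 0) := by
  refine (integrable_norm_iff ?_).1 ?_
  · exact Complex.continuous_conj.comp_aestronglyMeasurable hi.aestronglyMeasurable
  · simpa [cbar] using hi.norm

theorem tauInf_eq {u uh : ℝ → ℂ} (hu : Continuous u) (hi : IntegrableOn u (Ioi 0))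
    (huh : Continuous uh) (hih : IntegrableOn uh (Ioi 0)) (K : Mat2) (lam : ℝ) :
    tauInf u uh K lam = jostMat u lam * K * (jostMat (cbar uh) lam).transpose := by
  have hl : (lam : ℂ).im = 0 := Complex.ofReal_im lam
  have e : (-(lam : ℂ)) = ((-lam : ℝ) : ℂ) := by push_cast; rfl
  have hj := fun j => jost_cbar huh hih hl.le j
  rw [Complex.conj_ofReal, e] at hj
  rw [tauInf, e, transitionInf_eq hu hi, transitionInf_eq huh hih, Matrix.inv_def,
    jostMat_det huh hih, Ring.inverse_one, one_smul]
  congr 1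
  rw [jostMat, Matrix.adjugate_fin_two, jostMat]
  ext i j
  fin_cases i <;> fin_cases j <;> simp [hj]

theorem trace_tau_eq {u uh : ℝ → ℂ} (huh : Continuous uh) (K : Mat2) (lam : ℂ) (L : ℝ) :
    (tau u uh K lam L).trace = ∑ i, ∑ a, ∑ b,
      transition u lam L i a * K a b * transition (cbar uh) lam L i b := by
  rw [tau_eq huh, Matrix.trace]
  simp only [Matrix.diag, Matrix.mul_apply, Matrix.transpose_apply, Fin.sum_univ_two]
  ring

/-- The factor exp(−iλL) is the square of the weight and is shared between the two transition
matrices. The contribution of the first rows then tends to 0 and the second rows converge to Jost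
rows. -/
theorem tendsto_trace_tau {u uh : ℝ → ℂ} (hu : Continuous u) (hi : IntegrableOn u (Ioi 0))
    (huh : Continuous uh) (hih : IntegrableOn uh (Ioi 0)) (K : Mat2) {lam : ℂ} (hl : lam.im < 0) :
    Tendsto (fun L : ℝ => Complex.exp (-(Complex.I * lam * L)) * (tau u uh K lam L).trace) atTop
      (𝓝 (∑ a, ∑ b, jost u lam a * K a b * jost (cbar uh) lam b)) := by
  have hcu := continuous_cbar huh
  have hci := cbar_integrableOn hih
  have h0 := fun j => tendsto_wT_zero_row hu hi hl j
  have h1 := fun j => tendsto_jost hu hi hl.le j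
  have g0 := fun j => tendsto_wT_zero_row hcu hci hl j
  have g1 := fun j => tendsto_jost hcu hci hl.le j
  have e0 : Tendsto (fun L : ℝ => ∑ a, ∑ b, wT u lam L 0 a * K a b * wT (cbar uh) lam L 0 b) atTop
      (𝓝 (∑ a : Fin 2, ∑ b : Fin 2, 0 * K a b * 0)) :=
    tendsto_finsetSum _ fun a _ => tendsto_finsetSum _ fun b _ =>
      ((h0 a).mul_const _).mul (g0 b)
  have e1 : Tendsto (fun L : ℝ => ∑ a, ∑ b, wT u lam L 1 a * K a b * wT (cbar uh) lam L 1 b) atTop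
      (𝓝 (∑ a, ∑ b, jost u lam a * K a b * jost (cbar uh) lam b)) :=
    tendsto_finsetSum _ fun a _ => tendsto_finsetSum _ fun b _ =>
      ((h1 a).mul_const _).mul (g1 b)
  have e := e0.add e1
  simp only [mul_zero, Finset.sum_const_zero, zero_add] at e
  refine e.congr fun L => ?_
  have hw : Complex.exp (-(Complex.I * lam * L)) = weight lam L * weight lam L := by
    rw [weight, ← Complex.exp_add]
    congr 1; ring
  rw [trace_tau_eq huh, hw, Fin.sum_univ_two (f := fun i => ∑ a, ∑ b,
      transition u lam L i a * K a b * transition (cbar uh) lam L i b), mul_add, Finset.mul_sum,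
      Finset.mul_sum]
  congr 1 <;>
  · refine Finset.sum_congr rfl fun a _ => ?_
    rw [Finset.mul_sum]
    refine Finset.sum_congr rfl fun b _ => ?_
    simp only [wT, Matrix.smul_apply, smul_eq_mul]
    ring

theorem traceInf_eq {u uh : ℝ → ℂ} (hu : Continuous u) (hi : IntegrableOn u (Ioi 0))
    (huh : Continuous uh) (hih : IntegrableOn uh (Ioi 0)) (K : Mat2) {lam : ℂ} (hl : lam.im < 0) :
    traceInf u uh K lam = ∑ a, ∑ b, jost u lam a * K a b * jost (cbar uh) lam b :=
  (tendsto_trace_tau hu hi huh hih K hl).limUnder_eq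

/-! ### Evolution in time -/

theorem laxV_succ (n : ℕ) (u : ℝ → ℂ) (lam : ℂ) (x : ℝ) :
    laxV (n + 1) u lam x = lam • laxV n u lam x + coefMat u x (n + 1) := by
  rw [laxV_eq, Finset.sum_range_succ, laxV_eq, Finset.smul_sum, Nat.sub_self, pow_zero, one_smul]
  congr 1
  refine Finset.sum_congr rfl fun j hj => ?_
  rw [Finset.mem_range] at hj
  rw [smul_smul, ← pow_succ']
  congr 2; omega

theorem laxV_zero (u : ℝ → ℂ) (lam : ℂ) (x : ℝ) : laxV 0 u lam x = coefMat u x 0 := by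
  simp [laxV_eq]

/-- The two `varU` terms telescope in the recursion V⁽ⁿ⁺¹⁾ = λV⁽ⁿ⁾ + Q_{n+1}, so only the last
source, ic_{n+1}, survives in the zero curvature equation. -/
theorem coefMat_hasDerivAt {u : ℝ → ℂ} (hu : HalfLineSchwartz u) (lam : ℂ) (n : ℕ) (x : ℝ)
    (i j : Fin 2) : HasDerivAt (fun x => coefMat u x n i j)
      ((laxU u lam x * coefMat u x n - coefMat u x n * laxU u lam x
        - lam • varU (Complex.I * (coef u n).c x) + varU (Complex.I * (coef u (n + 1)).c x)) i j)
      x := by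
  obtain ⟨ha, hb, hc⟩ := coef_hasDerivAt hu n x
  have hl : lam / (2 * Complex.I) = -(Complex.I * lam / 2) := by field_simp; simp
  have b1 := (coef_conj hu n).1 x
  have b2 := (coef_conj hu (n + 1)).1 x
  have hcc : ∀ n, conj ((coef u n).c x) = -(coef u n).b x := fun n => by
    rw [(coef_conj hu n).1, neg_neg]
  fin_cases i <;> fin_cases j
  · refine ha.congr_deriv ?_
    simp [coefMat, laxU, varU, hl, hcc]; ring
  · refine hb.congr_deriv ?_
    simp [coefMat, laxU, varU, hl, hcc]; ring
  · refine hc.congr_deriv ?_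
    simp [coefMat, laxU, varU, hl, hcc]; ring
  · refine ha.neg.congr_deriv ?_
    simp [coefMat, laxU, varU, hl, hcc]; ring

/-- Zero curvature. -/
theorem laxV_hasDerivAt {u : ℝ → ℂ} (hu : HalfLineSchwartz u) (lam : ℂ) (n : ℕ) (x : ℝ)
    (i j : Fin 2) : HasDerivAt (fun x => laxV n u lam x i j)
      ((laxU u lam x * laxV n u lam x - laxV n u lam x * laxU u lam x
        + varU (Complex.I * (coef u (n + 1)).c x)) i j) x := by
  induction n generalizing i j with
  | zero =>
    simp only [laxV_zero]
    refine (coefMat_hasDerivAt hu lam 0 x i j).congr_deriv ?_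
    have : varU (Complex.I * (coef u 0).c x) = 0 := by
      ext i j; fin_cases i <;> fin_cases j <;> simp [varU, coef]
    rw [this, smul_zero, sub_zero]
  | succ n ih =>
    simp only [laxV_succ]
    refine (((ih i j).const_mul lam).add (coefMat_hasDerivAt hu lam (n + 1) x i j)).congr_deriv ?_
    rw [← smul_eq_mul, ← Matrix.smul_apply, ← Matrix.add_apply]
    refine congrFun (congrFun (?_ : (_ : Mat2) = _) i) j
    simp only [mul_add, add_mul, Matrix.mul_smul, Matrix.smul_mul, smul_add, smul_sub]
    abel

/-- The variation of the transition matrix along the flow. -/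
theorem integral_flow {u : ℝ → ℂ} (hu : HalfLineSchwartz u) (lam : ℂ) (n : ℕ) (L : ℝ)
    (i j : Fin 2) :
    ∫ y in (0 : ℝ)..L, (propagator u lam L y i 1 * (Complex.I * (coef u (n + 1)).c y)
        * transition u lam y 0 j
        - propagator u lam L y i 0 * conj (Complex.I * (coef u (n + 1)).c y)
        * transition u lam y 1 j) =
      (laxV n u lam L * transition u lam L - transition u lam L * laxV n u lam 0) i j := by
  have hc := hu.continuous
  -- Conjugating V by transition matrices removes the commutator with U from its derivative; what
  -- remains is the source, which is the integrand.
  have hd : ∀ y, HasDerivAt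
      (fun y => (propagator u lam L y * laxV n u lam y * transition u lam y) i j)
      (propagator u lam L y i 1 * (Complex.I * (coef u (n + 1)).c y)
        * transition u lam y 0 j
        - propagator u lam L y i 0 * conj (Complex.I * (coef u (n + 1)).c y)
        * transition u lam y 1 j) y := by
    intro y
    have h1 := hasDerivAt_mul_apply (A := fun _ => transition u lam L) (A' := 0) (x := y)
      (fun i j => hasDerivAt_const _ _) (transitionInv_hasDerivAt hc lam y)
    have h2 := hasDerivAt_mul_apply h1 (laxV_hasDerivAt hu lam n y)
    have h3 := hasDerivAt_mul_apply h2 (transition_hasDerivAt hc lam y) i j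
    refine h3.congr_deriv ?_
    rw [← mul_varU_mul, propagator]
    refine congrFun (congrFun (?_ : (_ : Mat2) = _) i) j
    simp only [zero_mul, zero_add, Matrix.mul_neg, Matrix.neg_mul, Matrix.mul_sub, Matrix.sub_mul,
      Matrix.mul_assoc, Matrix.mul_add, Matrix.add_mul]
    abel
  rw [intervalIntegral.integral_eq_sub_of_hasDerivAt (fun y _ => hd y)]
  · rw [propagator_self hc, propagator_zero_right, transition_zero, one_mul, mul_one,
      Matrix.sub_apply]
  · refine Continuous.intervalIntegrable ?_ _ _
    have c1 := propagator_continuous_right hc lam L i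
    have c2 := fun i => transition_continuous hc lam i j
    have c3 : Continuous fun y => Complex.I * (coef u (n + 1)).c y :=
      continuous_const.mul (coef_schwartz hu n).2.2.continuous
    exact (((c1 1).mul c3).mul (c2 0)).sub
      (((c1 0).mul (Complex.continuous_conj.comp c3)).mul (c2 1))

theorem tendsto_laxV {u : ℝ → ℂ} (hu : HalfLineSchwartz u) (lam : ℂ) (n : ℕ) :
    Tendsto (fun x => laxV n u lam x 1 0) atTop (𝓝 0) ∧
      Tendsto (fun x => laxV n u lam x 1 1) atTop (𝓝 (-(lam ^ n * (Complex.I / 2)))) := by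
  induction n with
  | zero => simp [laxV_zero, coefMat, coef]
  | succ n ih =>
    simp only [laxV_succ]
    have h := coef_schwartz hu n
    constructor
    · have := (ih.1.const_mul lam).add h.2.2.tendsto_zero
      rw [mul_zero, add_zero] at this
      exact this
    · have := (ih.2.const_mul lam).add h.1.tendsto_zero.neg
      rw [neg_zero, add_zero] at this
      rw [pow_succ']
      have e : -(lam * lam ^ n * (Complex.I / 2)) = lam * -(lam ^ n * (Complex.I / 2)) := by ring
      rw [e]
      exact this

namespace IsHalfLineSolution

variable {n : ℕ} {J : Set ℝ} {u : ℝ → ℝ → ℂ}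

/-- Decay of c_{n+1}, uniform for times near t, bounds the time derivative by an integrable function
of x; the mean value inequality turns this into the required Lipschitz bound. -/
theorem diffFamily (h : IsHalfLineSolution n J u) (hJ : IsOpen J) {t : ℝ} (ht : t ∈ J) :
    DiffFamily (fun s x => u x s)
      (fun x => Complex.I * (coef (fun y => u y t) (n + 1)).c x) t where
  cont := (h.rapidDecay hJ ht).1.mono fun _ hs => hs.continuous
  int := (h.rapidDecay hJ ht).integrableOn
  vcont := continuous_const.mul (coef_schwartz (h.schwartz hJ ht) n).2.2.continuous
  vint := ((coef_schwartz (h.schwartz hJ ht) n).2.2.const_mul Complex.I).integrableOn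
  deriv := fun y hy => h.hasDerivAt_time hJ ht hy
  dom := by
    obtain ⟨C, hC⟩ := ((h.rapidDecay hJ ht).coef n).2.2.le_inv 0
    obtain ⟨δ, hδ, hball⟩ := Metric.eventually_nhds_iff_ball.1 (hC.and (hJ.mem_nhds ht))
    refine ⟨fun x => C * (1 + x ^ 2)⁻¹, (integrable_inv_one_add_sq.const_mul C).integrableOn, ?_⟩
    filter_upwards [Metric.ball_mem_nhds t hδ] with s hs y hy
    have := (convex_ball t δ).norm_image_sub_le_of_norm_hasDerivWithin_le (f := fun s => u y s)
      (f' := fun s => Complex.I * (coef (fun y => u y s) (n + 1)).c y) (C := C * (1 + y ^ 2)⁻¹)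
      (fun r hr => (h.hasDerivAt_time hJ (hball r hr).2 hy).hasDerivWithinAt)
      (fun r hr => by
        have := (hball r hr).1 y hy
        rw [norm_mul, Complex.norm_I, one_mul]
        simpa using this)
      (Metric.mem_ball_self hδ) hs
    simpa using this

/-- The variation integral over [0, L] is explicit by `integral_flow`. As L → ∞ only λⁿa₀ is left of
V in the second row at the far end, giving the scalar −iλⁿ/2, while the end x = 0 gives −jV(0). -/
theorem jost_hasDerivAt (h : IsHalfLineSolution n J u) (hJ : IsOpen J) {t : ℝ} (ht : t ∈ J)
    {lam : ℂ} (hl : lam.im ≤ 0) (j : Fin 2) :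
    HasDerivAt (fun s => jost (fun x => u x s) lam j)
      (-(lam ^ n * (Complex.I / 2)) * jost (fun x => u x t) lam j
        - ∑ k, jost (fun x => u x t) lam k * laxV n (fun x => u x t) lam 0 k j) t := by
  have hs := h.schwartz hJ ht
  have hF := h.diffFamily hJ ht
  set f : ℝ → ℂ := fun x => u x t
  have hc := hs.continuous
  have hi := hs.integrableOn
  refine (hF.jost_hasDerivAt hl j).congr_deriv ?_
  have hk := tendsto_kernel hc hi hl hF.vcont hF.vint (wT_continuous hc lam 0 j)
    (wT_continuous hc lam 1 j) (fun y hy => norm_wT_le hc hl hy 0 j)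
    (fun y hy => norm_wT_le hc hl hy 1 j)
  refine tendsto_nhds_unique hk ?_
  obtain ⟨v0, v1⟩ := tendsto_laxV hs lam n
  have b0 : Tendsto (fun L => laxV n f lam L 1 0 * wT f lam L 0 j) atTop (𝓝 0) := by
    refine squeeze_zero_norm' (a := fun L => ‖laxV n f lam L 1 0‖) ?_
      (tendsto_zero_iff_norm_tendsto_zero.1 v0)
    filter_upwards [eventually_ge_atTop 0] with L hL
    rw [norm_mul]
    exact mul_le_of_le_one_right (norm_nonneg _) (norm_wT_le hc hl hL 0 j)
  have hlim := (b0.add (v1.mul (tendsto_jost hc hi hl j))).sub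
    (tendsto_finsetSum (Finset.univ : Finset (Fin 2)) fun k _ =>
      (tendsto_jost hc hi hl k).mul_const (laxV n f lam 0 k j))
  rw [zero_add] at hlim
  refine hlim.congr' ?_
  filter_upwards [eventually_ge_atTop 0] with L hL
  rw [← intervalIntegral.integral_of_le hL]
  simp only [← weight_mul_kernel f f]
  rw [intervalIntegral.integral_const_mul, integral_flow hs]
  simp only [wT, Matrix.sub_apply, Matrix.mul_apply, Matrix.smul_apply, smul_eq_mul,
    Fin.sum_univ_two]
  ring

end IsHalfLineSolution

theorem laxV_conj {u : ℝ → ℂ} (hu : HalfLineSchwartz u) (n : ℕ) (lam : ℂ) (x : ℝ) (i j : Fin 2) :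
    conj (laxV n u (conj lam) x i j) = -laxV n u lam x j i := by
  have hcc : ∀ n, conj ((coef u n).c x) = -(coef u n).b x := fun n => by
    rw [(coef_conj hu n).1, neg_neg]
  have hbb : ∀ n, conj ((coef u n).b x) = -(coef u n).c x := fun n => by
    rw [(coef_conj hu n).1, map_neg, Complex.conj_conj]
  have hQ : ∀ n, ∀ i j, conj (coefMat u x n i j) = -coefMat u x n j i := fun n i j => by
    have ha := (coef_conj hu n).2 x
    fin_cases i <;> fin_cases j <;> simp [coefMat, ha, hcc, hbb]
  induction n with
  | zero => simp only [laxV_zero, hQ]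
  | succ n ih =>
    simp only [laxV_succ, Matrix.add_apply, Matrix.smul_apply, smul_eq_mul, map_add, map_mul,
      Complex.conj_conj, ih, hQ]
    ring

theorem laxV_trace (n : ℕ) (u : ℝ → ℂ) (lam : ℂ) (x : ℝ) :
    laxV n u lam x 1 1 = -laxV n u lam x 0 0 := by
  induction n with
  | zero => simp [laxV_zero, coefMat]
  | succ n ih =>
    simp only [laxV_succ, Matrix.add_apply, Matrix.smul_apply, smul_eq_mul, ih]
    simp [coefMat]
    ring

theorem IsHalfLineSolution.jost_cbar_hasDerivAt {n : ℕ} {J : Set ℝ} {u : ℝ → ℝ → ℂ}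
    (h : IsHalfLineSolution n J u) (hJ : IsOpen J) {t : ℝ} (ht : t ∈ J)
    {lam : ℂ} (hl : lam.im ≤ 0) (j : Fin 2) :
    HasDerivAt (fun s => jost (cbar fun x => u x s) lam j)
      (((-lam) ^ n * (Complex.I / 2)) * jost (cbar fun x => u x t) lam j
        + ∑ k, jost (cbar fun x => u x t) lam k * laxV n (fun x => u x t) (-lam) 0 j k) t := by
  have hl' : (-conj lam).im ≤ 0 := by simpa using hl
  have hs := h.schwartz hJ ht
  have hd := (h.jost_hasDerivAt hJ ht hl' j).star
  have e : ∀ᶠ s in 𝓝 t, jost (cbar fun x => u x s) lam j =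
      star (jost (fun x => u x s) (-conj lam) j) :=
    Filter.eventually_of_mem (hJ.mem_nhds ht) fun s hs' =>
      jost_cbar (h.schwartz hJ hs').continuous (h.schwartz hJ hs').integrableOn hl j
  refine (hd.congr_of_eventuallyEq e).congr_deriv ?_
  have hj := fun j => jost_cbar hs.continuous hs.integrableOn hl j
  have hV : ∀ k, conj (laxV n (fun x => u x t) (-conj lam) 0 k j) =
      -laxV n (fun x => u x t) (-lam) 0 j k := fun k => by
    have := laxV_conj hs n (-lam) 0 k j
    rwa [map_neg] at this
  simp only [Fin.sum_univ_two]
  simp only [hj, Complex.star_def, map_sub, map_add, map_mul, hV, map_neg, map_pow, map_div₀,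
    Complex.conj_I, Complex.conj_conj, map_ofNat]
  ring

/-- The bilinear form in Jost rows is conserved by the boundary equation. -/
theorem bilinear_hasDerivAt_zero {r s : ℝ → Fin 2 → ℂ} {K : ℝ → Mat2} {V W : Mat2} {c : ℂ} {t : ℝ}
    (hr : ∀ j, HasDerivAt (fun x => r x j) (c * r t j - ∑ k, r t k * V k j) t)
    (hs : ∀ j, HasDerivAt (fun x => s x j) (-c * s t j - ∑ k, s t k * W k j) t)
    (hK : ∀ i j, HasDerivAt (fun x => K x i j) ((V * K t + K t * W.transpose) i j) t) :
    HasDerivAt (fun x => ∑ a, ∑ b, r x a * K x a b * s x b) 0 t := by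
  have := HasDerivAt.fun_sum (u := Finset.univ) fun a _ => HasDerivAt.fun_sum
    (u := Finset.univ) fun b _ => ((hr a).mul (hK a b)).mul (hs b)
  refine this.congr_deriv ?_
  simp [Fin.sum_univ_two, Matrix.mul_apply]
  ring

/-- The conjugate row. -/
def tildeRow (r : Fin 2 → ℂ) : Fin 2 → ℂ := ![conj (r 1), -conj (r 0)]

/-- A traceless skew-Hermitian V commutes with the map r ↦ (r̄₁, −r̄₀), the quaternionic structure
of ℂ²; only the imaginary scalar c changes sign. -/
theorem tildeRow_hasDerivAt {r : ℝ → Fin 2 → ℂ} {V : Mat2} {c : ℂ} {t : ℝ}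
    (hr : ∀ j, HasDerivAt (fun x => r x j) (c * r t j - ∑ k, r t k * V k j) t)
    (hc : conj c = -c) (hV : ∀ i j, conj (V i j) = -V j i) (htr : V 1 1 = -V 0 0) (j : Fin 2) :
    HasDerivAt (fun x => tildeRow (r x) j) (-c * tildeRow (r t) j - ∑ k, tildeRow (r t) k * V k j)
      t := by
  fin_cases j
  · refine (hr 1).star.congr_deriv ?_
    simp [tildeRow, Fin.sum_univ_two, hc, hV, htr]
    ring
  · refine (hr 0).star.neg.congr_deriv ?_
    simp [tildeRow, Fin.sum_univ_two, hc, hV, htr]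
    ring

theorem trace_jostMat (u q : ℝ → ℂ) (K : Mat2) (lam : ℂ) :
    (jostMat u lam * K * (jostMat q lam).transpose).trace =
      ∑ a, ∑ b, jost u lam a * K a b * jost q lam b +
      ∑ a, ∑ b, tildeRow (jost u lam) a * K a b * tildeRow (jost q lam) b := by
  simp only [Matrix.trace, Matrix.diag, Matrix.mul_apply, Matrix.transpose_apply,
    Fin.sum_univ_two]
  simp only [jostMat, tildeRow, Matrix.of_apply, Matrix.cons_val_zero, Matrix.cons_val_one]
  ring

/-! ### Conservation of the trace of the monodromy matrix -/

theorem bilinear_tildeRow_hasDerivAt_zero {r s : ℝ → Fin 2 → ℂ} {K : ℝ → Mat2} {V W : Mat2} {c : ℂ}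
    {t : ℝ} (hr : ∀ j, HasDerivAt (fun x => r x j) (c * r t j - ∑ k, r t k * V k j) t)
    (hs : ∀ j, HasDerivAt (fun x => s x j) (-c * s t j - ∑ k, s t k * W k j) t)
    (hK : ∀ i j, HasDerivAt (fun x => K x i j) ((V * K t + K t * W.transpose) i j) t)
    (hc : conj c = -c) (hV : ∀ i j, conj (V i j) = -V j i) (htV : V 1 1 = -V 0 0)
    (hW : ∀ i j, conj (W i j) = -W j i) (htW : W 1 1 = -W 0 0) :
    HasDerivAt (fun x => ∑ a, ∑ b, r x a * K x a b * s x b +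
      ∑ a, ∑ b, tildeRow (r x) a * K x a b * tildeRow (s x) b) 0 t := by
  have hc' : conj (-c) = - -c := by rw [map_neg, hc]
  have := (bilinear_hasDerivAt_zero hr hs hK).add
    (bilinear_hasDerivAt_zero (tildeRow_hasDerivAt hr hc hV htV)
      (tildeRow_hasDerivAt hs hc' hW htW) hK)
  rw [add_zero] at this
  exact this

section Even

variable {k : ℕ} {β : ℝ} {J : Set ℝ} {u : ℝ → ℝ → ℂ} {t : ℝ}

theorem even_jost_cbar_hasDerivAt (hJ : IsOpen J) (h : IsHalfLineSolution (2 * k) J u) (ht : t ∈ J)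
    {lam : ℂ} (hl : lam.im ≤ 0) (j : Fin 2) :
    HasDerivAt (fun s => jost (cbar fun x => u x s) lam j)
      (-(-(lam ^ (2 * k) * (Complex.I / 2))) * jost (cbar fun x => u x t) lam j
        - ∑ i, jost (cbar fun x => u x t) lam i *
          (-(laxV (2 * k) (fun x => u x t) (-lam) 0).transpose) i j) t := by
  refine (h.jost_cbar_hasDerivAt hJ ht hl j).congr_deriv ?_
  simp only [Matrix.neg_apply, Matrix.transpose_apply, Fin.sum_univ_two, (even_two_mul k).neg_pow]
  ring

theorem EvenBoundaryEq.hasDerivAt (h : EvenBoundaryEq k β u t) (lam : ℂ) (i j : Fin 2) :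
    HasDerivAt (fun s => evenK β (u 0 s) lam i j)
      ((laxV (2 * k) (fun x => u x t) lam 0 * evenK β (u 0 t) lam + evenK β (u 0 t) lam *
        (-(laxV (2 * k) (fun x => u x t) (-lam) 0).transpose).transpose) i j) t := by
  refine (h lam i j).congr_deriv ?_
  rw [Matrix.transpose_neg, Matrix.transpose_transpose, mul_neg, sub_eq_add_neg]

theorem evenTraceInf_hasDerivAt_zero (hJ : IsOpen J) (h : IsHalfLineSolution (2 * k) J u)
    (ht : t ∈ J) (hB : EvenBoundaryEq k β u t) {lam : ℂ} (hl : lam.im < 0) :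
    HasDerivAt (fun r => evenTraceInf β lam (evenState u r)) 0 t := by
  refine (bilinear_hasDerivAt_zero (fun j => h.jost_hasDerivAt hJ ht hl.le j)
    (even_jost_cbar_hasDerivAt hJ h ht hl.le) (hB.hasDerivAt lam)).congr_of_eventuallyEq ?_
  filter_upwards [hJ.mem_nhds ht] with r hr
  have hs := h.schwartz hJ hr
  exact traceInf_eq hs.continuous hs.integrableOn hs.continuous hs.integrableOn _ hl

theorem even_trace_tauInf_hasDerivAt_zero (hJ : IsOpen J) (h : IsHalfLineSolution (2 * k) J u)
    (ht : t ∈ J) (hB : EvenBoundaryEq k β u t) (lam : ℝ) :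
    HasDerivAt (fun r => (tauInf (fun x => u x r) (fun x => u x r)
      (evenK β (u 0 r) lam) lam).trace) 0 t := by
  have hl : (lam : ℂ).im ≤ 0 := (Complex.ofReal_im lam).le
  have hs := h.schwartz hJ ht
  have hV : ∀ (l : ℝ) (i j : Fin 2), conj (laxV (2 * k) (fun x => u x t) l 0 i j) =
      -laxV (2 * k) (fun x => u x t) l 0 j i := fun l i j => by
    have := laxV_conj hs (2 * k) l 0 i j
    rwa [Complex.conj_ofReal] at this
  refine (bilinear_tildeRow_hasDerivAt_zero (fun j => h.jost_hasDerivAt hJ ht hl j)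
    (even_jost_cbar_hasDerivAt hJ h ht hl) (hB.hasDerivAt lam) (by
      simp only [map_neg, map_mul, map_pow, map_div₀, Complex.conj_ofReal, Complex.conj_I, map_ofNat]
      ring) (hV lam)
    (laxV_trace _ _ _ _) (fun i j => ?_) ?_).congr_of_eventuallyEq ?_
  · have := hV (-lam) j i
    push_cast at this
    simp [this]
  · simp [laxV_trace]
  · filter_upwards [hJ.mem_nhds ht] with r hr
    have hs := h.schwartz hJ hr
    rw [tauInf_eq hs.continuous hs.integrableOn hs.continuous hs.integrableOn, trace_jostMat]

end Even

section Odd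

variable {k : ℕ} {β ε : ℝ} {J : Set ℝ} {u : ℝ → ℝ → ℂ} {t : ℝ}

/-- Conjugation turns the scalar into (−λ)ⁿ i/2, which for odd n has the sign of the scalar of u
instead of the opposite one. Time reversal supplies the missing sign, and this is why odd orders
pair u with û. -/
theorem odd_jost_cbar_hasDerivAt (hJ : IsOpen J) (h : IsHalfLineSolution (2 * k + 1) J u)
    (ht : -t ∈ J) {lam : ℂ} (hl : lam.im ≤ 0) (j : Fin 2) :
    HasDerivAt (fun s => jost (cbar fun x => u x (-s)) lam j)
      (-(-(lam ^ (2 * k + 1) * (Complex.I / 2))) * jost (cbar fun x => u x (-t)) lam j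
        - ∑ i, jost (cbar fun x => u x (-t)) lam i *
          (laxV (2 * k + 1) (fun x => u x (-t)) (-lam) 0).transpose i j) t := by
  have hd := (h.jost_cbar_hasDerivAt hJ ht hl j).scomp t (hasDerivAt_neg t)
  refine hd.congr_deriv ?_
  simp only [Matrix.transpose_apply, Fin.sum_univ_two, (odd_two_mul_add_one k).neg_pow, neg_smul,
    one_smul]
  ring

theorem OddBoundaryEq.hasDerivAt (h : OddBoundaryEq k β ε u t) (lam : ℂ) (i j : Fin 2) :
    HasDerivAt (fun s => oddK β ε (u 0 s) (u 0 (-s)) lam i j)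
      ((laxV (2 * k + 1) (fun x => u x t) lam 0 * oddK β ε (u 0 t) (u 0 (-t)) lam +
        oddK β ε (u 0 t) (u 0 (-t)) lam *
        ((laxV (2 * k + 1) (fun x => u x (-t)) (-lam) 0).transpose).transpose) i j) t := by
  rw [Matrix.transpose_transpose]
  exact h lam i j

theorem oddTraceInf_hasDerivAt_zero (hε : ε = 1 ∨ ε = -1) (hJ : IsOpen J) (hJs : ∀ t ∈ J, -t ∈ J)
    (h : IsHalfLineSolution (2 * k + 1) J u) (ht : t ∈ J) (hB : OddBoundaryEq k β ε u t) {lam : ℂ}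
    (hl : lam.im < 0) : HasDerivAt (fun r => oddTraceInf β ε lam (oddState ε u r)) 0 t := by
  refine (bilinear_hasDerivAt_zero (fun j => h.jost_hasDerivAt hJ ht hl.le j)
    (odd_jost_cbar_hasDerivAt hJ h (hJs t ht) hl.le) (hB.hasDerivAt lam)).congr_of_eventuallyEq ?_
  filter_upwards [hJ.mem_nhds ht] with r hr
  have hs := h.schwartz hJ hr
  have hs' := h.schwartz hJ (hJs r hr)
  simp only [oddK_eq_oddKw β ε hε]
  exact traceInf_eq hs.continuous hs.integrableOn hs'.continuous hs'.integrableOn _ hl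

theorem odd_trace_tauInf_hasDerivAt_zero (hJ : IsOpen J) (hJs : ∀ t ∈ J, -t ∈ J)
    (h : IsHalfLineSolution (2 * k + 1) J u) (ht : t ∈ J) (hB : OddBoundaryEq k β ε u t) (lam : ℝ) :
    HasDerivAt (fun r => (tauInf (fun x => u x r) (fun x => u x (-r))
      (oddK β ε (u 0 r) (u 0 (-r)) lam) lam).trace) 0 t := by
  have hl : (lam : ℂ).im ≤ 0 := (Complex.ofReal_im lam).le
  have hV : ∀ t ∈ J, ∀ (l : ℝ) (i j : Fin 2),
      conj (laxV (2 * k + 1) (fun x => u x t) l 0 i j) =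
        -laxV (2 * k + 1) (fun x => u x t) l 0 j i := fun t ht l i j => by
    have := laxV_conj (h.schwartz hJ ht) (2 * k + 1) l 0 i j
    rwa [Complex.conj_ofReal] at this
  refine (bilinear_tildeRow_hasDerivAt_zero (fun j => h.jost_hasDerivAt hJ ht hl j)
    (odd_jost_cbar_hasDerivAt hJ h (hJs t ht) hl) (hB.hasDerivAt lam) (by
      simp only [map_neg, map_mul, map_pow, map_div₀, Complex.conj_ofReal, Complex.conj_I, map_ofNat]
      ring) (hV t ht lam)
    (laxV_trace _ _ _ _) (fun i j => ?_) ?_).congr_of_eventuallyEq ?_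
  · have := hV (-t) (hJs t ht) (-lam) j i
    push_cast at this
    simp [this]
  · simp [laxV_trace]
  · filter_upwards [hJ.mem_nhds ht] with r hr
    have hs := h.schwartz hJ hr
    have hs' := h.schwartz hJ (hJs r hr)
    rw [tauInf_eq hs.continuous hs.integrableOn hs'.continuous hs'.integrableOn, trace_jostMat]

end Odd

/-! ### Asymptotic expansions -/

/-- `G(κ)` has the asymptotic power series `c` in `κ⁻¹` as `κ → +∞`. -/
def HasSeries (G : ℝ → ℂ) (c : PowerSeries ℂ) : Prop :=
  ∀ N : ℕ, ∃ P : Polynomial ℂ, (∀ d < N, P.coeff d = PowerSeries.coeff d c) ∧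
    (fun κ : ℝ => G κ - P.eval (κ : ℂ)⁻¹) =O[atTop] fun κ : ℝ => (κ : ℂ)⁻¹ ^ N

theorem polynomial_eval_inv_isBigO (P : Polynomial ℂ) :
    (fun κ : ℝ => P.eval (κ : ℂ)⁻¹) =O[atTop] fun _ => (1 : ℂ) := by
  have h0 : Tendsto (fun κ : ℝ => (κ : ℂ)⁻¹) atTop (𝓝 0) := by
    have := (Complex.continuous_ofReal.tendsto 0).comp tendsto_inv_atTop_zero
    simpa [Function.comp_def] using this
  exact ((P.continuous.tendsto 0).comp h0).isBigO_one ℂ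

namespace HasSeries

variable {G H : ℝ → ℂ} {c d : PowerSeries ℂ}

theorem of_polynomial (P : Polynomial ℂ) : HasSeries (fun κ => P.eval (κ : ℂ)⁻¹) (P : PowerSeries ℂ) :=
  fun N => ⟨P, fun d _ => by simp, by
    simp only [sub_self]
    exact Asymptotics.isBigO_zero _ _⟩

theorem add (h : HasSeries G c) (h' : HasSeries H d) : HasSeries (fun κ => G κ + H κ) (c + d) :=
  fun N => by
    obtain ⟨P, hP, hG⟩ := h N
    obtain ⟨Q, hQ, hH⟩ := h' N
    refine ⟨P + Q, fun m hm => by simp [hP m hm, hQ m hm], (hG.add hH).congr_left fun κ => ?_⟩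
    rw [Polynomial.eval_add]; ring

theorem isBigO_one (h : HasSeries G c) : G =O[atTop] fun _ => (1 : ℂ) := by
  obtain ⟨P, -, hG⟩ := h 0
  simp only [pow_zero] at hG
  exact (hG.add (polynomial_eval_inv_isBigO P)).congr_left fun κ => by ring

/-- Only the coefficients below N of an approximating polynomial are prescribed, so a product of
approximants is an approximant without truncation. -/
theorem mul (h : HasSeries G c) (h' : HasSeries H d) : HasSeries (fun κ => G κ * H κ) (c * d) :=
  fun N => by
    obtain ⟨P, hP, hG⟩ := h N
    obtain ⟨Q, hQ, hH⟩ := h' N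
    refine ⟨P * Q, fun m hm => ?_, ?_⟩
    · rw [Polynomial.coeff_mul, PowerSeries.coeff_mul]
      refine Finset.sum_congr rfl fun p hp => ?_
      have := Finset.HasAntidiagonal.mem_antidiagonal.1 hp
      rw [hP _ (by omega), hQ _ (by omega)]
    · have e1 := hG.mul h'.isBigO_one
      have e2 := (polynomial_eval_inv_isBigO P).mul hH
      simp only [mul_one, one_mul] at e1 e2
      refine (e1.add e2).congr_left fun κ => ?_
      rw [Polynomial.eval_mul]; ring

theorem congr (h : HasSeries G c) (e : G =ᶠ[atTop] H) : HasSeries H c := fun N => by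
  obtain ⟨P, hP, hG⟩ := h N
  exact ⟨P, hP, hG.congr' (e.mono fun κ hκ => by simp only [hκ]) EventuallyEq.rfl⟩

theorem isBigO (h : HasSeries G c) (N : ℕ) :
    (fun κ : ℝ => G κ - ∑ n ∈ Finset.range N, PowerSeries.coeff n c * (κ : ℂ)⁻¹ ^ n)
      =O[atTop] fun κ : ℝ => (κ : ℂ)⁻¹ ^ N := by
  obtain ⟨P, hP, hG⟩ := h N
  obtain ⟨Q, hQ⟩ : Polynomial.X ^ N ∣ P - PowerSeries.trunc N c := by
    refine Polynomial.X_pow_dvd_iff.2 fun d hd => ?_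
    rw [Polynomial.coeff_sub, PowerSeries.coeff_trunc, if_pos hd, hP d hd, sub_self]
  have e := (polynomial_eval_inv_isBigO Q).mul
    (Asymptotics.isBigO_refl (fun κ : ℝ => (κ : ℂ)⁻¹ ^ N) atTop)
  simp only [one_mul] at e
  refine (hG.add e).congr_left fun κ => ?_
  have h1 : (PowerSeries.trunc N c).eval (κ : ℂ)⁻¹ =
      ∑ n ∈ Finset.range N, PowerSeries.coeff n c * (κ : ℂ)⁻¹ ^ n := by
    simpa [Polynomial.eval₂_id] using PowerSeries.eval₂_trunc_eq_sum_range (κ : ℂ)⁻¹ (RingHom.id ℂ) N c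
  have h2 := congrArg (Polynomial.eval (κ : ℂ)⁻¹) hQ
  rw [Polynomial.eval_sub, Polynomial.eval_mul, Polynomial.eval_pow, Polynomial.eval_X, h1] at h2
  linear_combination -h2

theorem hasExpansion {F : ℂ → ℂ} (h : HasSeries (fun κ => F (-Complex.I * κ) / (-Complex.I * κ)) c) :
    HasExpansion F fun n => PowerSeries.coeff n c := fun N => by
  -- One extra term is needed because an error O(κ^(−N−1)) is what gives o(κ^(−N)).
  have h1 := h.isBigO (N + 1)
  have h2 : (fun κ : ℝ => (κ : ℂ)⁻¹ ^ (N + 1)) =o[atTop] fun κ : ℝ => (κ ^ N)⁻¹ := by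
    refine Asymptotics.IsLittleO.of_norm_left ?_
    have : (fun κ : ℝ => κ⁻¹ * (κ ^ N)⁻¹) =o[atTop] fun κ : ℝ => (1 : ℝ) * (κ ^ N)⁻¹ :=
      ((Asymptotics.isLittleO_one_iff ℝ).2 tendsto_inv_atTop_zero).mul_isBigO
        (Asymptotics.isBigO_refl _ _)
    simp only [one_mul] at this
    refine this.congr' ?_ EventuallyEq.rfl
    filter_upwards [eventually_gt_atTop 0] with κ hκ
    rw [norm_pow, norm_inv, Complex.norm_real, Real.norm_of_nonneg hκ.le, pow_succ, inv_pow, mul_comm]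
  refine (h1.trans_isLittleO h2).congr_left fun κ => ?_
  simp [div_eq_mul_inv]

end HasSeries

theorem HasExpansion.unique {F : ℂ → ℂ} {c d : ℕ → ℂ} (hc : HasExpansion F c)
    (hd : HasExpansion F d) : c = d := by
  funext n
  induction n using Nat.strong_induction_on with
  | _ n ih =>
    have h := (hd n).sub (hc n)
    have e : (fun κ : ℝ => (c n - d n) / (κ : ℂ) ^ n) =o[atTop] fun κ : ℝ => (κ ^ n)⁻¹ := by
      refine h.congr_left fun κ => ?_
      have : ∑ m ∈ Finset.range n, c m / (κ : ℂ) ^ m = ∑ m ∈ Finset.range n, d m / (κ : ℂ) ^ m :=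
        Finset.sum_congr rfl fun m hm => by rw [ih m (Finset.mem_range.1 hm)]
      rw [Finset.sum_range_succ, Finset.sum_range_succ, this]
      ring
    have e1 : (fun κ : ℝ => (κ ^ n)⁻¹) =O[atTop] fun κ : ℝ => ((κ : ℂ) ^ n)⁻¹ :=
      Asymptotics.IsBigO.of_bound 1 (Eventually.of_forall fun κ => by simp)
    have e2 : (fun _ : ℝ => c n - d n) =o[atTop] fun _ : ℝ => (1 : ℝ) := by
      refine ((e.trans_isBigO e1).mul_isBigO (Asymptotics.isBigO_refl (fun κ : ℝ => (κ : ℂ) ^ n) atTop)).congr'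
        ?_ EventuallyEq.rfl |>.trans_isBigO ?_
      · filter_upwards [eventually_gt_atTop 0] with κ hκ
        have : (κ : ℂ) ≠ 0 := by exact_mod_cast hκ.ne'
        field_simp
      · refine Asymptotics.IsBigO.of_bound 1 ?_
        filter_upwards [eventually_gt_atTop 0] with κ hκ
        have : κ ^ n ≠ 0 := by positivity
        simp [abs_of_pos hκ, this]
    have := (Asymptotics.isLittleO_one_iff ℝ).1 e2
    exact sub_eq_zero.1 (tendsto_nhds_unique tendsto_const_nhds this)

theorem HasExpansion.congr {F G : ℂ → ℂ} {c : ℕ → ℂ} (h : HasExpansion F c)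
    (e : ∀ lam : ℂ, lam.im < 0 → F lam = G lam) : HasExpansion G c := fun N => by
  refine (h N).congr' ?_ EventuallyEq.rfl
  filter_upwards [eventually_gt_atTop 0] with κ hκ
  rw [e _ (by simpa using hκ)]

/-- Existence and conservation of the expansion coefficients. -/
theorem exists_conserved_coefficients {m : ℕ} {D : Set ℂ} (F : ℂ → PhasePoint m → ℂ)
    (hF : ∀ s ∈ phaseSpace m D, ∃ c, HasExpansion (fun lam => F lam s) c) :
    ∃ I : ℕ → PhasePoint m → ℂ,
      (∀ s ∈ phaseSpace m D, HasExpansion (fun lam => F lam s) fun n => I n s) ∧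
      ∀ (J : Set ℝ) (γ : ℝ → PhasePoint m), IsOpen J → (∀ t ∈ J, γ t ∈ phaseSpace m D) →
        (∀ t ∈ J, ∀ lam : ℂ, lam.im < 0 → HasDerivAt (fun r => F lam (γ r)) 0 t) →
        ∀ t ∈ J, ∀ n, HasDerivAt (fun r => I n (γ r)) 0 t := by
  classical
  -- The value 0 is assigned where no expansion exists, hence outside phase space at most.
  refine ⟨fun n s => if h : ∃ c, HasExpansion (fun lam => F lam s) c then h.choose n else 0,
    fun s hs => ?_, fun J γ hJ hγ hd t ht n => ?_⟩
  · have h := hF s hs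
    simp only [h, dif_pos]
    exact h.choose_spec
  · obtain ⟨δ, hδ, hb⟩ := Metric.isOpen_iff.1 hJ t ht
    refine (hasDerivAt_const t (if h : ∃ c, HasExpansion (fun lam => F lam (γ t)) c
      then h.choose n else 0)).congr_of_eventuallyEq ?_
    filter_upwards [Metric.ball_mem_nhds t hδ] with r hr
    -- Near t the path keeps F(λ) constant for every λ at once. Uniqueness of the expansion then
    -- makes the coefficients locally constant, and no asymptotic series has to be differentiated in
    -- time.
    have e : ∀ lam : ℂ, lam.im < 0 → F lam (γ r) = F lam (γ t) := fun lam hl => by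
      have := (convex_ball t δ).norm_image_sub_le_of_norm_hasDerivWithin_le (C := 0)
        (fun s hs => (hd s (hb hs) lam hl).hasDerivWithinAt) (fun _ _ => norm_zero.le)
        (Metric.mem_ball_self hδ) hr
      rw [zero_mul] at this
      exact sub_eq_zero.1 (norm_le_zero_iff.1 this)
    have hr' := hF _ (hγ r (hb hr))
    have ht' := hF _ (hγ t ht)
    simp only [hr', ht', dif_pos]
    rw [(hr'.choose_spec.congr e).unique ht'.choose_spec]

/-- The coefficients of the expansion of the Jost solution. -/
def jostCoef (u : ℝ → ℂ) : ℕ → (ℝ → ℂ) × (ℝ → ℂ)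
  | 0 => (fun _ => 0, fun _ => 1)
  | n + 1 =>
    let p : ℝ → ℂ := fun x => deriv (jostCoef u n).1 x + u x * (jostCoef u n).2 x
    (p, dInv fun x => conj (u x) * p x)

theorem jostCoef_schwartz {u : ℝ → ℂ} (hu : HalfLineSchwartz u) (n : ℕ) :
    HalfLineSchwartz (jostCoef u (n + 1)).1 ∧ HalfLineSchwartz (jostCoef u (n + 1)).2 := by
  have key : ∀ n, HalfLineSchwartz (jostCoef u (n + 1)).1 →
      HalfLineSchwartz (jostCoef u (n + 1)).2 := fun n h => (hu.cbar.mul h).dInv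
  induction n with
  | zero =>
    have : HalfLineSchwartz (jostCoef u (0 + 1)).1 := by simpa [jostCoef] using hu
    exact ⟨this, key 0 this⟩
  | succ n ih =>
    have : HalfLineSchwartz (jostCoef u (n + 1 + 1)).1 := ih.1.deriv.add (hu.mul ih.2)
    exact ⟨this, key _ this⟩

theorem jostCoef_hasDerivAt {u : ℝ → ℂ} (hu : HalfLineSchwartz u) (n : ℕ) (x : ℝ) :
    HasDerivAt (jostCoef u n).1 ((jostCoef u (n + 1)).1 x - u x * (jostCoef u n).2 x) x ∧
      HasDerivAt (jostCoef u n).2 (conj (u x) * (jostCoef u n).1 x) x := by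
  cases n with
  | zero => exact ⟨by simpa [jostCoef] using hasDerivAt_const x (0 : ℂ),
      by simpa [jostCoef] using hasDerivAt_const x (1 : ℂ)⟩
  | succ n =>
    obtain ⟨h1, -⟩ := jostCoef_schwartz hu n
    refine ⟨((h1.1.differentiable (by simp)).differentiableAt.hasDerivAt).congr_deriv ?_, ?_⟩
    · rw [jostCoef.eq_2 u (n + 1)]; ring
    · have := hu.cbar.mul h1
      exact hasDerivAt_dInv this.continuous this.integrableOn x

theorem tendsto_jostCoef {u : ℝ → ℂ} (hu : HalfLineSchwartz u) (n : ℕ) :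
    Tendsto (jostCoef u n).1 atTop (𝓝 0) ∧
      Tendsto (jostCoef u n).2 atTop (𝓝 (if n = 0 then 1 else 0)) := by
  cases n with
  | zero => exact ⟨tendsto_const_nhds, tendsto_const_nhds⟩
  | succ n =>
    have := jostCoef_schwartz hu n
    exact ⟨this.1.tendsto_zero, by simpa using this.2.tendsto_zero⟩

/-- The truncated expansion of the Jost row, with its remainder. -/
theorem jost_eq_sum {u : ℝ → ℂ} (hu : HalfLineSchwartz u) (N : ℕ) {κ : ℝ} (hκ : 0 < κ) (j : Fin 2) :
    jost u (-Complex.I * κ) j = ∑ n ∈ Finset.range (N + 1), (κ : ℂ)⁻¹ ^ n *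
        ((jostCoef u n).1 0 * (1 : Mat2) 0 j + (jostCoef u n).2 0 * (1 : Mat2) 1 j) +
      ∫ x in Ioi (0 : ℝ),
        (κ : ℂ)⁻¹ ^ N * ((jostCoef u (N + 1)).1 x * wT u (-Complex.I * κ) x 0 j) := by
  set lam : ℂ := -Complex.I * κ with hlam
  have hl : lam.im ≤ 0 := by simp [hlam, hκ.le]
  have hk0 : (κ : ℂ) ≠ 0 := by exact_mod_cast hκ.ne'
  have hIl : Complex.I * lam = κ := by
    rw [hlam, ← mul_assoc, mul_neg, Complex.I_mul_I, neg_neg, one_mul]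
  have hc := hu.continuous
  set S : ℕ → ℝ → ℂ := fun N x => ∑ n ∈ Finset.range (N + 1), (κ : ℂ)⁻¹ ^ n *
    ((jostCoef u n).1 x * wT u lam x 0 j + (jostCoef u n).2 x * wT u lam x 1 j) with hS
  have hterm : ∀ n x, HasDerivAt (fun x => (κ : ℂ)⁻¹ ^ n *
      ((jostCoef u n).1 x * wT u lam x 0 j + (jostCoef u n).2 x * wT u lam x 1 j))
      ((κ : ℂ)⁻¹ ^ n * (((jostCoef u (n + 1)).1 x - κ * (jostCoef u n).1 x) * wT u lam x 0 j)) x :=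
    fun n x => by
      obtain ⟨m0, m1⟩ := wT_hasDerivAt hc lam x j
      obtain ⟨p, q⟩ := jostCoef_hasDerivAt hu n x
      rw [hIl] at m0
      refine (((p.mul m0).add (q.mul m1)).const_mul _).congr_deriv ?_
      ring
  -- The recursion for `jostCoef` is designed so that the term κ⁻ⁿ · κ p_n cancels the remainder
  -- κ⁻⁽ⁿ⁻¹⁾ p_n left by the preceding order.
  have hd : ∀ N x, HasDerivAt (S N)
      ((κ : ℂ)⁻¹ ^ N * ((jostCoef u (N + 1)).1 x * wT u lam x 0 j)) x := by
    intro N x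
    induction N with
    | zero =>
      have := hterm 0 x
      simpa [hS, jostCoef] using this
    | succ N ih =>
      have := ih.add (hterm (N + 1) x)
      simp only [hS] at this ⊢
      simp only [Finset.sum_range_succ _ (N + 1)]
      refine this.congr_deriv ?_
      rw [pow_succ]
      field_simp
      ring
  have hi : IntegrableOn (fun x => (κ : ℂ)⁻¹ ^ N * ((jostCoef u (N + 1)).1 x * wT u lam x 0 j))
      (Ioi 0) :=
    (integrableOn_mul_bdd measurableSet_Ioi (jostCoef_schwartz hu N).1.integrableOn
      (wT_continuous hc lam 0 j) (fun x hx => norm_wT_le hc hl (le_of_lt hx) 0 j)).const_mul _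
  -- At infinity all coefficients vanish except the second component of order 0, which is 1.
  have hlim : Tendsto (S N) atTop (𝓝 (jost u lam j)) := by
    have : jost u lam j = ∑ n ∈ Finset.range (N + 1), (κ : ℂ)⁻¹ ^ n *
        (0 + (if n = 0 then 1 else 0) * jost u lam j) := by
      simp
    rw [this]
    refine tendsto_finsetSum _ fun n _ => Tendsto.const_mul _ (Tendsto.add ?_ ?_)
    · refine squeeze_zero_norm' (a := fun x => ‖(jostCoef u n).1 x‖) ?_
        (tendsto_zero_iff_norm_tendsto_zero.1 (tendsto_jostCoef hu n).1)
      filter_upwards [eventually_ge_atTop 0] with x hx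
      rw [norm_mul]
      exact mul_le_of_le_one_right (norm_nonneg _) (norm_wT_le hc hl hx 0 j)
    · exact (tendsto_jostCoef hu n).2.mul (tendsto_jost hc hu.integrableOn hl j)
  rw [integral_Ioi_of_hasDerivAt_of_tendsto (hd N 0).continuousAt.continuousWithinAt
    (fun x _ => hd N x) hi hlim]
  simp only [hS, wT_zero]
  ring

/-- The expansion of the Jost row. -/
def jostSeries (u : ℝ → ℂ) (j : Fin 2) : PowerSeries ℂ :=
  PowerSeries.mk fun n => (jostCoef u n).1 0 * (1 : Mat2) 0 j + (jostCoef u n).2 0 * (1 : Mat2) 1 j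

theorem jost_hasSeries {u : ℝ → ℂ} (hu : HalfLineSchwartz u) (j : Fin 2) :
    HasSeries (fun κ => jost u (-Complex.I * κ) j) (jostSeries u j) := fun N => by
  refine ⟨PowerSeries.trunc (N + 1) (jostSeries u j), fun d hd => ?_, ?_⟩
  · rw [PowerSeries.coeff_trunc, if_pos (by omega)]
  · refine Asymptotics.IsBigO.of_bound (∫ x in Ioi (0 : ℝ), ‖(jostCoef u (N + 1)).1 x‖) ?_
    filter_upwards [eventually_gt_atTop 0] with κ hκ
    have h1 : (PowerSeries.trunc (N + 1) (jostSeries u j)).eval (κ : ℂ)⁻¹ =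
        ∑ n ∈ Finset.range (N + 1), (κ : ℂ)⁻¹ ^ n *
        ((jostCoef u n).1 0 * (1 : Mat2) 0 j + (jostCoef u n).2 0 * (1 : Mat2) 1 j) := by
      have := PowerSeries.eval₂_trunc_eq_sum_range (κ : ℂ)⁻¹ (RingHom.id ℂ) (N + 1) (jostSeries u j)
      rw [Polynomial.eval₂_id] at this
      rw [this]
      exact Finset.sum_congr rfl fun n _ => by simp [jostSeries, mul_comm]
    rw [h1, jost_eq_sum hu N hκ j, add_sub_cancel_left, integral_const_mul, norm_mul, mul_comm]
    refine mul_le_mul_of_nonneg_right ?_ (norm_nonneg _)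
    refine norm_integral_le_of_norm_le (jostCoef_schwartz hu N).1.integrableOn.norm
      ((ae_restrict_iff' measurableSet_Ioi).2 (Eventually.of_forall fun x hx => ?_))
    rw [norm_mul]
    exact mul_le_of_le_one_right (norm_nonneg _)
      (norm_wT_le hu.continuous (by simp [hκ.le]) (le_of_lt hx) 0 j)

/-- At λ = −iκ the quotient K/λ is the polynomial A + iBκ⁻¹ in κ⁻¹, so tr τ/λ is a finite sum of
products of three series. -/
theorem traceInf_hasExpansion {u uh : ℝ → ℂ} (hu : HalfLineSchwartz u) (huh : HalfLineSchwartz uh)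
    (A B : Mat2) : ∃ c, HasExpansion (fun lam => traceInf u uh (lam • A + B) lam) c := by
  have hK : ∀ a b, HasSeries
      (fun κ => ((-Complex.I * κ : ℂ) • A + B) a b / (-Complex.I * κ))
      ((Polynomial.C (A a b) + Polynomial.C (Complex.I * B a b) * Polynomial.X : Polynomial ℂ) :
        PowerSeries ℂ) := fun a b => by
    refine (HasSeries.of_polynomial _).congr ?_
    filter_upwards [eventually_gt_atTop 0] with κ hκ
    have hk0 : (κ : ℂ) ≠ 0 := by exact_mod_cast hκ.ne'
    have hI := Complex.I_ne_zero
    simp only [Polynomial.eval_add, Polynomial.eval_mul, Polynomial.eval_C, Polynomial.eval_X,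
      Matrix.add_apply, Matrix.smul_apply, smul_eq_mul]
    field_simp
    linear_combination (B a b) * Complex.I_sq
  have hs := fun a b => ((jost_hasSeries hu a).mul (hK a b)).mul (jost_hasSeries huh.cbar b)
  refine ⟨_, (((((hs 0 0).add (hs 0 1)).add (hs 1 0)).add (hs 1 1)).congr ?_).hasExpansion⟩
  filter_upwards [eventually_gt_atTop 0] with κ hκ
  rw [traceInf_eq hu.continuous hu.integrableOn huh.continuous huh.integrableOn _
    (by simpa using hκ)]
  simp only [Fin.sum_univ_two]
  ring

/-! ### Involution -/

/-- The stationary Lax equation `X' = [U(λ), X]`. -/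
def IsLax (u : ℝ → ℂ) (lam : ℂ) (X : ℝ → Mat2) : Prop :=
  ∀ y i j, HasDerivAt (fun y => X y i j) ((laxU u lam y * X y - X y * laxU u lam y) i j) y

theorem IsLax.continuous {u : ℝ → ℂ} {lam : ℂ} {X : ℝ → Mat2} (h : IsLax u lam X) (i j : Fin 2) :
    Continuous fun y => X y i j :=
  continuous_iff_continuousAt.2 fun y => (h y i j).continuousAt

theorem IsLax.transpose {u : ℝ → ℂ} {lam : ℂ} {X : ℝ → Mat2} (h : IsLax (cbar u) lam X) :
    IsLax u (-lam) fun y => (X y).transpose := fun y i j => by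
  refine (h y j i).congr_deriv ?_
  fin_cases i <;> fin_cases j <;>
  · simp only [Matrix.sub_apply, Matrix.transpose_apply,
      Matrix.mul_apply, Fin.sum_univ_two]
    simp [laxU, cbar]
    ring

/-- The two commutators combine to the trace of (U(λ) − U(μ))[X, Z]. The potential cancels in the
difference and a multiple of σ₃ is left, which selects off-diagonal entries. Divided by λ − μ, this
integrates the Poisson bracket density. -/
theorem IsLax.trace_mul_hasDerivAt {u : ℝ → ℂ} {lam mu : ℂ} {X Z : ℝ → Mat2} (hX : IsLax u lam X)
    (hZ : IsLax u mu Z) (y : ℝ) : HasDerivAt (fun y => (X y * Z y).trace)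
      (Complex.I * (lam - mu) * (X y 1 0 * Z y 0 1 - X y 0 1 * Z y 1 0)) y := by
  have h := fun i j => hasDerivAt_mul_apply (hX y) (hZ y) i j
  simp only [Matrix.trace, Matrix.diag, Fin.sum_univ_two]
  refine ((h 0 0).add (h 1 1)).congr_deriv ?_
  have hl : ∀ lam : ℂ, lam / (2 * Complex.I) = -(Complex.I * lam / 2) := fun lam => by
    field_simp; simp
  simp only [Matrix.sub_apply, Matrix.add_apply, 
    Matrix.mul_apply, Fin.sum_univ_two]
  simp [laxU, hl]
  ring

/-- Integration over `A`, a set of positive numbers that starts at `0` and ends at `l`. -/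
structure IsRange (A : Set ℝ) (l : Filter ℝ) : Prop where
  measurableSet : MeasurableSet A
  subset : A ⊆ Ioi 0
  integral_eq : ∀ Φ φ : ℝ → ℂ, (∀ y, HasDerivAt Φ (φ y) y) → IntegrableOn φ A →
    Tendsto Φ l (𝓝 0) → ∫ y in A, φ y = -Φ 0

theorem isRange_Ioc {L : ℝ} (hL : 0 < L) : IsRange (Ioc 0 L) (𝓝 L) where
  measurableSet := measurableSet_Ioc
  subset := fun _ hx => hx.1
  integral_eq := fun Φ φ hd hi ht => by
    rw [← intervalIntegral.integral_of_le hL.le,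
      intervalIntegral.integral_eq_sub_of_hasDerivAt (fun y _ => hd y)
        ((intervalIntegrable_iff_integrableOn_Ioc_of_le hL.le).2 hi),
      tendsto_nhds_unique (hd L).continuousAt ht, zero_sub]

theorem isRange_Ioi : IsRange (Ioi 0) atTop where
  measurableSet := measurableSet_Ioi
  subset := Subset.rfl
  integral_eq := fun Φ φ hd hi ht => by
    rw [integral_Ioi_of_hasDerivAt_of_tendsto (hd 0).continuousAt.continuousWithinAt
      (fun x _ => hd x) hi ht, zero_sub]

/-- Solutions of the scattering problem on `A`: `t` is a fundamental solution normalized at `0`,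
`R` its value at the end and `P` the propagator from `y` to the end. -/
structure Scattering (A : Set ℝ) (l : Filter ℝ) (lam : ℂ) where
  R : (ℝ → ℂ) → Mat2
  t : (ℝ → ℂ) → ℝ → Mat2
  P : (ℝ → ℂ) → ℝ → Mat2
  -- The scalar `c` is the rate removed by the weight: 0 on [0, L] and iλ/2 on the half-line. The
  -- matrix `proj` is the value of P at the far end: the identity, or the projection onto the second
  -- component when only the second row survives.
  c : ℂ
  proj : Mat2
  t_hasDerivAt : ∀ u, Continuous u → ∀ y i j,
    HasDerivAt (fun y => t u y i j) ((laxU u lam y * t u y - c • t u y) i j) y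
  P_hasDerivAt : ∀ u, Continuous u → ∀ y i j,
    HasDerivAt (fun y => P u y i j) ((c • P u y - P u y * laxU u lam y) i j) y
  t_zero : ∀ u, t u 0 = 1
  P_zero : ∀ u, Continuous u → P u 0 = R u
  t_tendsto : ∀ u, Continuous u → IntegrableOn u (Ioi 0) → ∀ i j,
    Tendsto (fun y => t u y i j) l (𝓝 (R u i j))
  P_tendsto : ∀ u, Continuous u → IntegrableOn u (Ioi 0) → ∀ i j,
    Tendsto (fun y => P u y i j) l (𝓝 (proj i j))
  R_proj : ∀ u, (R u).transpose * proj = (R u).transpose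
  t_bdd : ∀ u, Continuous u → IntegrableOn u (Ioi 0) → ∃ C, ∀ y ∈ A, ∀ i j, ‖t u y i j‖ ≤ C
  P_bdd : ∀ u, Continuous u → IntegrableOn u (Ioi 0) → ∃ C, ∀ y ∈ A, ∀ i j, ‖P u y i j‖ ≤ C
  t_memLp : ∀ u, Continuous u → IntegrableOn u (Ioi 0) → ∀ j,
    MemLp (fun y => t u y 0 j) 2 (volume.restrict A)
  P_memLp : ∀ u, Continuous u → IntegrableOn u (Ioi 0) → ∀ i,
    MemLp (fun y => P u y i 0) 2 (volume.restrict A)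
  R_hasDerivAt : ∀ (u : ℝ → ℝ → ℂ) (v : ℝ → ℂ) (s₀ : ℝ), DiffFamily u v s₀ → ∀ i j,
    HasDerivAt (fun s => R (u s) i j)
      (∫ y in A, (P (u s₀) y i 1 * v y * t (u s₀) y 0 j
        - P (u s₀) y i 0 * conj (v y) * t (u s₀) y 1 j)) s₀

theorem memLp_two_of_bdd {A : Set ℝ} (hA : MeasurableSet A) (hv : volume A ≠ ⊤) {f : ℝ → ℂ}
    (hf : Continuous f) {C : ℝ} (hC : ∀ y ∈ A, ‖f y‖ ≤ C) : MemLp f 2 (volume.restrict A) := by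
  have : IsFiniteMeasure (volume.restrict A) := ⟨by simpa using hv.lt_top⟩
  exact MemLp.of_bound hf.aestronglyMeasurable C
    ((ae_restrict_iff' hA).2 (Eventually.of_forall hC))

theorem memLp_two_of_normSq {A : Set ℝ} {f : ℝ → ℂ} (hf : Continuous f)
    (h : IntegrableOn (fun y => Complex.normSq (f y)) A) : MemLp f 2 (volume.restrict A) := by
  refine (memLp_two_iff_integrable_sq_norm hf.aestronglyMeasurable).2 ?_
  simp only [Complex.normSq_eq_norm_sq] at h
  exact h

/-- Scattering on `[0, L]`. -/
def finiteScattering (lam : ℂ) {L : ℝ} (hL : 0 < L) : Scattering (Ioc 0 L) (𝓝 L) lam where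
  R := fun u => transition u lam L
  t := fun u => transition u lam
  P := fun u => propagator u lam L
  c := 0
  proj := 1
  t_hasDerivAt := fun u hu y i j => by
    rw [zero_smul, sub_zero]; exact transition_hasDerivAt hu lam y i j
  P_hasDerivAt := fun u hu y i j => by
    rw [zero_smul, zero_sub]
    refine (hasDerivAt_mul_apply (A := fun _ => transition u lam L) (A' := 0) (x := y)
      (fun i j => hasDerivAt_const _ _) (transitionInv_hasDerivAt hu lam y) i j).congr_deriv ?_
    rw [propagator, zero_mul, zero_add, Matrix.mul_neg, Matrix.mul_assoc]
  t_zero := fun u => transition_zero u lam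
  P_zero := fun u _ => propagator_zero_right u lam L
  t_tendsto := fun u hu _ i j => (transition_continuous hu lam i j).tendsto L
  P_tendsto := fun u hu _ i j => by
    have := (propagator_continuous_right hu lam L i j).tendsto L
    rwa [propagator_self hu] at this
  R_proj := fun u => mul_one _
  t_bdd := fun u hu _ => ⟨Real.exp (|lam.im| * L / 2), fun y hy i j =>
    (norm_transition_le hu lam hy.1.le i j).trans (Real.exp_le_exp.2 (by
      have := abs_nonneg lam.im; nlinarith [hy.2]))⟩
  P_bdd := fun u hu _ => ⟨Real.exp (|lam.im| * L / 2), fun y hy i j =>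
    (norm_propagator_le hu lam hy.2 i j).trans (Real.exp_le_exp.2 (by
      have := abs_nonneg lam.im; nlinarith [hy.1]))⟩
  t_memLp := fun u hu _ j => memLp_two_of_bdd measurableSet_Ioc (by simp)
    (transition_continuous hu lam 0 j) (C := Real.exp (|lam.im| * L / 2)) fun y hy =>
    (norm_transition_le hu lam hy.1.le 0 j).trans (Real.exp_le_exp.2 (by
      have := abs_nonneg lam.im; nlinarith [hy.2]))
  P_memLp := fun u hu _ i => memLp_two_of_bdd measurableSet_Ioc (by simp)
    (propagator_continuous_right hu lam L i 0) (C := Real.exp (|lam.im| * L / 2)) fun y hy =>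
    (norm_propagator_le hu lam hy.2 i 0).trans (Real.exp_le_exp.2 (by
      have := abs_nonneg lam.im; nlinarith [hy.1]))
  R_hasDerivAt := fun u v s₀ h i j => h.transition_hasDerivAt lam hL.le i j

/-- Scattering on the half-line. -/
def infiniteScattering {lam : ℂ} (hl : lam.im < 0) : Scattering (Ioi 0) atTop lam where
  R := fun u => !![0, 0; jost u lam 0, jost u lam 1]
  t := fun u => wT u lam
  P := fun u y => !![0, 0; jostSol u lam y 0, jostSol u lam y 1]
  c := Complex.I * lam / 2
  proj := !![0, 0; 0, 1]
  t_hasDerivAt := fun u hu y i j => by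
    have hc : lam / (2 * Complex.I) = -(Complex.I * lam / 2) := by field_simp; simp
    obtain ⟨h0, h1⟩ := wT_hasDerivAt hu lam y j
    fin_cases i
    · refine h0.congr_deriv ?_
      simp only [Matrix.sub_apply, Matrix.smul_apply, 
        Matrix.mul_apply, Fin.sum_univ_two]
      simp [laxU, hc]; ring
    · refine h1.congr_deriv ?_
      simp only [Matrix.sub_apply, Matrix.smul_apply, 
        Matrix.mul_apply, Fin.sum_univ_two]
      simp [laxU, hc]
  P_hasDerivAt := fun u hu y i j => by
    have hc : lam / (2 * Complex.I) = -(Complex.I * lam / 2) := by field_simp; simp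
    obtain ⟨h0, h1⟩ := jostSol_hasDerivAt hu lam y
    fin_cases i <;> fin_cases j
    · refine (hasDerivAt_const y (0 : ℂ)).congr_deriv ?_
      simp only [Matrix.sub_apply, Matrix.smul_apply, Matrix.mul_apply, Fin.sum_univ_two]
      simp
    · refine (hasDerivAt_const y (0 : ℂ)).congr_deriv ?_
      simp only [Matrix.sub_apply, Matrix.smul_apply, Matrix.mul_apply, Fin.sum_univ_two]
      simp
    · refine h0.congr_deriv ?_
      simp only [Matrix.sub_apply, Matrix.smul_apply, 
        Matrix.mul_apply, Fin.sum_univ_two]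
      simp [laxU, hc]; ring
    · refine h1.congr_deriv ?_
      simp only [Matrix.sub_apply, Matrix.smul_apply, 
        Matrix.mul_apply, Fin.sum_univ_two]
      simp [laxU, hc]; ring
  t_zero := fun u => wT_zero u lam
  P_zero := fun u _ => by simp only [jostSol_zero]
  t_tendsto := fun u hu hi i j => by
    fin_cases i
    · have := tendsto_wT_zero_row hu hi hl j
      fin_cases j <;> simpa using this
    · have := tendsto_jost hu hi hl.le j
      fin_cases j <;> simpa using this
  P_tendsto := fun u hu hi i j => by
    have := tendsto_jostSol_atTop hu hi hl.le j
    fin_cases i <;> fin_cases j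
    · exact tendsto_const_nhds
    · exact tendsto_const_nhds
    · simpa using this
    · simpa [Matrix.one_apply] using this
  R_proj := fun u => by
    ext i j
    fin_cases i <;> fin_cases j <;> simp [Matrix.mul_apply, Fin.sum_univ_two]
  t_bdd := fun u hu _ => ⟨1, fun y hy i j => norm_wT_le hu hl.le (le_of_lt hy) i j⟩
  P_bdd := fun u hu hi => ⟨1, fun y hy i j => by
    have := norm_jostSol_le hu hi hl.le y
    fin_cases i <;> fin_cases j <;> simp [this]⟩
  t_memLp := fun u hu _ j => memLp_two_of_normSq (wT_continuous hu lam 0 j)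
    (wT_zero_row_sq_integrable hu hl j)
  P_memLp := fun u hu hi i => by
    fin_cases i
    · exact MemLp.zero' (ε := ℂ)
    · exact memLp_two_of_normSq (jostSol_continuous hu lam 0) (jostSol_zero_sq_integrable hu hi hl)
  R_hasDerivAt := fun u v s₀ h i j => by
    fin_cases i
    · have := hasDerivAt_const s₀ (0 : ℂ)
      fin_cases j <;> simpa using this
    · have := h.jost_hasDerivAt hl.le j
      fin_cases j <;> exact this

namespace Scattering

variable {A : Set ℝ} {l : Filter ℝ} {lam : ℂ} (S : Scattering A l lam) {p q : ℝ → ℂ}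

/-- The kernel of the variation of `tr (R(p) K R(q)ᵀ)` with respect to `p`. -/
def kernel (p q : ℝ → ℂ) (K : Mat2) (y : ℝ) : Mat2 :=
  S.t p y * (K * (S.R q).transpose) * S.P p y

theorem t_continuous (hp : Continuous p) (i j : Fin 2) : Continuous fun y => S.t p y i j :=
  continuous_iff_continuousAt.2 fun y => (S.t_hasDerivAt p hp y i j).continuousAt

theorem P_continuous (hp : Continuous p) (i j : Fin 2) : Continuous fun y => S.P p y i j :=
  continuous_iff_continuousAt.2 fun y => (S.P_hasDerivAt p hp y i j).continuousAt

/-- The factor t satisfies the equation from the left and P from the right, with opposite scalars c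
that cancel. -/
theorem kernel_isLax (hp : Continuous p) (q : ℝ → ℂ) (K : Mat2) :
    IsLax p lam (S.kernel p q K) := fun y i j => by
  have h1 := hasDerivAt_mul_apply (S.t_hasDerivAt p hp y)
    (B := fun _ => K * (S.R q).transpose) (B' := 0) (fun i j => hasDerivAt_const _ _)
  refine (hasDerivAt_mul_apply h1 (S.P_hasDerivAt p hp y) i j).congr_deriv ?_
  refine congrFun (congrFun (?_ : (_ : Mat2) = _) i) j
  simp only [kernel, mul_zero, add_zero, Matrix.sub_mul, Matrix.mul_sub, Matrix.smul_mul,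
    Matrix.mul_smul, Matrix.mul_assoc]
  abel

theorem kernel_zero (hp : Continuous p) (q : ℝ → ℂ) (K : Mat2) :
    S.kernel p q K 0 = K * ((S.R q).transpose * S.R p) := by
  rw [kernel, S.t_zero, S.P_zero p hp, one_mul, Matrix.mul_assoc]

theorem kernel_tendsto (hp : Continuous p) (hi : IntegrableOn p (Ioi 0)) (q : ℝ → ℂ) (K : Mat2)
    (i j : Fin 2) : Tendsto (fun y => S.kernel p q K y i j) l
      (𝓝 ((S.R p * K * (S.R q).transpose) i j)) := by
  have : S.R p * K * (S.R q).transpose = S.R p * (K * (S.R q).transpose) * S.proj := by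
    rw [Matrix.mul_assoc, Matrix.mul_assoc, Matrix.mul_assoc, S.R_proj]
  rw [this]
  have ht := S.t_tendsto p hp hi
  have hP := S.P_tendsto p hp hi
  simp only [kernel, Matrix.mul_apply (M := S.t p _ * _), Matrix.mul_apply (M := S.R p * _),
    Matrix.mul_apply (M := S.t p _), Matrix.mul_apply (M := S.R p)]
  exact tendsto_finsetSum _ fun b _ => (tendsto_finsetSum _ fun a _ =>
    (ht i a).mul_const _).mul (hP b j)

theorem kernel_apply (p q : ℝ → ℂ) (K : Mat2) (y : ℝ) (i j : Fin 2) :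
    S.kernel p q K y i j =
      ∑ b, ∑ a, (K * (S.R q).transpose) a b * (S.t p y i a * S.P p y b j) := by
  rw [kernel, Matrix.mul_apply]
  refine Finset.sum_congr rfl fun b _ => ?_
  rw [Matrix.mul_apply, Finset.sum_mul]
  exact Finset.sum_congr rfl fun a _ => by ring

/-- Square integrability is available for the first row of t and the first column of P only. The
(0,1) entry contains the former and the (1,0) entry the latter; the remaining factor is bounded. -/
theorem kernel_memLp (hA : MeasurableSet A) (hp : Continuous p) (hi : IntegrableOn p (Ioi 0))
    (q : ℝ → ℂ) (K : Mat2) : MemLp (fun y => S.kernel p q K y 0 1) 2 (volume.restrict A) ∧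
      MemLp (fun y => S.kernel p q K y 1 0) 2 (volume.restrict A) := by
  obtain ⟨C, hC⟩ := S.t_bdd p hp hi
  obtain ⟨D, hD⟩ := S.P_bdd p hp hi
  simp only [kernel_apply]
  constructor
  · refine memLp_finsetSum _ fun b _ => memLp_finsetSum _ fun a _ => MemLp.const_mul ?_ _
    refine (S.t_memLp p hp hi a).of_le_mul (c := D)
      ((S.t_continuous hp 0 a).mul (S.P_continuous hp b 1)).aestronglyMeasurable
      ((ae_restrict_iff' hA).2 (Eventually.of_forall fun y hy => ?_))
    rw [norm_mul, mul_comm]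
    exact mul_le_mul_of_nonneg_right (hD y hy b 1) (norm_nonneg _)
  · refine memLp_finsetSum _ fun b _ => memLp_finsetSum _ fun a _ => MemLp.const_mul ?_ _
    refine (S.P_memLp p hp hi b).of_le_mul (c := C)
      ((S.t_continuous hp 1 a).mul (S.P_continuous hp b 0)).aestronglyMeasurable
      ((ae_restrict_iff' hA).2 (Eventually.of_forall fun y hy => ?_))
    rw [norm_mul]
    exact mul_le_mul_of_nonneg_right (hC y hy 1 a) (norm_nonneg _)

theorem kernel_bdd (hp : Continuous p) (hi : IntegrableOn p (Ioi 0)) (q : ℝ → ℂ) (K : Mat2)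
    (i j : Fin 2) : ∃ C, ∀ y ∈ A, ‖S.kernel p q K y i j‖ ≤ C := by
  obtain ⟨C, hC⟩ := S.t_bdd p hp hi
  obtain ⟨D, hD⟩ := S.P_bdd p hp hi
  refine ⟨∑ b, ∑ a, ‖(K * (S.R q).transpose) a b‖ * (C * D), fun y hy => ?_⟩
  rw [kernel_apply]
  refine norm_sum_le_of_le _ fun b _ => norm_sum_le_of_le _ fun a _ => ?_
  rw [norm_mul, norm_mul]
  refine mul_le_mul_of_nonneg_left ?_ (norm_nonneg _)
  exact mul_le_mul (hC y hy i a) (hD y hy b j) (norm_nonneg _)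
    ((norm_nonneg _).trans (hC y hy i a))

theorem mul_kernel_integrableOn (hA : IsRange A l) (hp : Continuous p)
    (hi : IntegrableOn p (Ioi 0)) (q : ℝ → ℂ) (K : Mat2) {v : ℝ → ℂ}
    (hv : IntegrableOn v (Ioi 0)) (i j : Fin 2) :
    IntegrableOn (fun y => v y * S.kernel p q K y i j) A := by
  obtain ⟨C, hC⟩ := S.kernel_bdd hp hi q K i j
  exact integrableOn_mul_bdd hA.measurableSet (hv.mono_set hA.subset)
    ((S.kernel_isLax hp q K).continuous i j) hC

/-- The first variation of `R(p)`, contracted with a constant matrix. -/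
theorem sum_variation (hA : IsRange A l) (hp : Continuous p) (hi : IntegrableOn p (Ioi 0))
    (q : ℝ → ℂ) (K : Mat2) {v : ℝ → ℂ} (hv : IntegrableOn v (Ioi 0)) :
    ∑ i, ∑ a, (K * (S.R q).transpose) a i * ∫ y in A, (S.P p y i 1 * v y * S.t p y 0 a
        - S.P p y i 0 * conj (v y) * S.t p y 1 a) =
      ∫ y in A, (v y * S.kernel p q K y 0 1 - conj (v y) * S.kernel p q K y 1 0) := by
  obtain ⟨C, hC⟩ := S.t_bdd p hp hi
  obtain ⟨D, hD⟩ := S.P_bdd p hp hi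
  have hb : ∀ (v : ℝ → ℂ), IntegrableOn v (Ioi 0) → ∀ i b a j,
      IntegrableOn (fun y => v y * (S.P p y b j * S.t p y i a)) A := fun v hv i b a j =>
    integrableOn_mul_bdd hA.measurableSet (hv.mono_set hA.subset)
      ((S.P_continuous hp b j).mul (S.t_continuous hp i a)) (C := D * C) fun y hy => by
        rw [norm_mul]
        exact mul_le_mul (hD y hy b j) (hC y hy i a) (norm_nonneg _)
          ((norm_nonneg _).trans (hD y hy b j))
  have hint : ∀ i a, IntegrableOn (fun y => S.P p y i 1 * v y * S.t p y 0 a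
      - S.P p y i 0 * conj (v y) * S.t p y 1 a) A := fun i a => by
    refine ((hb v hv 0 i a 1).sub (hb (cbar v) (cbar_integrableOn hv) 1 i a 0)).congr_fun
      (fun y _ => ?_) hA.measurableSet
    simp only [Pi.sub_apply, cbar]; ring
  set M := K * (S.R q).transpose with hM
  have inner : ∀ i, ∑ a, M a i * ∫ y in A, (S.P p y i 1 * v y * S.t p y 0 a
      - S.P p y i 0 * conj (v y) * S.t p y 1 a) = ∫ y in A, ∑ a, M a i *
        (S.P p y i 1 * v y * S.t p y 0 a - S.P p y i 0 * conj (v y) * S.t p y 1 a) := fun i => by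
    rw [integral_finsetSum _ fun a _ => (hint i a).const_mul _]
    simp only [integral_const_mul]
  simp only [inner]
  rw [← integral_finsetSum _ fun i _ => integrable_finsetSum _ fun a _ => (hint i a).const_mul _]
  refine integral_congr_ae (Eventually.of_forall fun y => ?_)
  simp only [kernel_apply, ← hM, Fin.sum_univ_two]
  ring

end Scattering

theorem tendsto_trace_mul {l : Filter ℝ} {X Z : ℝ → Mat2} {E F : Mat2}
    (hX : ∀ i j, Tendsto (fun y => X y i j) l (𝓝 (E i j)))
    (hZ : ∀ i j, Tendsto (fun y => Z y i j) l (𝓝 (F i j))) :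
    Tendsto (fun y => (X y * Z y).trace) l (𝓝 (E * F).trace) := by
  simp only [Matrix.trace, Matrix.diag, Matrix.mul_apply]
  exact tendsto_finsetSum _ fun i _ => tendsto_finsetSum _ fun j _ => (hX i j).mul (hZ j i)

theorem DiffFamily.line {u v : ℝ → ℂ} (hu : HalfLineSchwartz u) (hv : HalfLineSchwartz v) :
    DiffFamily (fun r x => u x + r * v x) v 0 where
  cont := Eventually.of_forall fun r => hu.continuous.add (continuous_const.mul hv.continuous)
  int := Eventually.of_forall fun r => hu.integrableOn.add (hv.integrableOn.const_mul _)
  vcont := hv.continuous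
  vint := hv.integrableOn
  deriv := fun y _ => hasDerivAt_line (u y) (v y)
  dom := ⟨fun y => ‖v y‖, hv.integrableOn.norm, Eventually.of_forall fun s y _ => by
    simp [mul_comm]⟩

theorem setIntegral_indicator_eq {A : Set ℝ} {l : Filter ℝ} (hA : IsRange A l) (f : ℝ → ℂ) :
    ∫ x in Ioi (0 : ℝ), A.indicator f x = ∫ x in A, f x := by
  rw [setIntegral_indicator hA.measurableSet, inter_eq_self_of_subset_right hA.subset]

theorem memLp_indicator_Ioi {A : Set ℝ} {l : Filter ℝ} (hA : IsRange A l) {f : ℝ → ℂ}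
    (h : MemLp f 2 (volume.restrict A)) : MemLp (A.indicator f) 2 (volume.restrict (Ioi 0)) := by
  rw [memLp_indicator_iff_restrict hA.measurableSet, Measure.restrict_restrict hA.measurableSet,
    inter_eq_self_of_subset_left hA.subset]
  exact h

theorem HasGradient.congr {m : ℕ} {F F' : PhasePoint m → ℂ} {s : PhasePoint m} {g : Gradient m}
    (h : HasGradient F s g) (hs : ∀ i, HalfLineSchwartz (s.1 i))
    (e : ∀ p : PhasePoint m, (∀ i, HalfLineSchwartz (p.1 i)) → F p = F' p) :
    HasGradient F' s g := by
  refine ⟨h.1, h.2.1, fun v w hv => ?_⟩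
  refine (h.2.2 v w hv).congr_of_eventuallyEq (Eventually.of_forall fun r => (e _ fun i => ?_).symm)
  exact (hs i).add ((hv i).const_mul _)

theorem gradBracket_self {m : ℕ} (θ : ℂ) (g : Gradient m) : gradBracket θ g g = 0 := by
  have : ∀ i x, g.du i x * g.dub i x - g.dub i x * g.du i x = 0 := fun i x => by ring
  simp only [gradBracket, this]
  simp
  right; ring

/-- The opposite gradient. -/
def Gradient.opp {m : ℕ} (g : Gradient m) : Gradient m :=
  ⟨fun i x => -g.du i x, fun i x => -g.dub i x, -g.dz, -g.dzb⟩

theorem HasGradient.opp {m : ℕ} {F : PhasePoint m → ℂ} {s : PhasePoint m} {g : Gradient m}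
    (h : HasGradient F s g) : HasGradient (fun p => -F p) s g.opp := by
  refine ⟨fun i => (h.1 i).neg, fun i => (h.2.1 i).neg, fun v w hv => ?_⟩
  refine (h.2.2 v w hv).neg.congr_deriv ?_
  have : ∀ i x, -g.du i x * v i x + -g.dub i x * conj (v i x) =
      -(g.du i x * v i x + g.dub i x * conj (v i x)) := fun i x => by ring
  simp only [Gradient.opp, this, integral_neg, Finset.sum_neg_distrib]
  ring

theorem gradBracket_opp {m : ℕ} (θ : ℂ) (g : Gradient m) : gradBracket θ g g.opp = 0 := by
  have : ∀ i x, g.du i x * -g.dub i x - g.dub i x * -g.du i x = 0 := fun i x => by ring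
  simp only [gradBracket, Gradient.opp, this]
  simp
  right; ring

namespace Scattering

variable {A : Set ℝ} {l : Filter ℝ} {lam mu : ℂ} (S : Scattering A l lam) (S' : Scattering A l mu)
  {p q : ℝ → ℂ}

/-- The first variation of the trace of the monodromy matrix. -/
theorem trace_hasDerivAt (hA : IsRange A l) {pr qr : ℝ → ℝ → ℂ} {v w : ℝ → ℂ} {s₀ : ℝ}
    (hp : DiffFamily pr v s₀) (hq : DiffFamily qr w s₀) (hp0 : pr s₀ = p) (hq0 : qr s₀ = q)
    {K : ℝ → Mat2} {K₀ K' : Mat2} (hK0 : K s₀ = K₀)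
    (hK : ∀ i j, HasDerivAt (fun r => K r i j) (K' i j) s₀) :
    HasDerivAt (fun r => (S.R (pr r) * K r * (S.R (qr r)).transpose).trace)
      ((∫ y in A, (v y * S.kernel p q K₀ y 0 1 - conj (v y) * S.kernel p q K₀ y 1 0))
        + (∫ y in A, (w y * S.kernel q p K₀.transpose y 0 1
            - conj (w y) * S.kernel q p K₀.transpose y 1 0))
        + (K' * ((S.R q).transpose * S.R p)).trace) s₀ := by
  have hpc := hp.cont.self_of_nhds
  have hqc := hq.cont.self_of_nhds
  have hpi := hp.int.self_of_nhds
  have hqi := hq.int.self_of_nhds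
  have dp := S.R_hasDerivAt pr v s₀ hp
  have dq := S.R_hasDerivAt qr w s₀ hq
  rw [hp0] at dp hpc hpi
  rw [hq0] at dq hqc hqi
  rw [← S.sum_variation hA hpc hpi q K₀ hp.vint, ← S.sum_variation hA hqc hqi p K₀.transpose hq.vint]
  set A' : Mat2 := Matrix.of fun i j => ∫ y in A, (S.P p y i 1 * v y * S.t p y 0 j
        - S.P p y i 0 * conj (v y) * S.t p y 1 j) with hA'
  set B' : Mat2 := Matrix.of fun i j => ∫ y in A, (S.P q y i 1 * w y * S.t q y 0 j
        - S.P q y i 0 * conj (w y) * S.t q y 1 j) with hB'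
  have eA : ∀ i j, ∫ y in A, (S.P p y i 1 * v y * S.t p y 0 j
        - S.P p y i 0 * conj (v y) * S.t p y 1 j) = A' i j := fun i j => rfl
  have eB : ∀ i j, ∫ y in A, (S.P q y i 1 * w y * S.t q y 0 j
        - S.P q y i 0 * conj (w y) * S.t q y 1 j) = B' i j := fun i j => rfl
  simp only [eA] at dp
  simp only [eB] at dq
  simp only [eA, eB]
  clear_value A' B'
  have h1 := hasDerivAt_mul_apply dp hK
  have h2 := hasDerivAt_mul_apply h1 (B := fun r => (S.R (qr r)).transpose)
    (B' := B'.transpose) (fun i j => dq j i)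
  simp only [hp0, hq0, hK0] at h2
  simp only [Matrix.trace, Matrix.diag]
  refine (HasDerivAt.fun_sum fun i _ => h2 i i).congr_deriv ?_
  simp only [Matrix.add_apply, Matrix.mul_apply, Matrix.transpose_apply, Fin.sum_univ_two]
  ring

/-- At the far end the kernel of q becomes the transpose of the kernel of p. This is what cancels
the boundary terms there. -/
theorem kernel_swap_tendsto (hq : Continuous q) (hi : IntegrableOn q (Ioi 0)) (p : ℝ → ℂ) (K : Mat2)
    (i j : Fin 2) : Tendsto (fun y => S.kernel q p K.transpose y i j) l
      (𝓝 ((S.R p * K * (S.R q).transpose).transpose i j)) := by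
  have := S.kernel_tendsto hq hi p K.transpose i j
  rwa [show S.R q * K.transpose * (S.R p).transpose =
    (S.R p * K * (S.R q).transpose).transpose by
      simp only [Matrix.transpose_mul, Matrix.transpose_transpose, Matrix.mul_assoc]] at this

theorem kernel_swap_zero (hq : Continuous q) (p : ℝ → ℂ) (K : Mat2) :
    S.kernel q p K.transpose 0 =
      K.transpose * ((S.R q).transpose * S.R p).transpose := by
  rw [S.kernel_zero hq, Matrix.transpose_mul, Matrix.transpose_transpose]

/-- The functional gradient, even order. -/
def evenGrad (β : ℝ) (s : PhasePoint 1) : Gradient 1 where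
  du := fun _ => A.indicator fun y =>
    S.kernel (s.1 0) (cbar (s.1 0)) (evenK β s.2 lam) y 0 1
      - S.kernel (cbar (s.1 0)) (s.1 0) (evenK β s.2 lam).transpose y 1 0
  dub := fun _ => A.indicator fun y =>
    S.kernel (cbar (s.1 0)) (s.1 0) (evenK β s.2 lam).transpose y 0 1
      - S.kernel (s.1 0) (cbar (s.1 0)) (evenK β s.2 lam) y 1 0
  dz := (evenKz β s.2 * ((S.R (cbar (s.1 0))).transpose * S.R (s.1 0))).trace
  dzb := (evenKzb β s.2 * ((S.R (cbar (s.1 0))).transpose * S.R (s.1 0))).trace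

/-- The functional gradient, odd order. -/
def oddGrad (β ε : ℝ) (s : PhasePoint 2) : Gradient 2 where
  du := ![A.indicator fun y => S.kernel (s.1 0) (cbar (s.1 1)) (oddKw β ε s.2 lam) y 0 1,
    A.indicator fun y => -S.kernel (cbar (s.1 1)) (s.1 0) (oddKw β ε s.2 lam).transpose y 1 0]
  dub := ![A.indicator fun y => -S.kernel (s.1 0) (cbar (s.1 1)) (oddKw β ε s.2 lam) y 1 0,
    A.indicator fun y => S.kernel (cbar (s.1 1)) (s.1 0) (oddKw β ε s.2 lam).transpose y 0 1]
  dz := (oddKz β ε s.2 * ((S.R (cbar (s.1 1))).transpose * S.R (s.1 0))).trace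
  dzb := (oddKzb β ε s.2 * ((S.R (cbar (s.1 1))).transpose * S.R (s.1 0))).trace

theorem trace_wirtinger (Z Zb G : Mat2) (w : ℂ) :
    ((Matrix.of fun i j => Z i j * w + Zb i j * conj w : Mat2) * G).trace =
      (Z * G).trace * w + (Zb * G).trace * conj w := by
  simp only [Matrix.trace, Matrix.diag, Matrix.mul_apply, Matrix.of_apply, Fin.sum_univ_two]
  ring

/-- The field enters both factors of the monodromy matrix, as u and as ū. The variation of the
second factor is that of ū, so its entries appear with the roles of δ/δu and δ/δū exchanged. -/
theorem hasGradient_even (hA : IsRange A l) {β : ℝ} {s : PhasePoint 1}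
    (hs : s ∈ phaseSpace 1 (evenDisc β)) :
    HasGradient (fun p : PhasePoint 1 =>
      (S.R (p.1 0) * evenK β p.2 lam * (S.R (cbar (p.1 0))).transpose).trace) s (S.evenGrad β s) := by
  have hu := hs.1 0
  have hc := hu.continuous
  have hi := hu.integrableOn
  have hqc := hu.cbar.continuous
  have hqi := hu.cbar.integrableOn
  obtain ⟨x01, x10⟩ := S.kernel_memLp hA.measurableSet hc hi (cbar (s.1 0)) (evenK β s.2 lam)
  obtain ⟨y01, y10⟩ := S.kernel_memLp hA.measurableSet hqc hqi (s.1 0) (evenK β s.2 lam).transpose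
  refine ⟨fun i => memLp_indicator_Ioi hA (x01.sub y10), fun i => memLp_indicator_Ioi hA (y01.sub x10),
    fun v w hv => ?_⟩
  have hl := DiffFamily.line hu (hv 0)
  have h := S.trace_hasDerivAt hA hl hl.cbar (p := s.1 0) (q := cbar (s.1 0)) (by simp) (by simp)
    (K := fun r : ℝ => evenK β (s.2 + r * w) lam) (K₀ := evenK β s.2 lam)
    (K' := Matrix.of fun i j => evenKz β s.2 i j * w + evenKzb β s.2 i j * conj w) (by simp)
    fun i j => evenK_hasDerivAt hs.2 lam i j w
  refine h.congr_deriv ?_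
  rw [trace_wirtinger]
  have i1 := fun i j => S.mul_kernel_integrableOn hA hc hi (cbar (s.1 0)) (evenK β s.2 lam)
    (hv 0).integrableOn i j
  have i2 := fun i j => S.mul_kernel_integrableOn hA hc hi (cbar (s.1 0)) (evenK β s.2 lam)
    (hv 0).cbar.integrableOn i j
  have i3 := fun i j => S.mul_kernel_integrableOn hA hqc hqi (s.1 0) (evenK β s.2 lam).transpose
    (hv 0).integrableOn i j
  have i4 := fun i j => S.mul_kernel_integrableOn hA hqc hqi (s.1 0) (evenK β s.2 lam).transpose
    (hv 0).cbar.integrableOn i j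
  simp only [cbar] at i2 i4
  rw [Finset.univ_unique, Finset.sum_singleton, ← add_assoc]
  congr 2
  simp only [cbar, Complex.conj_conj]
  refine (integral_add ((i1 0 1).sub (i2 1 0)) ((i4 0 1).sub (i3 1 0))).symm.trans ?_
  rw [← setIntegral_indicator_eq hA]
  refine integral_congr_ae (Eventually.of_forall fun y => ?_)
  by_cases hy : y ∈ A
  · simp only [evenGrad, indicator_of_mem hy, Pi.sub_apply]
    simp only [Fin.default_eq_zero]
    change _ = (S.kernel (s.1 0) (cbar (s.1 0)) _ y 0 1 - S.kernel (cbar (s.1 0)) (s.1 0) _ y 1 0) *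
      v 0 y + (S.kernel (cbar (s.1 0)) (s.1 0) _ y 0 1 - S.kernel (s.1 0) (cbar (s.1 0)) _ y 1 0) *
      conj (v 0 y)
    ring_nf
  · simp [evenGrad, hy]

theorem hasGradient_odd (hA : IsRange A l) {β ε : ℝ} {s : PhasePoint 2}
    (hs : s ∈ phaseSpace 2 (oddDisc β)) :
    HasGradient (fun p : PhasePoint 2 =>
      (S.R (p.1 0) * oddKw β ε p.2 lam * (S.R (cbar (p.1 1))).transpose).trace) s
      (S.oddGrad β ε s) := by
  have hu := hs.1 0
  have hc := hu.continuous
  have hi := hu.integrableOn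
  have hqc := (hs.1 1).cbar.continuous
  have hqi := (hs.1 1).cbar.integrableOn
  obtain ⟨x01, x10⟩ := S.kernel_memLp hA.measurableSet hc hi (cbar (s.1 1)) (oddKw β ε s.2 lam)
  obtain ⟨y01, y10⟩ := S.kernel_memLp hA.measurableSet hqc hqi (s.1 0) (oddKw β ε s.2 lam).transpose
  refine ⟨fun i => ?_, fun i => ?_, fun v w hv => ?_⟩
  · fin_cases i
    · exact memLp_indicator_Ioi hA x01
    · exact memLp_indicator_Ioi hA y10.neg
  · fin_cases i
    · exact memLp_indicator_Ioi hA x10.neg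
    · exact memLp_indicator_Ioi hA y01
  have h := S.trace_hasDerivAt hA (DiffFamily.line hu (hv 0)) (DiffFamily.line (hs.1 1) (hv 1)).cbar
    (p := s.1 0) (q := cbar (s.1 1)) (by simp) (by simp)
    (K := fun r : ℝ => oddKw β ε (s.2 + r * w) lam) (K₀ := oddKw β ε s.2 lam)
    (K' := Matrix.of fun i j => oddKz β ε s.2 i j * w + oddKzb β ε s.2 i j * conj w) (by simp)
    fun i j => oddKw_hasDerivAt hs.2 lam i j w
  refine h.congr_deriv ?_
  rw [trace_wirtinger, Fin.sum_univ_two, ← add_assoc]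
  congr 3
  · rw [← setIntegral_indicator_eq hA]
    refine integral_congr_ae (Eventually.of_forall fun y => ?_)
    by_cases hy : y ∈ A
    · simp only [oddGrad, Matrix.cons_val_zero, indicator_of_mem hy]
      ring
    · simp [oddGrad, hy]
  · rw [← setIntegral_indicator_eq hA]
    refine integral_congr_ae (Eventually.of_forall fun y => ?_)
    by_cases hy : y ∈ A
    · simp only [oddGrad, Matrix.cons_val_one, Matrix.cons_val_zero, indicator_of_mem hy]
      simp only [cbar, Complex.conj_conj]
      ring_nf
    · simp [oddGrad, hy]

/-- The field part of the bracket is integrated to minus a primitive at x = 0, where the kernels are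
KG and KᵀGᵀ. There it cancels the bracket of the boundary variable, which `even_algebra` expresses
through K. -/
theorem even_gradBracket_eq_zero (hA : IsRange A l) {β : ℝ} {s : PhasePoint 1}
    (hs : s ∈ phaseSpace 1 (evenDisc β)) (h1 : lam ≠ mu) (h2 : lam ≠ -mu) :
    gradBracket (-Complex.I * Omega1 β s.2) (S.evenGrad β s) (S'.evenGrad β s) = 0 := by
  have hc := (hs.1 0).continuous
  have hi := (hs.1 0).integrableOn
  have hqc := (hs.1 0).cbar.continuous
  have hqi := (hs.1 0).cbar.integrableOn
  have h1' : lam - mu ≠ 0 := sub_ne_zero.2 h1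
  have h2' : lam + mu ≠ 0 := fun h => h2 (eq_neg_of_add_eq_zero_left h)
  have alg := even_algebra hs.2 h1 h2
  set u := s.1 0
  set K := evenK β s.2 lam
  set K' := evenK β s.2 mu
  set G := (S.R (cbar u)).transpose * S.R u with hG
  set G' := (S'.R (cbar u)).transpose * S'.R u with hG'
  set X := S.kernel u (cbar u) K with hX
  set Y := S.kernel (cbar u) u K.transpose with hY
  set X' := S'.kernel u (cbar u) K' with hX'
  set Y' := S'.kernel (cbar u) u K'.transpose with hY'
  have lX : IsLax u lam X := S.kernel_isLax hc _ _
  have lY : IsLax (cbar u) lam Y := S.kernel_isLax hqc _ _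
  have lX' : IsLax u mu X' := S'.kernel_isLax hc _ _
  have lY' : IsLax (cbar u) mu Y' := S'.kernel_isLax hqc _ _
  obtain ⟨x01, x10⟩ := S.kernel_memLp hA.measurableSet hc hi (cbar u) K
  obtain ⟨y01, y10⟩ := S.kernel_memLp hA.measurableSet hqc hqi u K.transpose
  obtain ⟨x01', x10'⟩ := S'.kernel_memLp hA.measurableSet hc hi (cbar u) K'
  obtain ⟨y01', y10'⟩ := S'.kernel_memLp hA.measurableSet hqc hqi u K'.transpose
  set φ : ℝ → ℂ := fun y => (X y 0 1 - Y y 1 0) * (Y' y 0 1 - X' y 1 0)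
    - (Y y 0 1 - X y 1 0) * (X' y 0 1 - Y' y 1 0) with hφ
  -- The products of like kernels give the denominator λ − μ. The mixed ones give λ + μ, because a
  -- transposed solution for ū solves the equation for u with −λ.
  set Φ : ℝ → ℂ := fun y => (lam - mu)⁻¹ * ((X y * X' y).trace - (Y y * Y' y).trace)
    + (lam + mu)⁻¹ * (((Y y).transpose * X' y).trace - (X y * (Y' y).transpose).trace) with hΦ
  have hd : ∀ y, HasDerivAt Φ (Complex.I * φ y) y := fun y => by
    refine ((((lX.trace_mul_hasDerivAt lX' y).sub (lY.trace_mul_hasDerivAt lY' y)).const_mul _).add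
      (((lY.transpose.trace_mul_hasDerivAt lX' y).sub
        (lX.trace_mul_hasDerivAt lY'.transpose y)).const_mul _)).congr_deriv ?_
    simp only [hφ, Matrix.transpose_apply]
    field_simp
    ring
  have hφi : IntegrableOn φ A :=
    ((x01.sub y10).integrable_mul (y01'.sub x10')).sub ((y01.sub x10).integrable_mul (x01'.sub y10'))
  have tX := S.kernel_tendsto hc hi (cbar u) K
  have tY := S.kernel_swap_tendsto hqc hqi u K
  have tX' := S'.kernel_tendsto hc hi (cbar u) K'
  have tY' := S'.kernel_swap_tendsto hqc hqi u K'
  -- At the end X and Yᵀ have the same limit, so each difference of traces vanishes.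
  have hend : Tendsto Φ l (𝓝 0) := by
    have := (((tendsto_trace_mul tX tX').sub (tendsto_trace_mul tY tY')).const_mul (lam - mu)⁻¹).add
      (((tendsto_trace_mul (X := fun y => (Y y).transpose) (fun i j => tY j i) tX').sub
        (tendsto_trace_mul (Z := fun y => (Y' y).transpose) tX (fun i j => tY' j i))).const_mul
        (lam + mu)⁻¹)
    convert this using 2
    generalize S.R u * K * (S.R (cbar u)).transpose = E
    generalize S'.R u * K' * (S'.R (cbar u)).transpose = E'
    simp only [Matrix.trace, Matrix.diag, Matrix.mul_apply, Matrix.transpose_apply, Fin.sum_univ_two]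
    ring
  have hint := hA.integral_eq Φ _ hd (hφi.const_mul _) hend
  rw [integral_const_mul] at hint
  have e : ∫ x in Ioi (0 : ℝ), ((S.evenGrad β s).du 0 x * (S'.evenGrad β s).dub 0 x
      - (S.evenGrad β s).dub 0 x * (S'.evenGrad β s).du 0 x) = ∫ y in A, φ y := by
    rw [← setIntegral_indicator_eq hA]
    refine integral_congr_ae (Eventually.of_forall fun y => ?_)
    by_cases hy : y ∈ A
    · simp only [evenGrad, indicator_of_mem hy]
      rfl
    · simp [evenGrad, hy]
  rw [gradBracket, Finset.univ_unique, Finset.sum_singleton, Fin.default_eq_zero, e, hint]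
  simp only [hΦ]
  have X0 : X 0 = K * G := S.kernel_zero hc (cbar u) K
  have Y0 : Y 0 = K.transpose * G.transpose := S.kernel_swap_zero hqc u K
  have X0' : X' 0 = K' * G' := S'.kernel_zero hc (cbar u) K'
  have Y0' : Y' 0 = K'.transpose * G'.transpose := S'.kernel_swap_zero hqc u K'
  rw [X0, Y0, X0', Y0']
  -- The boundary contribution is the contraction of the bracket {K₁, K₂} with G and G', so the
  -- algebra of K can be substituted entry by entry.
  have hz : -Complex.I * Omega1 β s.2 * ((S.evenGrad β s).dz * (S'.evenGrad β s).dzb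
      - (S.evenGrad β s).dzb * (S'.evenGrad β s).dz) = ∑ a, ∑ b, ∑ c, ∑ d, G b a * G' d c *
        (-Complex.I * Omega1 β s.2 * (evenKz β s.2 a b * evenKzb β s.2 c d
          - evenKzb β s.2 a b * evenKz β s.2 c d)) := by
    change _ * ((evenKz β s.2 * G).trace * (evenKzb β s.2 * G').trace
      - (evenKzb β s.2 * G).trace * (evenKz β s.2 * G').trace) = _
    simp only [Matrix.trace, Matrix.diag, Matrix.mul_apply, Fin.sum_univ_two]
    ring
  rw [hz]
  simp only [alg, one_div]
  generalize (lam - mu)⁻¹ = α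
  generalize (lam + mu)⁻¹ = γ
  simp only [Matrix.trace, Matrix.diag, Matrix.mul_apply, Matrix.transpose_apply, Fin.sum_univ_two,
    Matrix.one_apply_eq, Matrix.one_apply_ne (zero_ne_one : (0 : Fin 2) ≠ 1),
    Matrix.one_apply_ne (one_ne_zero : (1 : Fin 2) ≠ 0)]
  ring

/-- Here u and û are independent fields, so no mixed products and no denominator λ + μ arise.
Accordingly the algebra of K contains only r(λ − μ), and λ = −μ is not exceptional. -/
theorem odd_gradBracket_eq_zero (hA : IsRange A l) {β ε : ℝ} (hε : ε = 1 ∨ ε = -1)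
    {s : PhasePoint 2} (hs : s ∈ phaseSpace 2 (oddDisc β)) (h1 : lam ≠ mu) :
    gradBracket (-2 * Complex.I * Omega2 β s.2) (S.oddGrad β ε s) (S'.oddGrad β ε s) = 0 := by
  have hc := (hs.1 0).continuous
  have hi := (hs.1 0).integrableOn
  have hqc := (hs.1 1).cbar.continuous
  have hqi := (hs.1 1).cbar.integrableOn
  have h1' : lam - mu ≠ 0 := sub_ne_zero.2 h1
  have alg := odd_algebra hε hs.2 h1
  set p := s.1 0
  set q := cbar (s.1 1)
  set K := oddKw β ε s.2 lam
  set K' := oddKw β ε s.2 mu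
  set G := (S.R q).transpose * S.R p with hG
  set G' := (S'.R q).transpose * S'.R p with hG'
  set X := S.kernel p q K with hX
  set Y := S.kernel q p K.transpose with hY
  set X' := S'.kernel p q K' with hX'
  set Y' := S'.kernel q p K'.transpose with hY'
  have lX : IsLax p lam X := S.kernel_isLax hc _ _
  have lY : IsLax q lam Y := S.kernel_isLax hqc _ _
  have lX' : IsLax p mu X' := S'.kernel_isLax hc _ _
  have lY' : IsLax q mu Y' := S'.kernel_isLax hqc _ _
  obtain ⟨x01, x10⟩ := S.kernel_memLp hA.measurableSet hc hi q K
  obtain ⟨y01, y10⟩ := S.kernel_memLp hA.measurableSet hqc hqi p K.transpose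
  obtain ⟨x01', x10'⟩ := S'.kernel_memLp hA.measurableSet hc hi q K'
  obtain ⟨y01', y10'⟩ := S'.kernel_memLp hA.measurableSet hqc hqi p K'.transpose
  set φ₀ : ℝ → ℂ := fun y => X y 0 1 * -X' y 1 0 - -X y 1 0 * X' y 0 1 with hφ₀
  set φ₁ : ℝ → ℂ := fun y => -Y y 1 0 * Y' y 0 1 - Y y 0 1 * -Y' y 1 0 with hφ₁
  set Φ : ℝ → ℂ := fun y => (lam - mu)⁻¹ * ((X y * X' y).trace - (Y y * Y' y).trace) with hΦ
  have hd : ∀ y, HasDerivAt Φ (Complex.I * (φ₀ y + φ₁ y)) y := fun y => by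
    refine (((lX.trace_mul_hasDerivAt lX' y).sub
      (lY.trace_mul_hasDerivAt lY' y)).const_mul _).congr_deriv ?_
    simp only [hφ₀, hφ₁]
    field_simp
    ring
  have hi₀ : IntegrableOn φ₀ A := (x01.integrable_mul x10'.neg).sub (x10.neg.integrable_mul x01')
  have hi₁ : IntegrableOn φ₁ A := (y10.neg.integrable_mul y01').sub (y01.integrable_mul y10'.neg)
  have tX := S.kernel_tendsto hc hi q K
  have tY := S.kernel_swap_tendsto hqc hqi p K
  have tX' := S'.kernel_tendsto hc hi q K'
  have tY' := S'.kernel_swap_tendsto hqc hqi p K'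
  have hend : Tendsto Φ l (𝓝 0) := by
    have := ((tendsto_trace_mul tX tX').sub (tendsto_trace_mul tY tY')).const_mul (lam - mu)⁻¹
    convert this using 2
    generalize S.R p * K * (S.R q).transpose = E
    generalize S'.R p * K' * (S'.R q).transpose = E'
    simp only [Matrix.trace, Matrix.diag, Matrix.mul_apply, Matrix.transpose_apply, Fin.sum_univ_two]
    ring
  have hint := hA.integral_eq Φ _ hd ((hi₀.add hi₁).const_mul _) hend
  rw [integral_const_mul, integral_add hi₀ hi₁] at hint
  have e₀ : ∫ x in Ioi (0 : ℝ), ((S.oddGrad β ε s).du 0 x * (S'.oddGrad β ε s).dub 0 x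
      - (S.oddGrad β ε s).dub 0 x * (S'.oddGrad β ε s).du 0 x) = ∫ y in A, φ₀ y := by
    rw [← setIntegral_indicator_eq hA]
    refine integral_congr_ae (Eventually.of_forall fun y => ?_)
    by_cases hy : y ∈ A
    · simp only [oddGrad, Matrix.cons_val_zero, indicator_of_mem hy]
      rfl
    · simp [oddGrad, hy]
  have e₁ : ∫ x in Ioi (0 : ℝ), ((S.oddGrad β ε s).du 1 x * (S'.oddGrad β ε s).dub 1 x
      - (S.oddGrad β ε s).dub 1 x * (S'.oddGrad β ε s).du 1 x) = ∫ y in A, φ₁ y := by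
    rw [← setIntegral_indicator_eq hA]
    refine integral_congr_ae (Eventually.of_forall fun y => ?_)
    by_cases hy : y ∈ A
    · simp only [oddGrad, Matrix.cons_val_one, Matrix.cons_val_zero, indicator_of_mem hy]
      rfl
    · simp [oddGrad, hy]
  rw [gradBracket, Fin.sum_univ_two, e₀, e₁, hint]
  simp only [hΦ]
  have X0 : X 0 = K * G := S.kernel_zero hc q K
  have Y0 : Y 0 = K.transpose * G.transpose := S.kernel_swap_zero hqc p K
  have X0' : X' 0 = K' * G' := S'.kernel_zero hc q K'
  have Y0' : Y' 0 = K'.transpose * G'.transpose := S'.kernel_swap_zero hqc p K'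
  rw [X0, Y0, X0', Y0']
  have hz : -2 * Complex.I * Omega2 β s.2 * ((S.oddGrad β ε s).dz * (S'.oddGrad β ε s).dzb
      - (S.oddGrad β ε s).dzb * (S'.oddGrad β ε s).dz) = ∑ a, ∑ b, ∑ c, ∑ d, G b a * G' d c *
        (-2 * Complex.I * Omega2 β s.2 * (oddKz β ε s.2 a b * oddKzb β ε s.2 c d
          - oddKzb β ε s.2 a b * oddKz β ε s.2 c d)) := by
    change _ * ((oddKz β ε s.2 * G).trace * (oddKzb β ε s.2 * G').trace
      - (oddKzb β ε s.2 * G).trace * (oddKz β ε s.2 * G').trace) = _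
    simp only [Matrix.trace, Matrix.diag, Matrix.mul_apply, Fin.sum_univ_two]
    ring
  rw [hz]
  simp only [alg, one_div]
  generalize (lam - mu)⁻¹ = α
  simp only [Matrix.trace, Matrix.diag, Matrix.mul_apply, Matrix.transpose_apply, Fin.sum_univ_two]
  ring

end Scattering

/-! ### The traces as functionals on phase space -/

theorem evenTrace_eq (β : ℝ) (lam : ℂ) {L : ℝ} (hL : 0 < L) (p : PhasePoint 1)
    (hp : ∀ i, HalfLineSchwartz (p.1 i)) :
    (((finiteScattering lam hL).R (p.1 0)) * evenK β p.2 lam *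
      ((finiteScattering lam hL).R (cbar (p.1 0))).transpose).trace = evenTrace β lam L p := by
  rw [evenTrace, tau_eq (hp 0).continuous]
  rfl

theorem oddTrace_eq (β ε : ℝ) (lam : ℂ) {L : ℝ} (hL : 0 < L) (p : PhasePoint 2)
    (hp : ∀ i, HalfLineSchwartz (p.1 i)) :
    (((finiteScattering lam hL).R (p.1 0)) * oddKw β ε p.2 lam *
      ((finiteScattering lam hL).R (cbar (p.1 1))).transpose).trace = oddTrace β ε lam L p := by
  rw [oddTrace, tau_eq (hp 1).continuous]
  rfl

theorem infiniteScattering_trace {lam : ℂ} (hl : lam.im < 0) {f fh : ℝ → ℂ}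
    (hf : HalfLineSchwartz f) (hfh : HalfLineSchwartz fh) (K : Mat2) :
    (((infiniteScattering hl).R f) * K * ((infiniteScattering hl).R (cbar fh)).transpose).trace =
      traceInf f fh K lam := by
  rw [traceInf_eq hf.continuous hf.integrableOn hfh.continuous hfh.integrableOn _ hl]
  simp only [infiniteScattering, Matrix.trace, Matrix.diag, Matrix.mul_apply,
    Matrix.transpose_apply, Fin.sum_univ_two]
  simp
  ring

/-- For finite `L` the trace is an odd function of `λ`. -/
theorem evenTrace_neg (β : ℝ) (lam : ℂ) (L : ℝ) (p : PhasePoint 1)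
    (hp : ∀ i, HalfLineSchwartz (p.1 i)) : evenTrace β (-lam) L p = -evenTrace β lam L p := by
  have hc := (hp 0).continuous
  simp only [evenTrace, tau, neg_neg]
  rw [Matrix.inv_def, Matrix.inv_def, transition_det hc, transition_det hc, Ring.inverse_one,
    one_smul, one_smul, Matrix.adjugate_fin_two, Matrix.adjugate_fin_two]
  generalize transition (p.1 0) lam L = T
  generalize transition (p.1 0) (-lam) L = T'
  -- The part of K independent of λ is traceless. Consequently τ(−λ) = −adj τ(λ), and in size 2 a
  -- matrix and its adjugate have the same trace.
  have hK : evenK β p.2 (-lam) = -(evenK β p.2 lam).adjugate := by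
    rw [Matrix.adjugate_fin_two]
    ext i j
    fin_cases i <;> fin_cases j <;> simp [evenK] <;> ring
  rw [hK, Matrix.adjugate_fin_two]
  generalize evenK β p.2 lam = K
  simp only [Matrix.trace, Matrix.diag, Matrix.mul_apply, Fin.sum_univ_two, Matrix.neg_apply]
  simp
  ring

theorem even_involution {β : ℝ} {θ : ℂ → ℂ}
    (hθ : ∀ z ∈ evenDisc β, θ z = -Complex.I * Omega1 β z) {s : PhasePoint 1}
    (hs : s ∈ phaseSpace 1 (evenDisc β)) :
    (∀ (lam mu : ℂ) (L : ℝ), 0 < L → HasBracket θ (evenTrace β lam L) (evenTrace β mu L) s 0) ∧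
      ∀ lam mu : ℂ, lam.im < 0 → mu.im < 0 →
        HasBracket θ (evenTraceInf β lam) (evenTraceInf β mu) s 0 := by
  constructor
  · intro lam mu L hL
    have hg := fun lam => ((finiteScattering lam hL).hasGradient_even (isRange_Ioc hL) hs).congr hs.1
      (evenTrace_eq β lam hL)
    rcases eq_or_ne lam mu with rfl | h1
    · exact ⟨_, _, hg _, hg _, gradBracket_self _ _⟩
    -- The pole at λ = −μ is avoided on [0, L] by oddness of the trace, which makes the two
    -- functionals opposite to each other.
    rcases eq_or_ne lam (-mu) with h2 | h2
    · have hm : mu = -lam := by rw [h2, neg_neg]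
      rw [hm]
      exact ⟨_, _, hg lam, (hg lam).opp.congr hs.1 fun p hp => (evenTrace_neg β lam L p hp).symm,
        gradBracket_opp _ _⟩
    · refine ⟨_, _, hg lam, hg mu, ?_⟩
      rw [hθ _ hs.2]
      exact Scattering.even_gradBracket_eq_zero _ _ (isRange_Ioc hL) hs h1 h2
  · intro lam mu hl hm
    have hg := fun lam (hl : lam.im < 0) => ((infiniteScattering hl).hasGradient_even
      isRange_Ioi hs).congr (F' := evenTraceInf β lam) hs.1
      fun p hp => infiniteScattering_trace hl (hp 0) (hp 0) _
    rcases eq_or_ne lam mu with rfl | h1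
    · exact ⟨_, _, hg _ hl, hg _ hl, gradBracket_self _ _⟩
    · refine ⟨_, _, hg lam hl, hg mu hm, ?_⟩
      rw [hθ _ hs.2]
      -- Two points of the lower half-plane are never opposite.
      refine Scattering.even_gradBracket_eq_zero _ _ isRange_Ioi hs h1 fun h => ?_
      rw [h, Complex.neg_im] at hl
      linarith

theorem odd_involution {β ε : ℝ} (hε : ε = 1 ∨ ε = -1) {θ : ℂ → ℂ}
    (hθ : ∀ z ∈ oddDisc β, θ z = -2 * Complex.I * Omega2 β z) {s : PhasePoint 2}
    (hs : s ∈ phaseSpace 2 (oddDisc β)) :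
    (∀ (lam mu : ℂ) (L : ℝ), 0 < L → HasBracket θ (oddTrace β ε lam L) (oddTrace β ε mu L) s 0) ∧
      ∀ lam mu : ℂ, lam.im < 0 → mu.im < 0 →
        HasBracket θ (oddTraceInf β ε lam) (oddTraceInf β ε mu) s 0 := by
  constructor
  · intro lam mu L hL
    have hg := fun lam => ((finiteScattering lam hL).hasGradient_odd (ε := ε) (isRange_Ioc hL)
      hs).congr hs.1 (oddTrace_eq β ε lam hL)
    rcases eq_or_ne lam mu with rfl | h1
    · exact ⟨_, _, hg _, hg _, gradBracket_self _ _⟩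
    · refine ⟨_, _, hg lam, hg mu, ?_⟩
      rw [hθ _ hs.2]
      exact Scattering.odd_gradBracket_eq_zero _ _ (isRange_Ioc hL) hε hs h1
  · intro lam mu hl hm
    have hg := fun lam (hl : lam.im < 0) => ((infiniteScattering hl).hasGradient_odd (ε := ε)
      isRange_Ioi hs).congr (F' := oddTraceInf β ε lam) hs.1
      fun p hp => infiniteScattering_trace hl (hp 0) (hp 1) _
    rcases eq_or_ne lam mu with rfl | h1
    · exact ⟨_, _, hg _ hl, hg _ hl, gradBracket_self _ _⟩
    · refine ⟨_, _, hg lam hl, hg mu hm, ?_⟩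
      rw [hθ _ hs.2]
      exact Scattering.odd_gradBracket_eq_zero _ _ isRange_Ioi hε hs h1

end NLSBoundary

end

theorem mainTheorem3 (k : ℕ) (hk : 1 ≤ k) (β : ℝ) (ε : ℝ) (hε : ε = 1 ∨ ε = -1) :
    -- the limits that define the monodromy matrix of the half-line exist
    ((∀ f : ℝ → ℂ, HalfLineSchwartz f → ∀ (lam : ℝ) (i j : Fin 2),
        Tendsto (fun L : ℝ => transitionNormalized f lam L i j) atTop
          (𝓝 (transitionInf f lam i j))) ∧
      (∀ f fh : ℝ → ℂ, HalfLineSchwartz f → HalfLineSchwartz fh →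
        ∀ (K : Mat2) (lam : ℂ), lam.im < 0 →
          Tendsto
            (fun L : ℝ => Complex.exp (-(Complex.I * lam * L)) * (tau f fh K lam L).trace) atTop
            (𝓝 (traceInf f fh K lam)))) ∧
    -- equations of even order
    (( -- boundary equation
      ∀ (J : Set ℝ) (u : ℝ → ℝ → ℂ), IsOpen J → IsHalfLineSolution (2 * k) J u →
        (∀ t ∈ J, u 0 t ∈ evenDisc β) →
        ∀ t ∈ J, (EvenBC k β u t ↔ EvenBoundaryEq k β u t)) ∧
      ( -- reflection algebra
      ∀ θ : ℂ → ℂ,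
        BoundaryBracket 1 (evenDisc β) θ (fun z => -Complex.I * Omega1 β z) ↔
          ReflectionAlgebra 1 (evenDisc β) θ (evenK β)) ∧
      ( -- conservation
      ∃ I : ℕ → PhasePoint 1 → ℂ,
        (∀ s ∈ phaseSpace 1 (evenDisc β),
          HasExpansion (fun lam => evenTraceInf β lam s) (fun n => I n s)) ∧
        ∀ (J : Set ℝ) (u : ℝ → ℝ → ℂ), IsOpen J → IsHalfLineSolution (2 * k) J u →
          (∀ t ∈ J, u 0 t ∈ evenDisc β) → (∀ t ∈ J, EvenBC k β u t) →
          ∀ t ∈ J,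
            (∀ lam : ℝ, HasDerivAt
              (fun r => (tauInf (fun x => u x r) (fun x => u x r)
                (evenK β (u 0 r) lam) lam).trace) 0 t) ∧
            (∀ lam : ℂ, lam.im < 0 →
              HasDerivAt (fun r => evenTraceInf β lam (evenState u r)) 0 t) ∧
            (∀ n : ℕ, HasDerivAt (fun r => I n (evenState u r)) 0 t)) ∧
      ( -- involution
      ∀ θ : ℂ → ℂ,
        BoundaryBracket 1 (evenDisc β) θ (fun z => -Complex.I * Omega1 β z) →
        ∀ s ∈ phaseSpace 1 (evenDisc β),
          (∀ (lam mu : ℂ) (L : ℝ), 0 < L →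
            HasBracket θ (evenTrace β lam L) (evenTrace β mu L) s 0) ∧
          (∀ lam mu : ℂ, lam.im < 0 → mu.im < 0 →
            HasBracket θ (evenTraceInf β lam) (evenTraceInf β mu) s 0))) ∧
    -- equations of odd order
    (( -- boundary equation
      ∀ (J : Set ℝ) (u : ℝ → ℝ → ℂ), IsOpen J → (∀ t ∈ J, -t ∈ J) →
        IsHalfLineSolution (2 * k + 1) J u →
        (∀ t ∈ J, ε * u 0 (-t) - u 0 t ∈ oddDisc β) →
        ∀ t ∈ J, (OddBC k β ε u t ↔ OddBoundaryEq k β ε u t)) ∧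
      ( -- Poisson algebra
      ∀ θ : ℂ → ℂ,
        BoundaryBracket 2 (oddDisc β) θ (fun w => -2 * Complex.I * Omega2 β w) ↔
          CommutatorAlgebra 2 (oddDisc β) θ (oddKw β ε)) ∧
      ( -- conservation
      ∃ I : ℕ → PhasePoint 2 → ℂ,
        (∀ s ∈ phaseSpace 2 (oddDisc β),
          HasExpansion (fun lam => oddTraceInf β ε lam s) (fun n => I n s)) ∧
        ∀ (J : Set ℝ) (u : ℝ → ℝ → ℂ), IsOpen J → (∀ t ∈ J, -t ∈ J) →
          IsHalfLineSolution (2 * k + 1) J u →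
          (∀ t ∈ J, ε * u 0 (-t) - u 0 t ∈ oddDisc β) → (∀ t ∈ J, OddBC k β ε u t) →
          ∀ t ∈ J,
            (∀ lam : ℝ, HasDerivAt
              (fun r => (tauInf (fun x => u x r) (fun x => u x (-r))
                (oddK β ε (u 0 r) (u 0 (-r)) lam) lam).trace) 0 t) ∧
            (∀ lam : ℂ, lam.im < 0 →
              HasDerivAt (fun r => oddTraceInf β ε lam (oddState ε u r)) 0 t) ∧
            (∀ n : ℕ, HasDerivAt (fun r => I n (oddState ε u r)) 0 t)) ∧
      ( -- involution
      ∀ θ : ℂ → ℂ,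
        BoundaryBracket 2 (oddDisc β) θ (fun w => -2 * Complex.I * Omega2 β w) →
        ∀ s ∈ phaseSpace 2 (oddDisc β),
          (∀ (lam mu : ℂ) (L : ℝ), 0 < L →
            HasBracket θ (oddTrace β ε lam L) (oddTrace β ε mu L) s 0) ∧
          (∀ lam mu : ℂ, lam.im < 0 → mu.im < 0 →
            HasBracket θ (oddTraceInf β ε lam) (oddTraceInf β ε mu) s 0))) := by
  refine ⟨⟨fun f hf lam i j => ?_, fun f fh hf hfh K lam hl => ?_⟩,
    ⟨fun J u hJ hu hD t ht => evenBoundaryEq_iff hJ hu ht (hD t ht), fun θ => ?_, ?_,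
      fun θ hθ s hs => even_involution (boundaryBracket_iff.1 hθ) hs⟩,
    ⟨fun J u hJ hJs hu hD t ht => oddBoundaryEq_iff hε hJ hJs hu ht (hD t ht), fun θ => ?_, ?_,
      fun θ hθ s hs => odd_involution hε (boundaryBracket_iff.1 hθ) hs⟩⟩
  · rw [transitionInf_eq hf.continuous hf.integrableOn]
    exact tendsto_transitionNormalized hf.continuous hf.integrableOn lam i j
  · rw [traceInf_eq hf.continuous hf.integrableOn hfh.continuous hfh.integrableOn K hl]
    exact tendsto_trace_tau hf.continuous hf.integrableOn hfh.continuous hfh.integrableOn K hl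
  · rw [boundaryBracket_iff, reflectionAlgebra_iff]
  · obtain ⟨I, hI, hcons⟩ := exists_conserved_coefficients (D := evenDisc β) (evenTraceInf β)
      fun s hs => traceInf_hasExpansion (hs.1 0) (hs.1 0) _ _
    refine ⟨I, hI, fun J u hJ hu hD hB => ?_⟩
    have hE : ∀ t ∈ J, EvenBoundaryEq k β u t := fun t ht =>
      (evenBoundaryEq_iff hJ hu ht (hD t ht)).1 (hB t ht)
    have hc : ∀ t ∈ J, ∀ lam : ℂ, lam.im < 0 →
        HasDerivAt (fun r => evenTraceInf β lam (evenState u r)) 0 t := fun t ht lam hl =>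
      evenTraceInf_hasDerivAt_zero hJ hu ht (hE t ht) hl
    refine fun t ht => ⟨even_trace_tauInf_hasDerivAt_zero hJ hu ht (hE t ht), hc t ht,
      hcons J (evenState u) hJ (fun t ht => ⟨fun i => ?_, hD t ht⟩) hc t ht⟩
    fin_cases i
    exact hu.schwartz hJ ht
  · rw [boundaryBracket_iff, commutatorAlgebra_iff hε]
  · obtain ⟨I, hI, hcons⟩ := exists_conserved_coefficients (D := oddDisc β) (oddTraceInf β ε)
      fun s hs => traceInf_hasExpansion (hs.1 0) (hs.1 1) _ _
    refine ⟨I, hI, fun J u hJ hJs hu hD hB => ?_⟩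
    have hE : ∀ t ∈ J, OddBoundaryEq k β ε u t := fun t ht =>
      (oddBoundaryEq_iff hε hJ hJs hu ht (hD t ht)).1 (hB t ht)
    have hc : ∀ t ∈ J, ∀ lam : ℂ, lam.im < 0 →
        HasDerivAt (fun r => oddTraceInf β ε lam (oddState ε u r)) 0 t := fun t ht lam hl =>
      oddTraceInf_hasDerivAt_zero hε hJ hJs hu ht (hE t ht) hl
    refine fun t ht => ⟨odd_trace_tauInf_hasDerivAt_zero hJ hJs hu ht (hE t ht), hc t ht,
      hcons J (oddState ε u) hJ (fun t ht => ⟨fun i => ?_, hD t ht⟩) hc t ht⟩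
    fin_cases i
    · exact hu.schwartz hJ ht
    · exact hu.schwartz hJ (hJs t ht)
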